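/- Let $p\colon E\to M$ be a fibred manifold (a surjective smooth submersion of smooth, Hausdorff, $\sigma$-compact manifolds without boundary), $\dim M=n$, $\dim E=n+m$, let $\mathbf v$ be a volume form on $M$, and let $\Lambda=L\,\mathbf v$, $L\in C^\infty(J^1E)$, be a Lagrangian density on the first jet bundle $p_1\colon J^1E\to M$. Write a fibred coordinate system as $(x^i,y^\alpha)$, the induced one on $J^1E$ as $(x^i,y^\alpha,y^\alpha_i)$, and $\Lambda=\ell\,dx^1\wedge\dots\wedge dx^n$. The Euler-Lagrange (E-L) operator has the components $\mathcal E_\alpha(s)=\frac{\partial \ell}{\partial y^\alpha}\circ j^1s-\frac{\partial}{\partial x^i}\bigl(\frac{\partial \ell}{\partial y^\alpha_i}\circ j^1s\bigr)$, and the Poincaré-Cartan form is $\Theta_\Lambda=\frac{\partial \ell}{\partial y^\alpha_i}\,(dy^\alpha-y^\alpha_j\,dx^j)\wedge i_{\partial/\partial x^i}(dx^1\wedge\dots\wedge dx^n)+\ell\,dx^1\wedge\dots\wedge dx^n$. Let $s\colon M\to E$ be an extremal, i.e. a smooth section of $p$ with $\mathcal E(s)=0$. The space $T_s\mathcal S_\Lambda$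 of Jacobi fields along $s$ consists of the smooth $p$-vertical vector fields $X$ along $s$ such that $\frac{\partial}{\partial t}\big|_{t=0}\mathcal E_\alpha(S_t)=0$ for the smooth one-parameter families $S_t$ of local sections of $p$ with $S_0=s$ and initial velocity $X$. For a section $\bar s$ of $p_1$ that solves the Hamilton-Cartan (H-C) equations $\bar s^*(i_Yd\Theta_\Lambda)=0$ (for all $p_1$-vertical vector fields $Y$ on $J^1E$), the tangent space $T_{\bar s}\bar{\mathcal S}_\Lambda$ consists of the smooth $p_1$-vertical vector fields $\bar X$ along $\bar s$ such that $\bar s^*(i_YL_{\tilde X}d\Theta_\Lambda)=0$ for all $p_1$-vertical vector fields $Y$ on $J^1E$, where $\tilde X$ is a $p_1$-vertical extension of $\bar X$ to $J^1E$. Then $j^1s$ is a solution to the H-C equations, the last condition for $\bar s=j^1s$ does not depend on the extension $\tilde X$, both $T_s\mathcal S_\Lambda$ and $T_{j^1s}\bar{\mathcal S}_\Lambda$ are real vector spaces, and there is a well-defined injective linear map $$T_s\mathcal S_\Lambda\hookrightarrow T_{j^1s}\bar{\mathcal S}_\Lambda,\qquad X\mapsto \tilde X^{(1)}\circ j^1s,$$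 where $\tilde X$ is any smooth $p$-vertical extension of $X$ to $E$ (such extensions exist) and $\tilde X^{(1)}$ is its $1$-jet prolongation: the smooth vector field on $J^1E$ that projects onto $\tilde X$ and leaves the contact system generated by the forms $dy^\alpha-y^\alpha_i\,dx^i$ invariant. If, moreover, $\Lambda$ is regular, i.e. at every point of $J^1E$ the Hessian of $L$ along the affine fibre of $J^1E\to E$ is non-singular, then this map is an isomorphism of vector spaces. -/

import Mathlib

open scoped Manifold ContDiff Topology

noncomputable section

namespace FibredJet

/-- The model space of the base manifold, with coordinates `xⁱ`. -/
abbrev Base (n : ℕ) := EuclideanSpace ℝ (Fin n)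
/-- The model space of the fibres, with coordinates `y^α`. -/
abbrev Fib (m : ℕ) := EuclideanSpace ℝ (Fin m)
/-- The model space of the total space, with coordinates `(xⁱ, y^α)`. -/
abbrev Tot (n m : ℕ) := Base n × Fib m
/-- The model space of the first jet bundle, with coordinates `((xⁱ, y^α), y^α_i)`; the last
component is the linear map with matrix `(y^α_i)`. -/
abbrev JetModel (n m : ℕ) := Tot n m × (Base n →L[ℝ] Fib m)

/-- `p : E → M` is a fibred manifold (a surjective smooth submersion), where `dim M = n` and
`dim E = n + m`. -/
class IsFibredManifold (n m : ℕ) {M E : Type*} [TopologicalSpace M] [ChartedSpace (Base n) M]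
    [TopologicalSpace E] [ChartedSpace (Tot n m) E] (p : E → M) : Prop where
  submersion : Manifold.IsSubmersion 𝓘(ℝ, Tot n m) 𝓘(ℝ, Base n) ∞ p
  surjective : Function.Surjective p

/-- A fibred coordinate system `(xⁱ, y^α)`: charts of the maximal atlases of `E` and `M` in which
`p` is the projection `(x, y) ↦ x`. -/
structure FibredChart (n m : ℕ) {M E : Type*} [TopologicalSpace M] [ChartedSpace (Base n) M]
    [TopologicalSpace E] [ChartedSpace (Tot n m) E] (p : E → M) where
  tot : OpenPartialHomeomorph E (Tot n m)
  base : OpenPartialHomeomorph M (Base n)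
  tot_mem : tot ∈ IsManifold.maximalAtlas 𝓘(ℝ, Tot n m) ∞ E
  base_mem : base ∈ IsManifold.maximalAtlas 𝓘(ℝ, Base n) ∞ M
  proj_mem : ∀ e ∈ tot.source, p e ∈ base.source
  fst_tot : ∀ e ∈ tot.source, (tot e).1 = base (p e)

/-- The first jet bundle `J¹E` of `p`, as a set. A jet `j¹ₓs` with `s x = e` is identified with the
linear section `s_* : TₓM → T_eE` of `p_* : T_eE → TₓM`, `x = p e`. -/
structure Jet1 (n m : ℕ) {M E : Type*} [TopologicalSpace M] [ChartedSpace (Base n) M]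
    [TopologicalSpace E] [ChartedSpace (Tot n m) E] (p : E → M) where
  pt : E
  hom : TangentSpace 𝓘(ℝ, Base n) (p pt) →L[ℝ] TangentSpace 𝓘(ℝ, Tot n m) pt
  proj_comp : (mfderiv 𝓘(ℝ, Tot n m) 𝓘(ℝ, Base n) p pt).comp hom =
    ContinuousLinearMap.id ℝ (TangentSpace 𝓘(ℝ, Base n) (p pt))

theorem Jet1.ext_of {n m : ℕ} {M E : Type*} [TopologicalSpace M] [ChartedSpace (Base n) M]
    [TopologicalSpace E] [ChartedSpace (Tot n m) E] {p : E → M} {j k : Jet1 n m p}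
    (h : j.pt = k.pt) (hh : ∀ u : Base n, (j.hom u : Tot n m) = k.hom u) : j = k := by
  obtain ⟨e, A, hA⟩ := j
  obtain ⟨e', B, hB⟩ := k
  obtain rfl : e = e' := h
  have : A = B := ContinuousLinearMap.ext hh
  subst this
  rfl

section Charts

variable {n m : ℕ} {M E : Type*} [TopologicalSpace M] [ChartedSpace (Base n) M]
    [TopologicalSpace E] [ChartedSpace (Tot n m) E] {p : E → M}

theorem exists_fibredChart [IsManifold 𝓘(ℝ, Tot n m) ∞ E]
   [IsFibredManifold n m p] (e : E) : ∃ c : FibredChart n m p, e ∈ c.tot.source := by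
  have h := (IsFibredManifold.submersion (n := n) (m := m) (p := p)).isSubmersionAt e
  let F := h.complement
  let A : Tot n m ≃L[ℝ] Base n × F := h.equiv
  have : FiniteDimensional ℝ (Base n × F) := A.toLinearEquiv.finiteDimensional
  have : FiniteDimensional ℝ F :=
    FiniteDimensional.of_surjective (LinearMap.snd ℝ (Base n) F) (LinearMap.snd_surjective)
  have hr : Module.finrank ℝ F = Module.finrank ℝ (Fib m) := by
    have := A.toLinearEquiv.finrank_eq
    rw [Module.finrank_prod, Module.finrank_prod] at this
    omega
  let B : F ≃L[ℝ] Fib m := ContinuousLinearEquiv.ofFinrankEq hr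
  let D : Tot n m ≃L[ℝ] Tot n m := A.trans ((ContinuousLinearEquiv.refl ℝ (Base n)).prodCongr B)
  have hw : ∀ z ∈ h.domChart.target, h.codChart (p (h.domChart.symm z)) = (A z).1 := by
    intro z hz
    have := h.writtenInCharts (show z ∈ (h.domChart.extend 𝓘(ℝ, Tot n m)).target by simpa using hz)
    simpa using this
  refine ⟨⟨h.domChart.transHomeomorph D.toHomeomorph, h.codChart, ?_,
    h.codChart_mem_maximalAtlas, ?_, ?_⟩, ?_⟩
  · apply OpenPartialHomeomorph.mem_maximalAtlas_of_contMDiffOn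
    · have h1 := contMDiffOn_of_mem_maximalAtlas h.domChart_mem_maximalAtlas
      exact (D.contDiff.contMDiff (n := ∞)).comp_contMDiffOn h1
    · have h1 := contMDiffOn_symm_of_mem_maximalAtlas h.domChart_mem_maximalAtlas
      have h2 := (D.symm.contDiff.contMDiff (n := ∞))
      refine h1.comp h2.contMDiffOn ?_
      intro x hx
      simpa using hx
  · intro e he
    exact h.source_subset_preimage_source (by simpa using he)
  · intro e he
    have he' : e ∈ h.domChart.source := by simpa using he
    have := hw _ (h.domChart.map_source he')
    rw [h.domChart.left_inv he'] at this
    rw [this]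
    rfl
  · simpa using h.mem_domChart_source

namespace FibredChart

variable (c : FibredChart n m p)

theorem tot_mdiff : c.tot.MDifferentiable 𝓘(ℝ, Tot n m) 𝓘(ℝ, Tot n m) :=
  ⟨(contMDiffOn_of_mem_maximalAtlas c.tot_mem).mdifferentiableOn (by simp),
    (contMDiffOn_symm_of_mem_maximalAtlas c.tot_mem).mdifferentiableOn (by simp)⟩

theorem base_mdiff : c.base.MDifferentiable 𝓘(ℝ, Base n) 𝓘(ℝ, Base n) :=
  ⟨(contMDiffOn_of_mem_maximalAtlas c.base_mem).mdifferentiableOn (by simp),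
    (contMDiffOn_symm_of_mem_maximalAtlas c.base_mem).mdifferentiableOn (by simp)⟩

/-- The coordinates `y^α_i` of a jet in the coordinate system induced by a fibred chart. -/
def slope (j : Jet1 n m p) : Base n →L[ℝ] Fib m :=
  (ContinuousLinearMap.snd ℝ (Base n) (Fib m)).comp
    ((mfderiv 𝓘(ℝ, Tot n m) 𝓘(ℝ, Tot n m) c.tot j.pt).comp
      (j.hom.comp (mfderiv 𝓘(ℝ, Base n) 𝓘(ℝ, Base n) c.base.symm (c.base (p j.pt)))))

/-- The linear section with the coordinates `z`, that is `∂/∂xⁱ ↦ ∂/∂xⁱ + y^α_i ∂/∂y^α`. -/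
def homOf (z : JetModel n m) :
    TangentSpace 𝓘(ℝ, Base n) (p (c.tot.symm z.1)) →L[ℝ]
      TangentSpace 𝓘(ℝ, Tot n m) (c.tot.symm z.1) :=
  (mfderiv 𝓘(ℝ, Tot n m) 𝓘(ℝ, Tot n m) c.tot.symm z.1).comp
    (((ContinuousLinearMap.id ℝ (Base n)).prod z.2).comp
      (mfderiv 𝓘(ℝ, Base n) 𝓘(ℝ, Base n) c.base (p (c.tot.symm z.1))))

theorem fst_mem {z : Tot n m} (hz : z ∈ c.tot.target) : z.1 ∈ c.base.target := by
  have h := c.fst_tot _ (c.tot.map_target hz)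
  rw [c.tot.right_inv hz] at h
  rw [h]
  exact c.base.map_source (c.proj_mem _ (c.tot.map_target hz))

theorem proj_symm {z : Tot n m} (hz : z ∈ c.tot.target) :
    p (c.tot.symm z) = c.base.symm z.1 := by
  have h := c.fst_tot _ (c.tot.map_target hz)
  rw [c.tot.right_inv hz] at h
  rw [h, c.base.left_inv (c.proj_mem _ (c.tot.map_target hz))]

theorem base_proj_symm {z : Tot n m} (hz : z ∈ c.tot.target) :
    c.base (p (c.tot.symm z)) = z.1 := by
  have h := c.fst_tot _ (c.tot.map_target hz)
  rw [c.tot.right_inv hz] at h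
  exact h.symm

theorem mdiff_proj {e : E} (he : e ∈ c.tot.source) :
    MDifferentiableAt 𝓘(ℝ, Tot n m) 𝓘(ℝ, Base n) p e := by
  have h1 : MDifferentiableAt 𝓘(ℝ, Tot n m) 𝓘(ℝ, Base n)
      (fun e' => c.base.symm (c.tot e').1) e := by
    have ha := c.tot_mdiff.mdifferentiableAt he
    have hb : MDifferentiableAt 𝓘(ℝ, Tot n m) 𝓘(ℝ, Base n)
        (fun z : Tot n m => z.1) (c.tot e) :=
      (ContinuousLinearMap.fst ℝ (Base n) (Fib m)).differentiableAt.mdifferentiableAt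
    have hc := c.base_mdiff.mdifferentiableAt_symm (c.fst_mem (c.tot.map_source he))
    exact hc.comp e (hb.comp e ha)
  refine h1.congr_of_eventuallyEq ?_
  filter_upwards [c.tot.open_source.mem_nhds he] with e' he'
  rw [c.fst_tot _ he', c.base.left_inv (c.proj_mem _ he')]

theorem mfderiv_base_proj {e : E} (he : e ∈ c.tot.source) :
    (mfderiv 𝓘(ℝ, Base n) 𝓘(ℝ, Base n) c.base (p e)).comp
      (mfderiv 𝓘(ℝ, Tot n m) 𝓘(ℝ, Base n) p e) =
    (ContinuousLinearMap.fst ℝ (Base n) (Fib m)).comp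
      (mfderiv 𝓘(ℝ, Tot n m) 𝓘(ℝ, Tot n m) c.tot e) := by
  have ha := c.tot_mdiff.mdifferentiableAt he
  have hb : HasMFDerivAt 𝓘(ℝ, Tot n m) 𝓘(ℝ, Base n)
      (fun z : Tot n m => z.1) (c.tot e) (ContinuousLinearMap.fst ℝ (Base n) (Fib m)) :=
    (ContinuousLinearMap.fst ℝ (Base n) (Fib m)).hasFDerivAt.hasMFDerivAt
  have h1 := hb.comp e ha.hasMFDerivAt
  have h2 := ((c.base_mdiff.mdifferentiableAt (c.proj_mem _ he)).hasMFDerivAt).comp e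
    (c.mdiff_proj he).hasMFDerivAt
  have h3 : c.base ∘ p =ᶠ[𝓝 e] (fun z : Tot n m => z.1) ∘ c.tot := by
    filter_upwards [c.tot.open_source.mem_nhds he] with e' he'
    exact (c.fst_tot _ he').symm
  exact (hasMFDerivAt_unique (h1.congr_of_eventuallyEq h3) h2).symm

theorem homOf_proj (z : JetModel n m) (hz : z.1 ∈ c.tot.target) :
    (mfderiv 𝓘(ℝ, Tot n m) 𝓘(ℝ, Base n) p (c.tot.symm z.1)).comp (c.homOf z) =
      ContinuousLinearMap.id ℝ (TangentSpace 𝓘(ℝ, Base n) (p (c.tot.symm z.1))) := by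
  have he := c.tot.map_target hz
  have hp := c.proj_mem _ he
  have h1 := c.mfderiv_base_proj he
  have h2 := c.base_mdiff.symm_comp_deriv hp
  have h3 := c.tot_mdiff.comp_symm_deriv hz
  ext u
  let w : Tot n m := c.homOf z u
  have h8 : mfderiv 𝓘(ℝ, Tot n m) 𝓘(ℝ, Tot n m) c.tot (c.tot.symm z.1) w =
      ((ContinuousLinearMap.id ℝ (Base n)).prod z.2)
        (mfderiv 𝓘(ℝ, Base n) 𝓘(ℝ, Base n) c.base (p (c.tot.symm z.1)) u) :=
    DFunLike.congr_fun h3 (((ContinuousLinearMap.id ℝ (Base n)).prod z.2)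
      (mfderiv 𝓘(ℝ, Base n) 𝓘(ℝ, Base n) c.base (p (c.tot.symm z.1)) u))
  have h5 : mfderiv 𝓘(ℝ, Base n) 𝓘(ℝ, Base n) c.base (p (c.tot.symm z.1))
      (mfderiv 𝓘(ℝ, Tot n m) 𝓘(ℝ, Base n) p (c.tot.symm z.1) w) =
      mfderiv 𝓘(ℝ, Base n) 𝓘(ℝ, Base n) c.base (p (c.tot.symm z.1)) u :=
    (DFunLike.congr_fun h1 w).trans (congrArg Prod.fst h8)
  have h9 := DFunLike.congr_fun h2 (mfderiv 𝓘(ℝ, Tot n m) 𝓘(ℝ, Base n) p (c.tot.symm z.1) w)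
  have h6 := DFunLike.congr_fun h2 u
  have h10 : mfderiv 𝓘(ℝ, Tot n m) 𝓘(ℝ, Base n) p (c.tot.symm z.1) w = u :=
    h9.symm.trans ((congrArg (mfderiv 𝓘(ℝ, Base n) 𝓘(ℝ, Base n) c.base.symm
      (c.base (p (c.tot.symm z.1)))) h5).trans h6)
  exact h10

/-- The jet with the coordinates `z`. -/
def jetAt (z : JetModel n m) (hz : z.1 ∈ c.tot.target) : Jet1 n m p :=
  ⟨c.tot.symm z.1, c.homOf z, c.homOf_proj z hz⟩

theorem slope_jetAt (z : JetModel n m) (hz : z.1 ∈ c.tot.target) :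
    c.slope (c.jetAt z hz) = z.2 := by
  have he := c.tot.map_target hz
  have hp := c.proj_mem _ he
  have hq := c.base.map_source hp
  have h3 := c.tot_mdiff.comp_symm_deriv hz
  have h2 := c.base_mdiff.comp_symm_deriv hq
  rw [c.base.left_inv hp] at h2
  ext1 u
  have h5 := DFunLike.congr_fun h2 u
  have h7 := DFunLike.congr_fun h3 (((ContinuousLinearMap.id ℝ (Base n)).prod z.2)
      (mfderiv 𝓘(ℝ, Base n) 𝓘(ℝ, Base n) c.base (p (c.tot.symm z.1))
        (mfderiv 𝓘(ℝ, Base n) 𝓘(ℝ, Base n) c.base.symm (c.base (p (c.tot.symm z.1))) u)))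
  refine (congrArg Prod.snd h7).trans ?_
  exact congrArg z.2 h5

theorem jetAt_slope (j : Jet1 n m p) (hj : j.pt ∈ c.tot.source) :
    c.jetAt (c.tot j.pt, c.slope j) (c.tot.map_source hj) = j := by
  have hp := c.proj_mem _ hj
  have h1 := c.mfderiv_base_proj hj
  have h2 := c.base_mdiff.symm_comp_deriv hp
  have h3 := c.tot_mdiff.symm_comp_deriv hj
  refine Jet1.ext_of (c.tot.left_inv hj) fun u => ?_
  let D : M → (Base n →L[ℝ] Base n) := fun x => mfderiv 𝓘(ℝ, Base n) 𝓘(ℝ, Base n) c.base x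
  have hD : D (p (c.tot.symm (c.tot j.pt))) = D (p j.pt) := by rw [c.tot.left_inv hj]
  have h4 := DFunLike.congr_fun h1 (j.hom u)
  have h5 := DFunLike.congr_fun j.proj_comp u
  have h6 := DFunLike.congr_fun h2 u
  have h7 := DFunLike.congr_fun h3 (j.hom u)
  refine Eq.trans ?_ h7
  refine congrArg (mfderiv 𝓘(ℝ, Tot n m) 𝓘(ℝ, Tot n m) c.tot.symm (c.tot j.pt)) ?_
  change ((ContinuousLinearMap.id ℝ (Base n)).prod (c.slope j))
    (D (p (c.tot.symm (c.tot j.pt))) u) = _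
  rw [hD]
  refine Prod.ext ?_ ?_
  · refine Eq.trans ?_ h4
    exact (congrArg (D (p j.pt)) h5).symm
  · change (mfderiv 𝓘(ℝ, Tot n m) 𝓘(ℝ, Tot n m) c.tot j.pt (j.hom
      (mfderiv 𝓘(ℝ, Base n) 𝓘(ℝ, Base n) c.base.symm (c.base (p j.pt)) (D (p j.pt) u)))).2 = _
    exact congrArg (fun w => (mfderiv 𝓘(ℝ, Tot n m) 𝓘(ℝ, Tot n m) c.tot j.pt (j.hom w)).2) h6

variable [IsManifold 𝓘(ℝ, Tot n m) ∞ E] [IsFibredManifold n m p]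

theorem nonempty_jet1 (c : FibredChart n m p) : Nonempty (Jet1 n m p) := by
  obtain ⟨d, hd⟩ := exists_fibredChart (p := p) (n := n) (m := m) (c.tot.symm 0)
  exact ⟨d.jetAt (d.tot (c.tot.symm 0), 0) (d.tot.map_source hd)⟩

open Classical in
/-- The coordinate system `(xⁱ, y^α, y^α_i)` of `J¹E` induced by a fibred chart, defined on the
inverse image of the domain of the chart. -/
def jet : PartialEquiv (Jet1 n m p) (JetModel n m) where
  toFun j := (c.tot j.pt, c.slope j)
  invFun z := if hz : z.1 ∈ c.tot.target then c.jetAt z hz else Classical.choice c.nonempty_jet1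
  source := {j | j.pt ∈ c.tot.source}
  target := {z | z.1 ∈ c.tot.target}
  map_source' j hj := c.tot.map_source hj
  map_target' z hz := by
    simp only [Set.mem_ofPred_eq] at hz ⊢
    rw [dif_pos hz]
    exact c.tot.map_target hz
  left_inv' j hj := by
    have h : c.tot j.pt ∈ c.tot.target := c.tot.map_source hj
    rw [dif_pos h]
    exact c.jetAt_slope j hj
  right_inv' z hz := by
    simp only [Set.mem_ofPred_eq] at hz
    rw [dif_pos hz]
    exact Prod.ext (c.tot.right_inv hz) (c.slope_jetAt z hz)

theorem jet_symm_apply {z : JetModel n m} (hz : z.1 ∈ c.tot.target) :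
    c.jet.symm z = c.jetAt z hz := dif_pos hz

theorem jet_trans_source (d : FibredChart n m p) :
    (c.jet.symm.trans d.jet).source = (c.tot.symm.trans d.tot).source ×ˢ Set.univ := by
  ext z
  simp only [PartialEquiv.trans_source, PartialEquiv.symm_source, Set.mem_inter_iff,
    Set.mem_preimage, Set.mem_prod, Set.mem_univ, and_true, OpenPartialHomeomorph.trans_source,
    OpenPartialHomeomorph.symm_source]
  refine and_congr_right fun hz => ?_
  change (c.jet.symm z).pt ∈ d.tot.source ↔ _
  rw [c.jet_symm_apply hz]
  rfl

theorem jet_trans_apply (d : FibredChart n m p) {z : JetModel n m}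
    (hz : z.1 ∈ (c.tot.symm.trans d.tot).source) :
    (c.jet.symm.trans d.jet) z = ((c.tot.symm.trans d.tot) z.1,
      (ContinuousLinearMap.snd ℝ (Base n) (Fib m)).comp
        ((fderiv ℝ (c.tot.symm.trans d.tot) z.1).comp
          ((ContinuousLinearMap.inl ℝ (Base n) (Fib m) +
            (ContinuousLinearMap.inr ℝ (Base n) (Fib m)).comp z.2).comp
          (fderiv ℝ (d.base.symm.trans c.base) ((c.tot.symm.trans d.tot) z.1).1)))) := by
  have hz1 : z.1 ∈ c.tot.target := hz.1
  have hz2 : c.tot.symm z.1 ∈ d.tot.source := hz.2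
  have hc := c.proj_mem _ (c.tot.map_target hz1)
  have hd := d.proj_mem _ hz2
  have e1 : ((c.tot.symm.trans d.tot) z.1).1 = d.base (p (c.tot.symm z.1)) := d.fst_tot _ hz2
  have hl := d.base.left_inv hd
  have hc' : d.base.symm (d.base (p (c.tot.symm z.1))) ∈ c.base.source := by rwa [hl]
  have A : fderiv ℝ (c.tot.symm.trans d.tot) z.1 =
      (mfderiv 𝓘(ℝ, Tot n m) 𝓘(ℝ, Tot n m) d.tot (c.tot.symm z.1)).comp
        (mfderiv 𝓘(ℝ, Tot n m) 𝓘(ℝ, Tot n m) c.tot.symm z.1) := by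
    rw [← mfderiv_eq_fderiv]
    exact mfderiv_comp _ (d.tot_mdiff.mdifferentiableAt hz2)
      (c.tot_mdiff.mdifferentiableAt_symm hz1)
  have B : fderiv ℝ (d.base.symm.trans c.base) (d.base (p (c.tot.symm z.1))) =
      (mfderiv 𝓘(ℝ, Base n) 𝓘(ℝ, Base n) c.base
          (d.base.symm (d.base (p (c.tot.symm z.1))))).comp
        (mfderiv 𝓘(ℝ, Base n) 𝓘(ℝ, Base n) d.base.symm (d.base (p (c.tot.symm z.1)))) := by
    rw [← mfderiv_eq_fderiv]
    exact mfderiv_comp _ (c.base_mdiff.mdifferentiableAt hc')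
      (d.base_mdiff.mdifferentiableAt_symm (d.base.map_source hd))
  rw [e1, A, B]
  change d.jet (c.jet.symm z) = _
  rw [c.jet_symm_apply hz1]
  refine Prod.ext rfl ?_
  ext1 u
  let D : M → (Base n →L[ℝ] Base n) := fun x => mfderiv 𝓘(ℝ, Base n) 𝓘(ℝ, Base n) c.base x
  have hD : D (d.base.symm (d.base (p (c.tot.symm z.1)))) = D (p (c.tot.symm z.1)) := by rw [hl]
  let w : Base n := mfderiv 𝓘(ℝ, Base n) 𝓘(ℝ, Base n) d.base.symm (d.base (p (c.tot.symm z.1))) u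
  change ((mfderiv 𝓘(ℝ, Tot n m) 𝓘(ℝ, Tot n m) d.tot (c.tot.symm z.1))
    (mfderiv 𝓘(ℝ, Tot n m) 𝓘(ℝ, Tot n m) c.tot.symm z.1
      (((ContinuousLinearMap.id ℝ (Base n)).prod z.2) (D (p (c.tot.symm z.1)) w)))).2 =
    ((mfderiv 𝓘(ℝ, Tot n m) 𝓘(ℝ, Tot n m) d.tot (c.tot.symm z.1))
    (mfderiv 𝓘(ℝ, Tot n m) 𝓘(ℝ, Tot n m) c.tot.symm z.1
      ((ContinuousLinearMap.inl ℝ (Base n) (Fib m) +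
            (ContinuousLinearMap.inr ℝ (Base n) (Fib m)).comp z.2)
              (D (d.base.symm (d.base (p (c.tot.symm z.1)))) w)))).2
  rw [hD]
  have : ∀ y : Base n, ((ContinuousLinearMap.id ℝ (Base n)).prod z.2) y =
     (ContinuousLinearMap.inl ℝ (Base n) (Fib m) +
            (ContinuousLinearMap.inr ℝ (Base n) (Fib m)).comp z.2) y := by
    intro y; simp
  rw [this]

theorem contDiffOn_jet_trans (d : FibredChart n m p) :
    ContDiffOn ℝ ∞ (c.jet.symm.trans d.jet) (c.jet.symm.trans d.jet).source := by
  rw [c.jet_trans_source d]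
  have hT : ContDiffOn ℝ ∞ (c.tot.symm.trans d.tot) (c.tot.symm.trans d.tot).source := by
    rw [← contMDiffOn_iff_contDiffOn]
    exact (contMDiffOn_of_mem_maximalAtlas d.tot_mem).comp
      ((contMDiffOn_symm_of_mem_maximalAtlas c.tot_mem).mono fun _ h => h.1) fun _ h => h.2
  have hB : ContDiffOn ℝ ∞ (d.base.symm.trans c.base) (d.base.symm.trans c.base).source := by
    rw [← contMDiffOn_iff_contDiffOn]
    exact (contMDiffOn_of_mem_maximalAtlas c.base_mem).comp
      ((contMDiffOn_symm_of_mem_maximalAtlas d.base_mem).mono fun _ h => h.1) fun _ h => h.2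
  have hT' := hT.fderiv_of_isOpen (m := ∞) (c.tot.symm.trans d.tot).open_source (by simp)
  have hB' := hB.fderiv_of_isOpen (m := ∞) (d.base.symm.trans c.base).open_source (by simp)
  have hfst : Set.MapsTo (Prod.fst : JetModel n m → Tot n m)
      ((c.tot.symm.trans d.tot).source ×ˢ Set.univ) (c.tot.symm.trans d.tot).source :=
    fun z hz => hz.1
  have hT1 := hT.comp (contDiff_fst (𝕜 := ℝ) (E := Tot n m)
    (F := Base n →L[ℝ] Fib m)).contDiffOn hfst
  have hT2 := hT'.comp (contDiff_fst (𝕜 := ℝ) (E := Tot n m)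
    (F := Base n →L[ℝ] Fib m)).contDiffOn hfst
  have hB2 := hB'.comp (contDiff_fst.comp_contDiffOn hT1) (by
    intro z hz
    have h2 : c.tot.symm z.1 ∈ d.tot.source := hz.1.2
    have h1 : z.1 ∈ c.tot.target := hz.1.1
    have e1 : d.base (p (c.tot.symm z.1)) = (d.tot (c.tot.symm z.1)).1 := (d.fst_tot _ h2).symm
    have hp := d.proj_mem _ h2
    change (d.tot (c.tot.symm z.1)).1 ∈ _
    rw [← e1]
    refine ⟨d.base.map_source hp, ?_⟩
    change d.base.symm (d.base (p (c.tot.symm z.1))) ∈ c.base.source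
    rw [d.base.left_inv hp]
    exact c.proj_mem _ (c.tot.map_target h1))
  have hM : ContDiff ℝ ∞ (fun z : JetModel n m => ContinuousLinearMap.inl ℝ (Base n) (Fib m) +
            (ContinuousLinearMap.inr ℝ (Base n) (Fib m)).comp z.2) :=
    contDiff_const.add (contDiff_const.clm_comp contDiff_snd)
  have := hT1.prodMk (contDiff_const.contDiffOn.clm_comp (hT2.clm_comp
    (hM.contDiffOn.clm_comp hB2)) :
      ContDiffOn ℝ ∞ (fun z : JetModel n m => (ContinuousLinearMap.snd ℝ (Base n) (Fib m)).comp _) _)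
  exact this.congr fun z hz => c.jet_trans_apply d hz.1

end FibredChart

section Jet

variable [IsManifold 𝓘(ℝ, Tot n m) ∞ E] [IsFibredManifold n m p]

/-- A choice of a fibred chart around each point. -/
def fibredChartAt (e : E) : FibredChart n m p := Classical.choose (exists_fibredChart e)

variable (n m p) in
/-- The atlas of `J¹E`: the coordinate systems induced by all fibred charts. -/
def jetCore : ChartedSpaceCore (JetModel n m) (Jet1 n m p) where
  atlas := Set.range fun c : FibredChart n m p => c.jet
  chartAt j := (fibredChartAt j.pt).jet
  mem_chart_source j := Classical.choose_spec (exists_fibredChart (p := p) j.pt)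
  chart_mem_atlas j := ⟨_, rfl⟩
  open_source := by
    rintro _ _ ⟨c, rfl⟩ ⟨d, rfl⟩
    rw [c.jet_trans_source d]
    exact (c.tot.symm.trans d.tot).open_source.prod isOpen_univ
  continuousOn_toFun := by
    rintro _ _ ⟨c, rfl⟩ ⟨d, rfl⟩
    exact (c.contDiffOn_jet_trans d).continuousOn

instance : TopologicalSpace (Jet1 n m p) := (jetCore n m p).toTopologicalSpace

instance : ChartedSpace (JetModel n m) (Jet1 n m p) := (jetCore n m p).toChartedSpace

instance : IsManifold 𝓘(ℝ, JetModel n m) ∞ (Jet1 n m p) := by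
  apply isManifold_of_contDiffOn
  intro e e' he he'
  change e ∈ ⋃ (e : PartialEquiv (Jet1 n m p) (JetModel n m)) (he : e ∈ (jetCore n m p).atlas),
    {(jetCore n m p).openPartialHomeomorph e he} at he
  change e' ∈ ⋃ (e : PartialEquiv (Jet1 n m p) (JetModel n m)) (he : e ∈ (jetCore n m p).atlas),
    {(jetCore n m p).openPartialHomeomorph e he} at he'
  simp only [Set.mem_iUnion, Set.mem_singleton_iff] at he he'
  obtain ⟨_, ⟨c, rfl⟩, rfl⟩ := he
  obtain ⟨_, ⟨d, rfl⟩, rfl⟩ := he'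
  have h := c.contDiffOn_jet_trans d
  simp only [modelWithCornersSelf_coe, modelWithCornersSelf_coe_symm, Function.comp_id,
    Function.id_comp, Set.preimage_id, Set.range_id, Set.inter_univ]
  exact h

end Jet

end Charts

section Forms

open Classical in
/-- `(w₁, …, w_k) ↦ ∑ᵢ μ(π w₁, …, A wᵢ, …, π w_k)` as an alternating form.
If `A = ∑ᵢ αᵢ ⊗ eᵢ` with covectors `αᵢ` and vectors `eᵢ`, this is `∑ᵢ αᵢ ∧ π^*(i_{eᵢ} μ)`. -/
def slotSum {k : ℕ} {V W : Type*} [NormedAddCommGroup V] [NormedSpace ℝ V]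
    [NormedAddCommGroup W] [NormedSpace ℝ W]
    (μ : W [⋀^Fin k]→L[ℝ] ℝ) (π A : V →L[ℝ] W) : V [⋀^Fin k]→L[ℝ] ℝ where
  toContinuousMultilinearMap := ∑ i, μ.toContinuousMultilinearMap.compContinuousLinearMap
    fun j => if j = i then A else π
  map_eq_zero_of_eq' := by
    intro x a b hab hne
    change (∑ i, μ.toContinuousMultilinearMap.compContinuousLinearMap
      fun j => if j = i then A else π) x = 0
    rw [sum_apply]
    have hf : ∀ i, (μ.toContinuousMultilinearMap.compContinuousLinearMap
        fun j => if j = i then A else π) x =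
        μ (fun j => (if j = i then A else π) (x j)) := fun i => rfl
    simp only [hf]
    rw [← Finset.add_sum_erase _ _ (Finset.mem_univ a),
      ← Finset.add_sum_erase _ _ (Finset.mem_erase.2 ⟨hne.symm, Finset.mem_univ b⟩),
      Finset.sum_eq_zero, add_zero]
    · have h1 : (fun j => (if j = b then A else π) (x j)) =
          (fun j => (if j = a then A else π) (x j)) ∘ Equiv.swap a b := by
        funext j
        rcases eq_or_ne j a with rfl | hja
        · simp [hne, hne.symm, hab]
        · rcases eq_or_ne j b with rfl | hjb
          · simp [hab]
          · simp [Equiv.swap_apply_of_ne_of_ne hja hjb, hja, hjb]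
      have h2 := μ.toAlternatingMap.map_swap (fun j => (if j = a then A else π) (x j)) hne
      rw [h1]
      exact (congrArg (_ + ·) h2).trans (add_neg_cancel _)
    · intro i hi
      simp only [Finset.mem_erase, Finset.mem_univ, and_true] at hi
      refine μ.map_eq_zero_of_eq _ ?_ hne
      simp [hi.1.symm, hi.2.symm, hab]

theorem slotSum_apply {k : ℕ} {V W : Type*} [NormedAddCommGroup V] [NormedSpace ℝ V]
    [NormedAddCommGroup W] [NormedSpace ℝ W]
    (μ : W [⋀^Fin k]→L[ℝ] ℝ) (π A : V →L[ℝ] W) (w : Fin k → V) :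
    slotSum μ π A w = ∑ i, μ (Function.update (fun j => π (w j)) i (A (w i))) := by
  change (∑ i, μ.toContinuousMultilinearMap.compContinuousLinearMap
      fun j => if j = i then A else π) w = _
  rw [sum_apply]
  refine Finset.sum_congr rfl fun i _ => congrArg μ ?_
  funext j
  rcases eq_or_ne j i with rfl | h
  · simp
  · simp [h]

/-- The Lie derivative `L_Z η` of a `k`-form `η` on a vector space:
`(L_Z η)(w₁, …, w_k) = (D_Z η)(w₁, …, w_k) + ∑ᵢ η(w₁, …, D_{wᵢ} Z, …, w_k)`. -/
def lieDeriv {k : ℕ} {V : Type*} [NormedAddCommGroup V] [NormedSpace ℝ V]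
    (Z : V → V) (η : V → V [⋀^Fin k]→L[ℝ] ℝ) (z : V) : V [⋀^Fin k]→L[ℝ] ℝ :=
  fderiv ℝ η z (Z z) + slotSum (η z) (ContinuousLinearMap.id ℝ V) (fderiv ℝ Z z)

/-- The Lie derivative of a vector-valued `1`-form: `(L_Z θ)(w) = (D_Z θ)(w) + θ(D_w Z)`. -/
def lieDerivOne {V W : Type*} [NormedAddCommGroup V] [NormedSpace ℝ V]
    [NormedAddCommGroup W] [NormedSpace ℝ W]
    (Z : V → V) (θ : V → V →L[ℝ] W) (z : V) : V →L[ℝ] W :=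
  fderiv ℝ θ z (Z z) + (θ z).comp (fderiv ℝ Z z)

/-- The standard volume form `dx¹ ∧ ⋯ ∧ dxⁿ`. -/
def stdVolume (n : ℕ) : Base n [⋀^Fin n]→L[ℝ] ℝ where
  toMultilinearMap := (EuclideanSpace.basisFun (Fin n) ℝ).toBasis.det.toMultilinearMap
  cont := by
    change Continuous fun w => (EuclideanSpace.basisFun (Fin n) ℝ).toBasis.det w
    simp only [Module.Basis.det_apply]
    refine Continuous.matrix_det ?_
    refine continuous_matrix fun i j => ?_
    simp only [Module.Basis.toMatrix_apply, OrthonormalBasis.coe_toBasis_repr_apply,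
      EuclideanSpace.basisFun_repr]
    fun_prop
  map_eq_zero_of_eq' := (EuclideanSpace.basisFun (Fin n) ℝ).toBasis.det.map_eq_zero_of_eq'

/-- The projection `(dx, dy, dy_i) ↦ dx`. -/
def projBase (n m : ℕ) : JetModel n m →L[ℝ] Base n :=
  (ContinuousLinearMap.fst ℝ (Base n) (Fib m)).comp
    (ContinuousLinearMap.fst ℝ (Tot n m) (Base n →L[ℝ] Fib m))

/-- The projection `(dx, dy, dy_i) ↦ dy`. -/
def projFib (n m : ℕ) : JetModel n m →L[ℝ] Fib m :=
  (ContinuousLinearMap.snd ℝ (Base n) (Fib m)).comp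
    (ContinuousLinearMap.fst ℝ (Tot n m) (Base n →L[ℝ] Fib m))

/-- The contact forms `θ^α = dy^α - y^α_i dxⁱ`, collected in a vector-valued form. -/
def contactForm {n m : ℕ} (z : JetModel n m) : JetModel n m →L[ℝ] Fib m :=
  projFib n m - z.2.comp (projBase n m)

/-- The basis covector `dxⁱ` tensored with a fibre vector: `y ↦ dxⁱ ⊗ y`. -/
def dxTensor {n m : ℕ} (i : Fin n) : Fib m →L[ℝ] (Base n →L[ℝ] Fib m) :=
  ContinuousLinearMap.smulRightL ℝ (Base n) (Fib m) (EuclideanSpace.proj i)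

/-- `momentum ℓ i` has the components `∂ℓ/∂y^α_i`. -/
def momentum {n m : ℕ} (ℓ : JetModel n m → ℝ) (i : Fin n) (z : JetModel n m) : Fib m →L[ℝ] ℝ :=
  (fderiv ℝ ℓ z).comp
    ((ContinuousLinearMap.inr ℝ (Tot n m) (Base n →L[ℝ] Fib m)).comp (dxTensor i))

/-- The Poincaré-Cartan form `(∂ℓ/∂y^α_i) θ^α ∧ i_{∂/∂xⁱ}(dx¹ ∧ ⋯ ∧ dxⁿ) + ℓ dx¹ ∧ ⋯ ∧ dxⁿ`
of a density `ℓ dx¹ ∧ ⋯ ∧ dxⁿ` given in the coordinates `(xⁱ, y^α, y^α_i)`. -/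
def poincareCartan {n m : ℕ} (ℓ : JetModel n m → ℝ) (z : JetModel n m) :
    JetModel n m [⋀^Fin n]→L[ℝ] ℝ :=
  slotSum (stdVolume n) (projBase n m)
      (∑ i, ((momentum ℓ i z).comp (contactForm z)).smulRight (EuclideanSpace.single i (1 : ℝ))) +
    ℓ z • (stdVolume n).compContinuousLinearMap (projBase n m)

end Forms

section Fields

variable (n : ℕ) {M : Type*} [TopologicalSpace M] [ChartedSpace (Base n) M]
  {V N : Type*} [NormedAddCommGroup V] [NormedSpace ℝ V] [TopologicalSpace N] [ChartedSpace V N]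
  [IsManifold 𝓘(ℝ, V) ∞ N]

/-- `Y` is a smooth vector field on `N` that is vertical for the map `q : N → M`. -/
def IsVerticalField (q : N → M) (Y : ∀ y : N, TangentSpace 𝓘(ℝ, V) y) : Prop :=
  ContMDiff 𝓘(ℝ, V) 𝓘(ℝ, V).tangent ∞ (fun y => (⟨y, Y y⟩ : TangentBundle 𝓘(ℝ, V) N)) ∧
    ∀ y, mfderiv 𝓘(ℝ, V) 𝓘(ℝ, Base n) q y (Y y) = 0

/-- `X` is a smooth section of the pullback by `f : M → N` of the bundle of the tangent vectors
of `N` that are vertical for the map `q : N → M`. -/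
def IsVerticalAlong (q : N → M) (f : M → N) (X : ∀ x : M, TangentSpace 𝓘(ℝ, V) (f x)) : Prop :=
  ContMDiff 𝓘(ℝ, Base n) 𝓘(ℝ, V).tangent ∞
      (fun x => (⟨f x, X x⟩ : TangentBundle 𝓘(ℝ, V) N)) ∧
    ∀ x, mfderiv 𝓘(ℝ, V) 𝓘(ℝ, Base n) q (f x) (X x) = 0

/-- `Y` is a smooth vertical vector field on `N` that extends the vector field `X` along `f`. -/
def IsVerticalExtension (q : N → M) (f : M → N) (X : ∀ x : M, TangentSpace 𝓘(ℝ, V) (f x))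
    (Y : ∀ y : N, TangentSpace 𝓘(ℝ, V) y) : Prop :=
  IsVerticalField n q Y ∧ ∀ x, Y (f x) = X x

end Fields

section Volume

variable {n : ℕ} {M : Type*} [TopologicalSpace M] [ChartedSpace (Base n) M]

/-- The function `ρ` such that `form = ρ dx¹ ∧ ⋯ ∧ dxⁿ` in the chart `φ`. -/
def chartDensity (form : ∀ x : M, TangentSpace 𝓘(ℝ, Base n) x [⋀^Fin n]→L[ℝ] ℝ)
    (φ : OpenPartialHomeomorph M (Base n)) (ξ : Base n) : ℝ :=
  form (φ.symm ξ) fun i => mfderiv 𝓘(ℝ, Base n) 𝓘(ℝ, Base n) φ.symm ξ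
    (EuclideanSpace.single i (1 : ℝ) : Base n)

variable (n M) in
/-- A volume form on `M`: a smooth nowhere vanishing `n`-form, `n = dim M`. -/
structure VolumeForm where
  form : ∀ x : M, TangentSpace 𝓘(ℝ, Base n) x [⋀^Fin n]→L[ℝ] ℝ
  ne_zero : ∀ x, form x ≠ 0
  smooth : ∀ φ ∈ IsManifold.maximalAtlas 𝓘(ℝ, Base n) ∞ M,
    ContDiffOn ℝ ∞ (chartDensity form φ) φ.target

end Volume

section Variational

variable {n m : ℕ} {M E : Type*} [TopologicalSpace M] [ChartedSpace (Base n) M]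
    [TopologicalSpace E] [ChartedSpace (Tot n m) E]

/-- A (global, smooth) section of `p`. -/
structure FibSection (n m : ℕ) {M E : Type*} [TopologicalSpace M] [ChartedSpace (Base n) M]
    [TopologicalSpace E] [ChartedSpace (Tot n m) E] (p : E → M) where
  toFun : M → E
  smooth : ContMDiff 𝓘(ℝ, Base n) 𝓘(ℝ, Tot n m) ∞ toFun
  proj : ∀ x, p (toFun x) = x

variable {p : E → M}

/-- The projection `p₁ : J¹E → M`. -/
def proj1 (j : Jet1 n m p) : M := p j.pt

/-- The projection `p₁₀ : J¹E → E`. -/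
def proj10 (j : Jet1 n m p) : E := j.pt

/-- The vector space of linear maps `TₓM → V_e(p)`, `x = p e`, on which the fibre of `J¹E → E` at
`e` is modelled as an affine space. -/
def vertHom (n m : ℕ) {M E : Type*} [TopologicalSpace M] [ChartedSpace (Base n) M]
    [TopologicalSpace E] [ChartedSpace (Tot n m) E] (p : E → M) (e : E) :
    Submodule ℝ (TangentSpace 𝓘(ℝ, Base n) (p e) →L[ℝ] TangentSpace 𝓘(ℝ, Tot n m) e) where
  carrier := {h | (mfderiv 𝓘(ℝ, Tot n m) 𝓘(ℝ, Base n) p e).comp h = 0}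
  add_mem' := by
    intro a b ha hb
    change _ = _ at ha hb ⊢
    rw [ContinuousLinearMap.comp_add, ha, hb, add_zero]
  zero_mem' := ContinuousLinearMap.comp_zero _
  smul_mem' := by
    intro r a ha
    change _ = _ at ha ⊢
    rw [ContinuousLinearMap.comp_smul, ha, smul_zero]

/-- The affine structure of the fibres of `J¹E → E`. -/
def Jet1.translate (j : Jet1 n m p) (h : vertHom n m p j.pt) : Jet1 n m p where
  pt := j.pt
  hom := j.hom + h
  proj_comp := by
    have h1 : (mfderiv 𝓘(ℝ, Tot n m) 𝓘(ℝ, Base n) p j.pt).comp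
      (h : TangentSpace 𝓘(ℝ, Base n) (p j.pt) →L[ℝ] TangentSpace 𝓘(ℝ, Tot n m) j.pt) = 0 := h.2
    rw [ContinuousLinearMap.comp_add, j.proj_comp, h1, add_zero]

/-- The Hessian metric of `L` at `j`: the second derivative of `L` along the affine fibre of
`J¹E → E` through `j`. -/
def hessian (L : Jet1 n m p → ℝ) (j : Jet1 n m p) (h₁ h₂ : vertHom n m p j.pt) : ℝ :=
  deriv (fun a : ℝ => deriv (fun b : ℝ => L (j.translate (a • h₂ + b • h₁))) 0) 0

/-- `L` is regular: its Hessian metric is non-singular at every jet. -/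
def IsRegularLagrangian (L : Jet1 n m p → ℝ) : Prop :=
  ∀ (j : Jet1 n m p) (h₁ : vertHom n m p j.pt), (∀ h₂, hessian L j h₁ h₂ = 0) → h₁ = 0

variable [IsManifold 𝓘(ℝ, Tot n m) ∞ E] [IsFibredManifold n m p]

/-- The first jet prolongation `j¹s` of a section `s`. -/
def jetSection (s : FibSection n m p) (x : M) : Jet1 n m p where
  pt := s.toFun x
  hom := (mfderiv 𝓘(ℝ, Base n) 𝓘(ℝ, Tot n m) s.toFun x : Base n →L[ℝ] Tot n m)
  proj_comp := by
    obtain ⟨c, hc⟩ := exists_fibredChart (p := p) (n := n) (m := m) (s.toFun x)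
    have h1 := (c.mdiff_proj hc).hasMFDerivAt.comp x
      ((s.smooth x).mdifferentiableAt (by simp)).hasMFDerivAt
    have h2 : p ∘ s.toFun = id := funext s.proj
    rw [h2] at h1
    have h3 := hasMFDerivAt_unique h1 (hasMFDerivAt_id x)
    ext1 u
    exact DFunLike.congr_fun h3 u

/-- The function `ℓ` such that `L 𝐯 = ℓ dx¹ ∧ ⋯ ∧ dxⁿ` in the fibred chart `c`. -/
def FibredChart.lagrangian (c : FibredChart n m p) (v : VolumeForm n M) (L : Jet1 n m p → ℝ)
    (z : JetModel n m) : ℝ :=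
  L (c.jet.symm z) * chartDensity v.form c.base z.1.1

/-- The functions `y^α ∘ s` in the fibred chart `c`, as functions of the `xⁱ`. -/
def FibredChart.sectionRep (c : FibredChart n m p) (s : M → E) (ξ : Base n) : Fib m :=
  (c.tot (s (c.base.symm ξ))).2

/-- The coordinate expression of `j¹s`: `y^α = s^α`, `y^α_i = ∂s^α/∂xⁱ`. -/
def FibredChart.holonomicRep (c : FibredChart n m p) (s : M → E) (ξ : Base n) : JetModel n m :=
  ((ξ, c.sectionRep s ξ), fderiv ℝ (c.sectionRep s) ξ)

/-- The coordinate expression of a map `M → J¹E` in the fibred chart `c`. -/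
def FibredChart.jetRep (c : FibredChart n m p) (σ : M → Jet1 n m p) (ξ : Base n) :
    JetModel n m :=
  c.jet (σ (c.base.symm ξ))

/-- The coordinate expression of a vector field on `J¹E` in the fibred chart `c`. -/
def FibredChart.fieldRep (c : FibredChart n m p)
    (Z : ∀ j : Jet1 n m p, TangentSpace 𝓘(ℝ, JetModel n m) j) (z : JetModel n m) :
    JetModel n m :=
  mfderiv 𝓘(ℝ, JetModel n m) 𝓘(ℝ, JetModel n m) c.jet (c.jet.symm z) (Z (c.jet.symm z))

/-- The Euler-Lagrange operator at the section `s` (which may be defined only near `x`), at the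
point `x`, in the fibred chart `c`: the value on `u = (u^α)` of the covector with the components
`∂ℓ/∂y^α (j¹ₓs) - ∂/∂xⁱ (∂ℓ/∂y^α_i ∘ j¹s)(x)` (with respect to `dy^α ⊗ dx¹ ∧ ⋯ ∧ dxⁿ`). -/
def eulerLagrange (v : VolumeForm n M) (L : Jet1 n m p → ℝ) (c : FibredChart n m p)
    (s : M → E) (x : M) (u : Fib m) : ℝ :=
  fderiv ℝ (c.lagrangian v L) (c.holonomicRep s (c.base x)) ((0, u), 0) -
    ∑ i, fderiv ℝ (fun ξ => momentum (c.lagrangian v L) i (c.holonomicRep s ξ) u) (c.base x)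
      (EuclideanSpace.single i (1 : ℝ))

/-- `s` is an extremal: a solution to the Euler-Lagrange equations. -/
def IsExtremal (v : VolumeForm n M) (L : Jet1 n m p → ℝ) (s : FibSection n m p) : Prop :=
  ∀ (c : FibredChart n m p) (x : M), s.toFun x ∈ c.tot.source →
    ∀ u, eulerLagrange v L c s.toFun x u = 0

/-- `S : (-ε, ε) × U → E` is a smooth one-parameter family of sections over the open set `U`, with
`S₀ = s` and with initial velocity `X`. -/
structure IsVariation (s : FibSection n m p)
    (X : ∀ x : M, TangentSpace 𝓘(ℝ, Tot n m) (s.toFun x)) (ε : ℝ) (U : Set M)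
    (S : ℝ → M → E) : Prop where
  pos : 0 < ε
  isOpen : IsOpen U
  smooth : ContMDiffOn (𝓘(ℝ, ℝ).prod 𝓘(ℝ, Base n)) 𝓘(ℝ, Tot n m) ∞
    (fun q : ℝ × M => S q.1 q.2) (Set.Ioo (-ε) ε ×ˢ U)
  proj : ∀ t ∈ Set.Ioo (-ε) ε, ∀ x ∈ U, p (S t x) = x
  zero : ∀ x ∈ U, S 0 x = s.toFun x
  velocity : ∀ x ∈ U,
    (mfderiv 𝓘(ℝ, ℝ) 𝓘(ℝ, Tot n m) (fun t => S t x) 0 (1 : ℝ) : Tot n m) = X x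

/-- `X` is a Jacobi field along `s`: a smooth vertical vector field along `s` in the kernel of the
linearisation of the Euler-Lagrange operator, `∂/∂t|_{t=0} (Euler-Lagrange operator at S_t) = 0`
for the one-parameter families `S_t` of (local) sections with `S₀ = s` and initial velocity `X`. -/
def IsJacobiField (v : VolumeForm n M) (L : Jet1 n m p → ℝ) (s : FibSection n m p)
    (X : ∀ x : M, TangentSpace 𝓘(ℝ, Tot n m) (s.toFun x)) : Prop :=
  IsVerticalAlong n p s.toFun X ∧
    ∀ (c : FibredChart n m p) (ε : ℝ) (U : Set M) (S : ℝ → M → E), IsVariation s X ε U S →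
      ∀ x ∈ U, s.toFun x ∈ c.tot.source →
        ∀ u, HasDerivAt (fun t => eulerLagrange v L c (S t) x u) 0 0

/-- `σ` is a solution to the Hamilton-Cartan equations: a smooth section of `p₁` such that
`σ^*(i_Y dΘ) = 0` for all `p₁`-vertical vector fields `Y` on `J¹E`. -/
def IsHCSolution (v : VolumeForm n M) (L : Jet1 n m p → ℝ) (σ : M → Jet1 n m p) : Prop :=
  ContMDiff 𝓘(ℝ, Base n) 𝓘(ℝ, JetModel n m) ∞ σ ∧ (∀ x, proj1 (σ x) = x) ∧
    ∀ Y : (∀ j : Jet1 n m p, TangentSpace 𝓘(ℝ, JetModel n m) j), IsVerticalField n proj1 Y →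
      ∀ (c : FibredChart n m p) (x : M), (σ x).pt ∈ c.tot.source →
        ((extDeriv (poincareCartan (c.lagrangian v L)) (c.jet (σ x))).curryLeft
          (c.fieldRep Y (c.jet (σ x)))).compContinuousLinearMap
            (fderiv ℝ (c.jetRep σ) (c.base x)) = 0

/-- The linearised Hamilton-Cartan equations at `σ`: `σ^*(i_Y L_Z dΘ) = 0` for all `p₁`-vertical
vector fields `Y` on `J¹E`. -/
def LinearisedHC (v : VolumeForm n M) (L : Jet1 n m p → ℝ) (σ : M → Jet1 n m p)
    (Z : ∀ j : Jet1 n m p, TangentSpace 𝓘(ℝ, JetModel n m) j) : Prop :=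
  ∀ Y : (∀ j : Jet1 n m p, TangentSpace 𝓘(ℝ, JetModel n m) j), IsVerticalField n proj1 Y →
    ∀ (c : FibredChart n m p) (x : M), (σ x).pt ∈ c.tot.source →
      ((lieDeriv (c.fieldRep Z) (extDeriv (poincareCartan (c.lagrangian v L)))
        (c.jet (σ x))).curryLeft (c.fieldRep Y (c.jet (σ x)))).compContinuousLinearMap
          (fderiv ℝ (c.jetRep σ) (c.base x)) = 0

/-- `X` belongs to the tangent space at `σ` to the solutions to the Hamilton-Cartan equations: it
is a smooth `p₁`-vertical vector field along `σ` with a vertical extension to `J¹E` that satisfies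
the linearised equations. -/
def IsHCTangent (v : VolumeForm n M) (L : Jet1 n m p → ℝ) (σ : M → Jet1 n m p)
    (X : ∀ x : M, TangentSpace 𝓘(ℝ, JetModel n m) (σ x)) : Prop :=
  IsVerticalAlong n proj1 σ X ∧ ∃ Z, IsVerticalExtension n proj1 σ X Z ∧ LinearisedHC v L σ Z

/-- `Z` is the `1`-jet prolongation of the vector field `Y` on `E`: a smooth vector field on `J¹E`
that is `p₁₀`-projectable onto `Y` and leaves the contact system invariant, i.e. the forms
`L_Z θ^α` belong to the span of the contact forms in every fibred chart. -/
def IsJetProlongation (Y : ∀ e : E, TangentSpace 𝓘(ℝ, Tot n m) e)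
    (Z : ∀ j : Jet1 n m p, TangentSpace 𝓘(ℝ, JetModel n m) j) : Prop :=
  ContMDiff 𝓘(ℝ, JetModel n m) 𝓘(ℝ, JetModel n m).tangent ∞
      (fun j => (⟨j, Z j⟩ : TangentBundle 𝓘(ℝ, JetModel n m) (Jet1 n m p))) ∧
    (∀ j : Jet1 n m p,
      mfderiv 𝓘(ℝ, JetModel n m) 𝓘(ℝ, Tot n m) (proj10 (n := n) (m := m) (p := p)) j (Z j) =
        Y j.pt) ∧
    ∀ (c : FibredChart n m p), ∀ z ∈ c.jet.target, ∀ w : JetModel n m, contactForm z w = 0 →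
      lieDerivOne (c.fieldRep Z) contactForm z w = 0

end Variational

end FibredJet

end

open FibredJet

/-!
Everything is computed in a fibred chart, where a section is a function `a(x)`, its `1`-jet is
`z = (x, a, ∂a)`, a vertical field along the section is a function `X(x)`, and
`Θ = pⁱ θ ∧ i_{∂/∂xⁱ} dx + ℓ dx` with the contact forms `θ = dy - y_i dxⁱ` and the momenta
`pⁱ = ∂ℓ/∂y_i`.

Let `S` be a linear lift of the tangent space of the base at `z` and let `y` be a vertical tangent
vector with the components `(η, ζ)`. By `extDeriv_poincareCartan`, the value of `dΘ` on `y` followed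
by `S(∂/∂x¹), …, S(∂/∂xⁿ)` is
`EL(z, S) η + D²ℓ(z)(y, θ ∘ S)`,
where `EL(z, S)` is the Euler-Lagrange expression and the second argument is placed in the
directions `∂/∂y_i`. If `S` is the derivative of the `1`-jet of a section, then `θ ∘ S = 0`, so the
`1`-jet of an extremal solves the Hamilton-Cartan equations (`isHCSolution_jetSection`).
Differentiating this identity along a vertical field `Z` whose value and derivative along `j¹s` are
`z'` and `S'` gives, at an extremal,
`DEL(z, S)(z', S') η + D²ℓ(z)(y, dy ∘ S' - z'_i)`
(`lieDeriv_extDeriv_poincareCartan`, `linHC`). Only the values of `Z` along `j¹s` occur here, which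
is the independence of the extension (`linearisedHC_iff`), and the expression is linear in them.

On the other side, differentiating the Euler-Lagrange operator along a variation with the initial
velocity `X`, and using the variations `a + tX` in a chart, shows that `X` is a Jacobi field if and
only if `DEL(z, S)(z', S') = 0` for `z' = (0, X, ∂X)`, `S' = ∂z'` (`isJacobiField_iff`). For such a
`z'` the second summand above vanishes, so that `X` is a Jacobi field if and only if its lift
`(0, X, ∂X)` solves the linearised Hamilton-Cartan equations (`solvesLinHC_jetLift_iff`); here the
test vectors `y` are arbitrary because every vertical vector extends to a vertical field
(`exists_verticalField_jet`).

The lift is the restriction to `j¹s` of the prolongation of any vertical extension of `X`: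
extensions exist by a partition of unity (`exists_verticalExtension`), and the prolongation of a
vertical field with the components `Y(x, y)` is forced to have the components `(0, Y, d_i Y)`, with
the total derivatives `d_i`, by the invariance of the contact system
(`IsJetProlongation.fieldRep_eq`). Conversely this formula defines a vector field, since
it is compatible with changes of fibred charts
(`fderiv_flatTransition_flatProlong`, where the symmetry of second derivatives enters).

The lift is injective since its components contain `X`. For a regular Lagrangian the equations in
the directions `∂/∂y_i` read `D²ℓ(z)(ζ, dy ∘ S' - z'_i) = 0` for all `ζ`, so that the components
`z'_i` are the derivatives of the component of `z'` along the fibres: every solution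
is the lift of its projection to `E` (`IsRegularLagrangian.jetLift_projAlong`), and that
projection is a Jacobi field by the equivalence above.
-/

noncomputable section

namespace FibredJet

-- The instances on the nested spaces of continuous linear maps need this depth.
set_option maxSynthPendingDepth 3

/-! ### Forms of Poincaré-Cartan type on a vector space over the base -/

section AbstractForms

variable {n : ℕ} {V F : Type*} [NormedAddCommGroup V] [NormedSpace ℝ V]
  [NormedAddCommGroup F] [NormedSpace ℝ F]

theorem slotSum_add {k : ℕ} {V W : Type*} [NormedAddCommGroup V] [NormedSpace ℝ V]
    [NormedAddCommGroup W] [NormedSpace ℝ W]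
    (μ : W [⋀^Fin k]→L[ℝ] ℝ) (π A B : V →L[ℝ] W) :
    slotSum μ π (A + B) = slotSum μ π A + slotSum μ π B := by
  ext w
  simp only [slotSum_apply, ContinuousAlternatingMap.add_apply, add_apply,
    ContinuousAlternatingMap.map_update_add, Finset.sum_add_distrib]

theorem slotSum_smul {k : ℕ} {V W : Type*} [NormedAddCommGroup V] [NormedSpace ℝ V]
    [NormedAddCommGroup W] [NormedSpace ℝ W]
    (μ : W [⋀^Fin k]→L[ℝ] ℝ) (π A : V →L[ℝ] W) (r : ℝ) :
    slotSum μ π (r • A) = r • slotSum μ π A := by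
  ext w
  simp only [slotSum_apply, ContinuousAlternatingMap.smul_apply, smul_apply,
    ContinuousAlternatingMap.map_update_smul, Finset.smul_sum]

/-- `slotSum μ π A` as a continuous linear function of `A`. -/
def slotSumCLM {k : ℕ} {V W : Type*} [NormedAddCommGroup V] [NormedSpace ℝ V]
    [NormedAddCommGroup W] [NormedSpace ℝ W] [FiniteDimensional ℝ V] [FiniteDimensional ℝ W]
    (μ : W [⋀^Fin k]→L[ℝ] ℝ) (π : V →L[ℝ] W) : (V →L[ℝ] W) →L[ℝ] V [⋀^Fin k]→L[ℝ] ℝ :=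
  LinearMap.toContinuousLinearMap
    { toFun := slotSum μ π
      map_add' := slotSum_add μ π
      map_smul' := fun r A => slotSum_smul μ π A r }

/-- The vector `∂/∂xⁱ` of the model of the base. -/
abbrev baseVec (i : Fin n) : Base n := EuclideanSpace.single i (1 : ℝ)

theorem stdVolume_basis : stdVolume n baseVec = 1 := by
  have h := (EuclideanSpace.basisFun (Fin n) ℝ).toBasis.det_self
  have h2 : ⇑(EuclideanSpace.basisFun (Fin n) ℝ).toBasis = baseVec := by
    ext1 i; simp
  rw [h2] at h
  exact h

theorem stdVolume_update (w : Base n) (i : Fin n) :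
    stdVolume n (Function.update baseVec i w) = w i := by
  have h : (EuclideanSpace.basisFun (Fin n) ℝ).toBasis.det
      (Function.update baseVec i w) = w i := by
    have h2 : ⇑(EuclideanSpace.basisFun (Fin n) ℝ).toBasis = baseVec := by
      ext1 i; simp
    rw [← h2, Module.Basis.det_apply, Module.Basis.toMatrix_update, Module.Basis.toMatrix_self,
      ← Matrix.cramer_apply, Matrix.cramer_one]
    simp
  exact h

/-- The form `(A^i) ∧ i_{∂/∂xⁱ}(dx¹ ∧ ⋯ ∧ dxⁿ) + ℓ dx¹ ∧ ⋯ ∧ dxⁿ` on a vector space with a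
projection `π` to the base, for covectors `A^i` collected in the base-valued form `A`. -/
def slotForm (π : V →L[ℝ] Base n) (A : V → V →L[ℝ] Base n) (ℓ : V → ℝ) (z : V) :
    V [⋀^Fin n]→L[ℝ] ℝ :=
  slotSum (stdVolume n) π (A z) + ℓ z • (stdVolume n).compContinuousLinearMap π

section

variable [FiniteDimensional ℝ V] {π : V →L[ℝ] Base n} {A : V → V →L[ℝ] Base n} {ℓ : V → ℝ} {z : V}

theorem slotForm_contDiffAt {r : WithTop ℕ∞} (hA : ContDiffAt ℝ r A z) (hℓ : ContDiffAt ℝ r ℓ z) :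
    ContDiffAt ℝ r (slotForm π A ℓ) z :=
  ((slotSumCLM (stdVolume n) π).contDiff.contDiffAt.comp z hA).add (hℓ.smul contDiffAt_const)

theorem fderiv_slotForm (hA : DifferentiableAt ℝ A z) (hℓ : DifferentiableAt ℝ ℓ z) (h : V) :
    fderiv ℝ (slotForm π A ℓ) z h = slotSum (stdVolume n) π (fderiv ℝ A z h) +
      fderiv ℝ ℓ z h • (stdVolume n).compContinuousLinearMap π := by
  have h1 := ((slotSumCLM (stdVolume n) π).hasFDerivAt.comp z hA.hasFDerivAt).add
    (hℓ.hasFDerivAt.smul_const ((stdVolume n).compContinuousLinearMap π))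
  exact DFunLike.congr_fun h1.fderiv h

/-- The exterior derivative, with the derivative along the first vector singled out. -/
theorem extDeriv_vecCons {V : Type*} [NormedAddCommGroup V] [NormedSpace ℝ V] {k : ℕ}
    (η : V → V [⋀^Fin k]→L[ℝ] ℝ) (z y : V) (w : Fin k → V) :
    extDeriv η z (Matrix.vecCons y w) =
      fderiv ℝ η z y w - ∑ i, fderiv ℝ η z (w i) (Function.update w i y) := by
  rw [extDeriv, ContinuousAlternatingMap.alternatizeUncurryFin_apply, Fin.sum_univ_succ,
    sub_eq_add_neg, ← Finset.sum_neg_distrib]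
  congr 1
  · simp
  · refine Finset.sum_congr rfl fun i _ => ?_
    obtain ⟨k, rfl⟩ : ∃ k', k = k' + 1 := ⟨k - 1, by have := i.pos; omega⟩
    have h1 : Function.update w i y = i.insertNth y (i.removeNth w) := by simp
    have h2 : i.succ.removeNth (Matrix.vecCons y w) = Matrix.vecCons y (i.removeNth w) := by
      ext j
      refine Fin.cases ?_ (fun j => ?_) j <;> simp [Fin.removeNth]
    rw [h1, ContinuousAlternatingMap.map_insertNth, h2]
    simp [pow_succ]

/-- The exterior derivative of a form of Poincaré-Cartan type on a vertical vector `y` followed by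
the lift `S(∂/∂xⁱ)` of the coordinate frame. -/
theorem extDeriv_slotForm (hA : DifferentiableAt ℝ A z) (hℓ : DifferentiableAt ℝ ℓ z)
    {y : V} (hy : π y = 0) {S : Base n →L[ℝ] V} (hS : ∀ w, π (S w) = w) :
    extDeriv (slotForm π A ℓ) z (Matrix.vecCons y fun i => S (baseVec i)) =
      fderiv ℝ ℓ z y +
        ∑ i, (fderiv ℝ A z y (S (baseVec i)) i - fderiv ℝ A z (S (baseVec i)) y i) := by
  have h1 : ∀ h : V, fderiv ℝ (slotForm π A ℓ) z h (fun i => S (baseVec i)) =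
      ∑ i, fderiv ℝ A z h (S (baseVec i)) i + fderiv ℝ ℓ z h := by
    intro h
    rw [fderiv_slotForm hA hℓ, ContinuousAlternatingMap.add_apply, slotSum_apply]
    congr 1
    · refine Finset.sum_congr rfl fun i _ => ?_
      simp only [hS]
      exact stdVolume_update _ i
    · simp only [ContinuousAlternatingMap.smul_apply,
        ContinuousAlternatingMap.compContinuousLinearMap_apply, Function.comp_def, hS]
      rw [show (fun i => baseVec i) = baseVec (n := n) from rfl, stdVolume_basis, smul_eq_mul,
        mul_one]
  have h2 : ∀ (h : V) (i : Fin n), fderiv ℝ (slotForm π A ℓ) z h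
      (Function.update (fun i => S (baseVec i)) i y) = fderiv ℝ A z h y i := by
    intro h i
    have h3 : (fun j => π (Function.update (fun i => S (baseVec i)) i y j)) =
        Function.update baseVec i 0 := by
      ext1 j
      rcases eq_or_ne j i with rfl | hj
      · simp [hy]
      · simp [hj, hS]
    rw [fderiv_slotForm hA hℓ, ContinuousAlternatingMap.add_apply, slotSum_apply, h3,
      Finset.sum_eq_single i]
    · have h4 : stdVolume n (Function.update baseVec i 0) = 0 :=
        (stdVolume n).map_coord_zero i (by simp)
      simp only [ContinuousAlternatingMap.smul_apply,
        ContinuousAlternatingMap.compContinuousLinearMap_apply, Function.comp_def, h3, h4]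
      simp [stdVolume_update]
    · intro j _ hj
      exact (stdVolume n).map_coord_zero i (by simp [hj.symm])
    · simp
  rw [extDeriv_vecCons, h1]
  simp only [h2]
  rw [Finset.sum_sub_distrib]
  ring

end

/-- The base-valued form `p^i_α θ^α ⊗ ∂/∂xⁱ`. -/
def contactPart (p : Fin n → V → F →L[ℝ] ℝ) (θ : V → V →L[ℝ] F) (z : V) : V →L[ℝ] Base n :=
  ∑ i, ((p i z).comp (θ z)).smulRight (baseVec i)

section

variable {p : Fin n → V → F →L[ℝ] ℝ} {θ : V → V →L[ℝ] F} {z : V}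

theorem contactPart_contDiffAt {r : WithTop ℕ∞} (hp : ∀ i, ContDiffAt ℝ r (p i) z)
    (hθ : ContDiffAt ℝ r θ z) : ContDiffAt ℝ r (contactPart p θ) z :=
  ContDiffAt.sum fun i _ => (((hp i).clm_comp hθ).smulRight contDiffAt_const)

theorem contactPart_apply (z w : V) (i : Fin n) :
    contactPart p θ z w i = p i z (θ z w) := by
  simp only [contactPart, FunLike.coe_sum, Finset.sum_apply,
    ContinuousLinearMap.smulRight_apply, PiLp.smul_apply, WithLp.ofLp_sum]
  simp [PiLp.single_apply]

theorem fderiv_contactPart (hp : ∀ i, ContDiffAt ℝ 1 (p i) z) (hθ : ContDiffAt ℝ 1 θ z) (h w : V)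
    (i : Fin n) : fderiv ℝ (contactPart p θ) z h w i =
      fderiv ℝ (p i) z h (θ z w) + p i z (fderiv ℝ θ z h w) := by
  have hm := ((hp i).differentiableAt (by simp)).hasFDerivAt
  have hA := ((contactPart_contDiffAt hp hθ).differentiableAt (by simp)).hasFDerivAt
  have e1 : HasFDerivAt (fun z => contactPart p θ z w i) _ z :=
    (EuclideanSpace.proj i : Base n →L[ℝ] ℝ).hasFDerivAt.comp z
      (hA.clm_apply (hasFDerivAt_const w z))
  have e2 := hm.clm_apply
    ((hθ.differentiableAt (by simp)).hasFDerivAt.clm_apply (hasFDerivAt_const w z))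
  have e3 : (fun z => contactPart p θ z w i) = fun z => p i z (θ z w) :=
    funext fun z => contactPart_apply z w i
  rw [e3] at e1
  have := DFunLike.congr_fun (e1.unique e2) h
  simpa [add_comm] using this

end

/-- The expression `D z (ι u) - ∑ᵢ (∂_{S(∂/∂xⁱ)} pᵢ)(z) u` at `q = (z, S)`. For `D = dℓ` and the
momenta `pᵢ` of `ℓ` it is the Euler-Lagrange expression on `u`, as a function of the point
`z = j¹ₓs` and of the derivative `S` of `j¹s` at `x`;
the total derivative is expanded by the chain rule. -/
def elExpr (D : V → V →L[ℝ] ℝ) (p : Fin n → V → F →L[ℝ] ℝ) (ι : F →L[ℝ] V) (u : F)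
    (q : V × (Base n →L[ℝ] V)) : ℝ :=
  D q.1 (ι u) - ∑ i, fderiv ℝ (p i) q.1 (q.2 (baseVec i)) u

theorem elExpr_contDiffAt {D : V → V →L[ℝ] ℝ} {p : Fin n → V → F →L[ℝ] ℝ} {ι : F →L[ℝ] V} {u : F}
    {q : V × (Base n →L[ℝ] V)} (hD : ContDiffAt ℝ ∞ D q.1) (hp : ∀ i, ContDiffAt ℝ ∞ (p i) q.1) :
    ContDiffAt ℝ ∞ (elExpr D p ι u) q := by
  have h2 : ∀ i, ContDiffAt ℝ ∞ (fderiv ℝ (p i)) q.1 := fun i => (hp i).fderiv_right (by simp)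
  refine ContDiffAt.sub ((hD.comp q contDiffAt_fst).clm_apply contDiffAt_const)
    (ContDiffAt.sum fun i _ => ?_)
  exact ((((h2 i).comp q contDiffAt_fst).clm_apply
    (contDiffAt_snd.clm_apply contDiffAt_const)).clm_apply contDiffAt_const)

/-- The Lie derivative, up to the term in which the derivative of `Z` acts on the first argument, is
the derivative along `t ↦ z + t Z` with the other arguments transported by `Z`. -/
theorem lieDeriv_vecCons {V : Type*} [NormedAddCommGroup V] [NormedSpace ℝ V] {k : ℕ}
    {Z : V → V} {η : V → V [⋀^Fin (k + 1)]→L[ℝ] ℝ} {z : V} (hη : DifferentiableAt ℝ η z)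
    (y : V) (w : Fin k → V) :
    HasDerivAt (fun t : ℝ => η (z + t • Z z)
        (Matrix.vecCons y fun i => w i + t • fderiv ℝ Z z (w i)))
      (lieDeriv Z η z (Matrix.vecCons y w) - η z (Matrix.vecCons (fderiv ℝ Z z y) w)) 0 := by
  have hc : HasDerivAt (fun t : ℝ => z + t • Z z) (Z z) 0 := by
    simpa using ((hasDerivAt_id (0 : ℝ)).smul_const (Z z)).const_add z
  have h1 : HasFDerivAt (fun t : ℝ => η (z + t • Z z)) _ 0 :=
    HasFDerivAt.comp (0 : ℝ) (by simpa using hη.hasFDerivAt) hc.hasFDerivAt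
  let g : Fin (k + 1) → ℝ → V := fun i t =>
    (Matrix.vecCons y (fun i => w i + t • fderiv ℝ Z z (w i)) : Fin (k + 1) → V) i
  let g' : Fin (k + 1) → V := Matrix.vecCons 0 fun i => fderiv ℝ Z z (w i)
  have h2 : ∀ i, HasFDerivAt (g i) (ContinuousLinearMap.toSpanSingleton ℝ (g' i)) 0 := by
    intro i
    refine Fin.cases ?_ (fun i => ?_) i
    · simpa [g, g'] using (hasFDerivAt_const y (0 : ℝ))
    · have := (((hasDerivAt_id (0 : ℝ)).smul_const (fderiv ℝ Z z (w i))).const_add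
        (w i)).hasFDerivAt
      simpa [g, g'] using this
  have h3 := (h1.continuousAlternatingMap_apply h2).hasDerivAt
  have h4 : (fun i => g i 0) = Matrix.vecCons y w := by
    ext1 i
    refine Fin.cases ?_ (fun i => ?_) i <;> simp [g]
  refine h3.congr_deriv ?_
  rw [h4]
  simp only [lieDeriv, ContinuousAlternatingMap.add_apply, slotSum_apply, Fin.sum_univ_succ]
  simp [g', ContinuousAlternatingMap.toContinuousLinearMap]
  have h5 : Function.update (fun j => (Matrix.vecCons y w : Fin (k + 1) → V) j) 0
      (fderiv ℝ Z z y) = Matrix.vecCons (fderiv ℝ Z z y) w := by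
    ext1 i
    refine Fin.cases ?_ (fun i => ?_) i <;> simp
  rw [h5]
  ring

/-- The derivative along a curve in `(z, S)`-space computes the Lie derivative of a form `η` along
`Z`, as soon as the values of `η` on the frames in question are known near the point. -/
theorem lieDeriv_eq_fderiv {k : ℕ} {Z : V → V} {η : V → V [⋀^Fin (k + 1)]→L[ℝ] ℝ} {z : V}
    (hη : DifferentiableAt ℝ η z) (y : V) (e : Fin k → Base n) {S : Base n →L[ℝ] V}
    {G : V × (Base n →L[ℝ] V) → ℝ} (hG : DifferentiableAt ℝ G (z, S))
    (h : ∀ᶠ t in 𝓝 (0 : ℝ), η (z + t • Z z)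
        (Matrix.vecCons y fun i => (S + t • (fderiv ℝ Z z).comp S) (e i)) =
      G (z + t • Z z, S + t • (fderiv ℝ Z z).comp S)) :
    lieDeriv Z η z (Matrix.vecCons y fun i => S (e i)) =
      fderiv ℝ G (z, S) (Z z, (fderiv ℝ Z z).comp S) +
        η z (Matrix.vecCons (fderiv ℝ Z z y) fun i => S (e i)) := by
  have h1 := lieDeriv_vecCons (Z := Z) hη y (fun i => S (e i))
  have hc : HasDerivAt (fun t : ℝ => (z + t • Z z, S + t • (fderiv ℝ Z z).comp S))
      (Z z, (fderiv ℝ Z z).comp S) 0 := by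
    have a := ((hasDerivAt_id (0 : ℝ)).smul_const (Z z)).const_add z
    have b := ((hasDerivAt_id (0 : ℝ)).smul_const ((fderiv ℝ Z z).comp S)).const_add S
    simpa using a.prodMk b
  have h2 : HasDerivAt (fun t : ℝ => G (z + t • Z z, S + t • (fderiv ℝ Z z).comp S)) _ 0 :=
    HasFDerivAt.comp_hasDerivAt (0 : ℝ) (by simpa using hG.hasFDerivAt) hc
  have h3 := (h2.congr_of_eventuallyEq h).unique h1
  rw [h3]
  ring

theorem differentiableAt_extDeriv {k : ℕ} {η : V → V [⋀^Fin k]→L[ℝ] ℝ} {z : V}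
    (hη : ContDiffAt ℝ 2 η z) : DifferentiableAt ℝ (extDeriv η) z :=
  DifferentiableAt.comp z (g := ContinuousAlternatingMap.alternatizeUncurryFinCLM ℝ V ℝ)
    (ContinuousLinearMap.differentiableAt _)
    ((hη.fderiv_right (m := 1) (by norm_num)).differentiableAt (by simp))

/-- The derivative of the Euler-Lagrange expression in the direction `(z', S')`. -/
def elExprDeriv (D : V → V →L[ℝ] ℝ) (p : Fin n → V → F →L[ℝ] ℝ) (ι : F →L[ℝ] V) (u : F)
    (z : V) (S : Base n →L[ℝ] V) (z' : V) (S' : Base n →L[ℝ] V) : ℝ :=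
  fderiv ℝ (elExpr D p ι u) (z, S) (z', S')

/-- If the value of `η` on the vector `y` followed by a frame `S` splits into an expression
`G (z, S)` and a term `b z (θ z ∘ S)`, and if `θ z ∘ S = 0`, then only the derivative of `θ z ∘ S`
contributes to the Lie derivative of the second term. -/
theorem lieDeriv_of_split {k : ℕ} {Z : V → V} {η : V → V [⋀^Fin (k + 1)]→L[ℝ] ℝ} {z : V}
    (hη : DifferentiableAt ℝ η z) {y : V} {e : Fin k → Base n} {S : Base n →L[ℝ] V}
    {G : V × (Base n →L[ℝ] V) → ℝ} (hG : DifferentiableAt ℝ G (z, S))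
    {b : V → (Base n →L[ℝ] F) →L[ℝ] ℝ} (hb : DifferentiableAt ℝ b z)
    {θ : V → V →L[ℝ] F} (hθ : DifferentiableAt ℝ θ z) (hS : (θ z).comp S = 0)
    {O : Set V} (hO : O ∈ 𝓝 z) {π : V →L[ℝ] Base n} (hπS : ∀ w, π (S w) = w)
    (hZ : ∀ w, π (fderiv ℝ Z z w) = 0)
    (h : ∀ z' ∈ O, ∀ S' : Base n →L[ℝ] V, (∀ w, π (S' w) = w) →
      η z' (Matrix.vecCons y fun i => S' (e i)) = G (z', S') + b z' ((θ z').comp S'))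
    (h0 : η z (Matrix.vecCons (fderiv ℝ Z z y) fun i => S (e i)) = 0) :
    lieDeriv Z η z (Matrix.vecCons y fun i => S (e i)) =
      fderiv ℝ G (z, S) (Z z, (fderiv ℝ Z z).comp S) +
        b z ((fderiv ℝ θ z (Z z)).comp S + (θ z).comp ((fderiv ℝ Z z).comp S)) := by
  let c : V × (Base n →L[ℝ] V) → (Base n →L[ℝ] F) := fun q => (θ q.1).comp q.2
  have hb' : HasFDerivAt (fun q : V × (Base n →L[ℝ] V) => b q.1) _ (z, S) :=
    HasFDerivAt.comp (z, S) (f := Prod.fst) hb.hasFDerivAt hasFDerivAt_fst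
  have hc : HasFDerivAt c _ (z, S) := HasFDerivAt.clm_comp
    (HasFDerivAt.comp (z, S) (f := Prod.fst) hθ.hasFDerivAt hasFDerivAt_fst) hasFDerivAt_snd
  have hcurve : ContinuousAt (fun t : ℝ => z + t • Z z) 0 := by fun_prop
  have hbc := hb'.clm_apply hc
  have hsum := hG.hasFDerivAt.fun_add hbc
  have h1 := lieDeriv_eq_fderiv (Z := Z) hη y e (S := S)
    (G := fun q => G q + b q.1 (c q)) (hG.add hbc.differentiableAt) (by
      -- the curve `S + t Z' ∘ S` stays among the lifts of the base, because `Z` is vertical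
      filter_upwards [hcurve.eventually_mem (by simpa using hO)] with t ht
      exact h _ ht _ fun w => by simp [hπS, hZ])
  rw [h1, h0, add_zero, hsum.fderiv]
  simp [c, hS, add_comm]

end AbstractForms

/-! ### The Poincaré-Cartan form in coordinates -/

section JetForms

variable {n m : ℕ} {ℓ : JetModel n m → ℝ} {z : JetModel n m}

/-- The inclusion `u ↦ u^α ∂/∂y^α`. -/
def fibIncl (n m : ℕ) : Fib m →L[ℝ] JetModel n m :=
  (ContinuousLinearMap.inl ℝ (Tot n m) (Base n →L[ℝ] Fib m)).comp
    (ContinuousLinearMap.inr ℝ (Base n) (Fib m))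

/-- The inclusion `T ↦ T^α_i ∂/∂y^α_i`. -/
def slopeIncl (n m : ℕ) : (Base n →L[ℝ] Fib m) →L[ℝ] JetModel n m :=
  ContinuousLinearMap.inr ℝ (Tot n m) (Base n →L[ℝ] Fib m)

/-- The Euler-Lagrange expression of `ℓ` on the vertical vector `u`, as a function of the point
`z = j¹ₓs` and of the derivative `S` of `j¹s` at `x`. -/
def elDensity (ℓ : JetModel n m → ℝ) (u : Fib m) (z : JetModel n m)
    (S : Base n →L[ℝ] JetModel n m) : ℝ :=
  elExpr (fderiv ℝ ℓ) (momentum ℓ) (fibIncl n m) u (z, S)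

/-- The linearisation of the Euler-Lagrange expression at `(z, S)` in the direction `(z', S')`. -/
def linEL (ℓ : JetModel n m → ℝ) (u : Fib m) (z : JetModel n m)
    (S : Base n →L[ℝ] JetModel n m) (z' : JetModel n m) (S' : Base n →L[ℝ] JetModel n m) : ℝ :=
  elExprDeriv (fderiv ℝ ℓ) (momentum ℓ) (fibIncl n m) u z S z' S'

theorem momentum_contDiffAt (h : ContDiffAt ℝ ∞ ℓ z)
    (i : Fin n) : ContDiffAt ℝ ∞ (momentum ℓ i) z :=
  (h.fderiv_right (m := ∞) (by simp)).clm_comp contDiffAt_const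

theorem contactForm_apply (z w : JetModel n m) : contactForm z w = w.1.2 - z.2 w.1.1 := rfl

theorem hasFDerivAt_contactForm (z : JetModel n m) :
    HasFDerivAt (contactForm (n := n) (m := m))
      (-((ContinuousLinearMap.compL ℝ (JetModel n m) (Base n) (Fib m)).flip (projBase n m) ∘L
        ContinuousLinearMap.snd ℝ (Tot n m) (Base n →L[ℝ] Fib m))) z := by
  have h : HasFDerivAt (fun z : JetModel n m => z.2.comp (projBase n m)) _ z :=
    ((ContinuousLinearMap.compL ℝ (JetModel n m) (Base n) (Fib m)).flip (projBase n m) ∘L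
        ContinuousLinearMap.snd ℝ (Tot n m) (Base n →L[ℝ] Fib m)).hasFDerivAt
  exact h.const_sub (projFib n m)

theorem fderiv_contactForm (z h w : JetModel n m) :
    fderiv ℝ contactForm z h w = - h.2 w.1.1 := by
  rw [(hasFDerivAt_contactForm z).fderiv]
  rfl

theorem contactForm_contDiff {r : WithTop ℕ∞} : ContDiff ℝ r (contactForm (n := n) (m := m)) :=
  contDiff_const.sub (contDiff_snd.clm_comp contDiff_const)

theorem poincareCartan_eq (ℓ : JetModel n m → ℝ) : poincareCartan ℓ =
    slotForm (projBase n m) (contactPart (momentum ℓ) contactForm) ℓ := rfl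

theorem poincareCartan_contDiffAt (h : ContDiffAt ℝ ∞ ℓ z) :
    ContDiffAt ℝ ∞ (poincareCartan ℓ) z :=
  slotForm_contDiffAt (contactPart_contDiffAt (momentum_contDiffAt h)
    contactForm_contDiff.contDiffAt) h

/-- `∑ᵢ dxⁱ ⊗ T(∂/∂xⁱ) = T`. -/
theorem sum_dxTensor (T : Base n →L[ℝ] Fib m) : ∑ i, dxTensor i (T (baseVec i)) = T := by
  ext1 u
  have hu : u = ∑ i, u i • baseVec i := by
    have := (EuclideanSpace.basisFun (Fin n) ℝ).sum_repr u
    simpa using this.symm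
  conv_rhs => rw [hu, map_sum]
  simp only [FunLike.coe_sum, Finset.sum_apply, map_smul]
  exact Finset.sum_congr rfl fun i _ => by simp [dxTensor]

/-- The momenta contracted with `T = ∑ᵢ dxⁱ ⊗ T(∂/∂xⁱ)`. -/
theorem sum_momentum (T : Base n →L[ℝ] Fib m) :
    ∑ i, momentum ℓ i z (T (baseVec i)) = fderiv ℝ ℓ z (slopeIncl n m T) := by
  conv_rhs => rw [← sum_dxTensor T]
  exact (map_sum ((fderiv ℝ ℓ z).comp (slopeIncl n m))
    (fun i => dxTensor i (T (baseVec i))) Finset.univ).symm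

/-- The mixed second derivative `∂²ℓ/∂y^α_i∂z` contracted with `T = ∑ᵢ dxⁱ ⊗ T(∂/∂xⁱ)`. -/
theorem sum_fderiv_momentum (hℓ : ContDiffAt ℝ ∞ ℓ z)
    (y : JetModel n m) (T : Base n →L[ℝ] Fib m) :
    ∑ i, fderiv ℝ (momentum ℓ i) z y (T (baseVec i)) =
      fderiv ℝ (fderiv ℝ ℓ) z y (slopeIncl n m T) := by
  have h0 : DifferentiableAt ℝ (fderiv ℝ ℓ) z :=
    (hℓ.fderiv_right (m := ∞) (by simp)).differentiableAt (by simp)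
  have h1 : ∀ i u, fderiv ℝ (momentum ℓ i) z y u =
      fderiv ℝ (fderiv ℝ ℓ) z y (slopeIncl n m (dxTensor i u)) := by
    intro i u
    have h2 : HasFDerivAt (momentum ℓ i) _ z := h0.hasFDerivAt.clm_comp
      (hasFDerivAt_const ((slopeIncl n m).comp (dxTensor i)) z)
    rw [h2.fderiv]
    simp [slopeIncl]
  simp only [h1]
  conv_rhs => rw [← sum_dxTensor T]
  exact (map_sum ((fderiv ℝ (fderiv ℝ ℓ) z y).comp (slopeIncl n m))
      (fun i => dxTensor i (T (baseVec i))) Finset.univ).symm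

/-- The value of `dΘ` on a vertical vector followed by the frame `S(∂/∂xⁱ)` of a horizontal
space. -/
theorem extDeriv_poincareCartan (hℓ : ContDiffAt ℝ ∞ ℓ z) {y : JetModel n m} (hy : y.1.1 = 0)
    {S : Base n →L[ℝ] JetModel n m} (hS : ∀ w, (S w).1.1 = w) :
    extDeriv (poincareCartan ℓ) z (Matrix.vecCons y fun i => S (baseVec i)) =
      elDensity ℓ y.1.2 z S +
        fderiv ℝ (fderiv ℝ ℓ) z y (slopeIncl n m ((contactForm z).comp S)) := by
  have hp : ∀ i, ContDiffAt ℝ 1 (momentum ℓ i) z := fun i =>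
    (momentum_contDiffAt hℓ i).of_le (by simp)
  have hc : ContDiffAt ℝ 1 (contactForm (n := n) (m := m)) z := contactForm_contDiff.contDiffAt
  have h := extDeriv_slotForm (π := projBase n m)
    ((contactPart_contDiffAt hp hc).differentiableAt (by simp))
    (hℓ.differentiableAt (by simp)) (y := y) hy (S := S) hS
  rw [poincareCartan_eq, h]
  simp only [fderiv_contactPart hp hc, fderiv_contactForm, hy, hS, map_zero, neg_zero, add_zero]
  have h7 : contactForm z y = y.1.2 := by
    rw [contactForm_apply, hy, map_zero, sub_zero]
  have h6 : fderiv ℝ ℓ z y =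
      fderiv ℝ ℓ z (fibIncl n m y.1.2) + fderiv ℝ ℓ z (slopeIncl n m y.2) := by
    rw [← map_add]
    congr 1
    ext1
    · ext1
      · exact hy.trans (by simp [fibIncl, slopeIncl])
      · simp [fibIncl, slopeIncl]
    · simp [fibIncl, slopeIncl]
  rw [h6, h7, ← sum_momentum, ← sum_fderiv_momentum hℓ, elDensity, elExpr, Finset.sum_sub_distrib,
    Finset.sum_add_distrib]
  simp only [map_neg, Finset.sum_neg_distrib, ContinuousLinearMap.comp_apply]
  ring

set_option maxHeartbeats 400000 in
/-- The Lie derivative of `dΘ` along a vertical field `Z`, at a point where the horizontal space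
spanned by `S` is in the kernel of the contact forms and solves the Euler-Lagrange equations. -/
theorem lieDeriv_extDeriv_poincareCartan {O : Set (JetModel n m)} (hO : IsOpen O)
    (hℓ : ContDiffOn ℝ ∞ ℓ O) (hz : z ∈ O) {Z : JetModel n m → JetModel n m}
    (hZ : ∀ w, (fderiv ℝ Z z w).1.1 = 0)
    {y : JetModel n m} (hy : y.1.1 = 0)
    {S : Base n →L[ℝ] JetModel n m} (hS : ∀ w, (S w).1.1 = w)
    (hSc : (contactForm z).comp S = 0) (hEL : ∀ u, elDensity ℓ u z S = 0) :
    lieDeriv Z (extDeriv (poincareCartan ℓ)) z (Matrix.vecCons y fun i => S (baseVec i)) =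
      linEL ℓ y.1.2 z S (Z z) ((fderiv ℝ Z z).comp S) +
        fderiv ℝ (fderiv ℝ ℓ) z y
          (slopeIncl n m ((projFib n m).comp ((fderiv ℝ Z z).comp S) - (Z z).2)) := by
  have hat : ∀ {z'}, z' ∈ O → ContDiffAt ℝ ∞ ℓ z' := fun h => hℓ.contDiffAt (hO.mem_nhds h)
  have hd : DifferentiableAt ℝ (extDeriv (poincareCartan ℓ)) z :=
    differentiableAt_extDeriv ((poincareCartan_contDiffAt (hat hz)).of_le (by norm_cast))
  have h2 : DifferentiableAt ℝ (fderiv ℝ (fderiv ℝ ℓ)) z :=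
    (((hat hz).fderiv_right (m := ∞) (by simp)).fderiv_right (m := ∞) (by simp)).differentiableAt
      (by simp)
  have hb : DifferentiableAt ℝ (fun z => (fderiv ℝ (fderiv ℝ ℓ) z y).comp (slopeIncl n m)) z :=
    (h2.clm_apply (differentiableAt_const y)).clm_comp (differentiableAt_const _)
  have hE := (elExpr_contDiffAt (ι := fibIncl n m) (u := y.1.2) (q := (z, S))
    ((hat hz).fderiv_right (m := ∞) (by simp)) (momentum_contDiffAt (hat hz))).differentiableAt
      (by simp)
  have h1 := lieDeriv_of_split hd hE hb (hasFDerivAt_contactForm z).differentiableAt hSc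
    (hO.mem_nhds hz) (π := projBase n m) hS (Z := Z) hZ (e := baseVec)
    (fun z' hz' S' hS' => extDeriv_poincareCartan (hat hz') hy hS')
    (by rw [extDeriv_poincareCartan (hat hz) (hZ y) hS, hEL, hSc, map_zero, map_zero, add_zero])
  rw [h1]
  refine congrArg (_ + ·) (congrArg (fun T => fderiv ℝ (fderiv ℝ ℓ) z y (slopeIncl n m T)) ?_)
  ext1 w
  change fderiv ℝ contactForm z (Z z) (S w) + contactForm z (fderiv ℝ Z z (S w)) =
    (fderiv ℝ Z z (S w)).1.2 - (Z z).2 w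
  rw [fderiv_contactForm, contactForm_apply, hZ, hS, map_zero]
  abel

end JetForms

/-! ### Vector fields along maps in charts -/

section FieldCoordinates

variable {V N : Type*} [NormedAddCommGroup V] [NormedSpace ℝ V] [TopologicalSpace N]
  [ChartedSpace V N] {φ : OpenPartialHomeomorph N V}

theorem mdifferentiable_of_mem_maximalAtlas (hφ : φ ∈ IsManifold.maximalAtlas 𝓘(ℝ, V) ∞ N) :
    φ.MDifferentiable 𝓘(ℝ, V) 𝓘(ℝ, V) :=
  ⟨(contMDiffOn_of_mem_maximalAtlas hφ).mdifferentiableOn (by simp),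
    (contMDiffOn_symm_of_mem_maximalAtlas hφ).mdifferentiableOn (by simp)⟩

theorem mfderiv_symm_mfderiv (hφ : φ ∈ IsManifold.maximalAtlas 𝓘(ℝ, V) ∞ N) {y : N}
    (hy : y ∈ φ.source) (w : TangentSpace 𝓘(ℝ, V) y) :
    (mfderiv 𝓘(ℝ, V) 𝓘(ℝ, V) φ.symm (φ y) (mfderiv 𝓘(ℝ, V) 𝓘(ℝ, V) φ y w) : V) = w :=
  DFunLike.congr_fun ((mdifferentiable_of_mem_maximalAtlas hφ).symm_comp_deriv hy) w

theorem mfderiv_mfderiv_symm (hφ : φ ∈ IsManifold.maximalAtlas 𝓘(ℝ, V) ∞ N) {z : V}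
    (hz : z ∈ φ.target) (w : V) :
    (mfderiv 𝓘(ℝ, V) 𝓘(ℝ, V) φ (φ.symm z) (mfderiv 𝓘(ℝ, V) 𝓘(ℝ, V) φ.symm z w) : V) = w :=
  DFunLike.congr_fun ((mdifferentiable_of_mem_maximalAtlas hφ).comp_symm_deriv hz) w

variable [IsManifold 𝓘(ℝ, V) ∞ N]
  {W H : Type*} [NormedAddCommGroup W] [NormedSpace ℝ W] [TopologicalSpace H]
  {I : ModelWithCorners ℝ W H} {M : Type*} [TopologicalSpace M] [ChartedSpace H M]

/-- The coordinates of a smooth vector field along `f` are smooth. -/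
theorem contMDiffAt_coord_of_field (hφ : φ ∈ IsManifold.maximalAtlas 𝓘(ℝ, V) ∞ N) {f : M → N}
    {X : ∀ x, TangentSpace 𝓘(ℝ, V) (f x)} {x₀ : M} (hx : f x₀ ∈ φ.source)
    (hX : ContMDiffAt I 𝓘(ℝ, V).tangent ∞ (fun x => (⟨f x, X x⟩ : TangentBundle 𝓘(ℝ, V) N)) x₀) :
    ContMDiffAt I 𝓘(ℝ, V) ∞ (fun x => (mfderiv 𝓘(ℝ, V) 𝓘(ℝ, V) φ (f x) (X x) : V)) x₀ := by
  have h1 := (contMDiffOn_of_mem_maximalAtlas hφ).contMDiffOn_tangentMapWithin (m := ∞) (by simp)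
    φ.open_source.uniqueMDiffOn
  have h2 : ContMDiffAt 𝓘(ℝ, V).tangent 𝓘(ℝ, V).tangent ∞
      (tangentMapWithin 𝓘(ℝ, V) 𝓘(ℝ, V) φ φ.source) (⟨f x₀, X x₀⟩ : TangentBundle 𝓘(ℝ, V) N) :=
    h1.contMDiffAt ((φ.open_source.preimage (FiberBundle.continuous_proj V _)).mem_nhds hx)
  have h3 := ((contMDiff_snd_tangentBundle_modelSpace V 𝓘(ℝ, V) (n := ∞)).contMDiffAt).comp x₀
    (h2.comp x₀ hX)
  refine h3.congr_of_eventuallyEq ?_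
  have hf : ContinuousAt f x₀ :=
    (FiberBundle.continuous_proj V (TangentSpace 𝓘(ℝ, V) (M := N))).continuousAt.comp
      hX.continuousAt
  filter_upwards [hf.eventually_mem (φ.open_source.mem_nhds hx)] with x hx
  exact (DFunLike.congr_fun (mfderivWithin_of_isOpen (I := 𝓘(ℝ, V)) (I' := 𝓘(ℝ, V)) (f := φ)
    φ.open_source hx) (X x)).symm

/-- A vector field along `f` with smooth coordinates is smooth. -/
theorem contMDiffAt_field_of_coord (hφ : φ ∈ IsManifold.maximalAtlas 𝓘(ℝ, V) ∞ N) {f : M → N}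
    {X : ∀ x, TangentSpace 𝓘(ℝ, V) (f x)} {x₀ : M} (hx : f x₀ ∈ φ.source)
    (hf : ContMDiffAt I 𝓘(ℝ, V) ∞ f x₀)
    (hX : ContMDiffAt I 𝓘(ℝ, V) ∞ (fun x => (mfderiv 𝓘(ℝ, V) 𝓘(ℝ, V) φ (f x) (X x) : V)) x₀) :
    ContMDiffAt I 𝓘(ℝ, V).tangent ∞ (fun x => (⟨f x, X x⟩ : TangentBundle 𝓘(ℝ, V) N)) x₀ := by
  have h1 := (contMDiffOn_symm_of_mem_maximalAtlas hφ).contMDiffOn_tangentMapWithin (m := ∞)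
    (by simp) φ.open_target.uniqueMDiffOn
  let g : M → TangentBundle 𝓘(ℝ, V) V := fun x =>
    ⟨φ (f x), (mfderiv 𝓘(ℝ, V) 𝓘(ℝ, V) φ (f x) (X x) : V)⟩
  have hφf : ContMDiffAt I 𝓘(ℝ, V) ∞ (fun x => φ (f x)) x₀ :=
    ((contMDiffOn_of_mem_maximalAtlas hφ).contMDiffAt (φ.open_source.mem_nhds hx)).comp x₀ hf
  have hg : ContMDiffAt I 𝓘(ℝ, V).tangent ∞ g x₀ := by
    have h := hφf.prodMk hX
    rw [chartedSpaceSelf_prod] at h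
    exact ContMDiffAt.comp x₀ (contMDiff_tangentBundleModelSpaceHomeomorph_symm (I := 𝓘(ℝ, V))
      (n := ∞)).contMDiffAt h
  have h2 : ContMDiffAt 𝓘(ℝ, V).tangent 𝓘(ℝ, V).tangent ∞
      (tangentMapWithin 𝓘(ℝ, V) 𝓘(ℝ, V) φ.symm φ.target) (g x₀) :=
    h1.contMDiffAt ((φ.open_target.preimage (FiberBundle.continuous_proj V _)).mem_nhds
      (φ.map_source hx))
  refine (h2.comp x₀ hg).congr_of_eventuallyEq ?_
  filter_upwards [hf.continuousAt.eventually_mem (φ.open_source.mem_nhds hx)] with x hx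
  have h4 := mfderiv_symm_mfderiv hφ hx (X x)
  have h5 := (DFunLike.congr_fun (mfderivWithin_of_isOpen (I := 𝓘(ℝ, V)) (I' := 𝓘(ℝ, V))
    (f := φ.symm) φ.open_target (φ.map_source hx)) (mfderiv 𝓘(ℝ, V) 𝓘(ℝ, V) φ (f x) (X x))).trans h4
  have key : ∀ (y : N) (w : V), y = f x → w = (X x : V) →
      (⟨f x, X x⟩ : TangentBundle 𝓘(ℝ, V) N) = ⟨y, (w : TangentSpace 𝓘(ℝ, V) y)⟩ := by
    rintro y w rfl rfl
    rfl
  exact key _ _ (φ.left_inv hx) h5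

end FieldCoordinates

/-! ### The charts of the first jet bundle -/

section JetCharts

variable {n m : ℕ} {M E : Type*} [TopologicalSpace M] [ChartedSpace (Base n) M]
    [TopologicalSpace E] [ChartedSpace (Tot n m) E] {p : E → M}

namespace FibredChart

variable (c : FibredChart n m p)

theorem mfderiv_proj_eq_zero_iff {e : E} (he : e ∈ c.tot.source)
    (w : TangentSpace 𝓘(ℝ, Tot n m) e) :
    mfderiv 𝓘(ℝ, Tot n m) 𝓘(ℝ, Base n) p e w = 0 ↔
      (mfderiv 𝓘(ℝ, Tot n m) 𝓘(ℝ, Tot n m) c.tot e w : Tot n m).1 = 0 := by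
  have h1 := DFunLike.congr_fun (c.mfderiv_base_proj he) w
  have h2 : mfderiv 𝓘(ℝ, Base n) 𝓘(ℝ, Base n) c.base (p e)
      (mfderiv 𝓘(ℝ, Tot n m) 𝓘(ℝ, Base n) p e w) =
      (mfderiv 𝓘(ℝ, Tot n m) 𝓘(ℝ, Tot n m) c.tot e w : Tot n m).1 := h1
  rw [← h2]
  exact (map_eq_zero_iff _ (c.base_mdiff.mfderiv_injective (c.proj_mem e he))).symm

theorem mfderiv_tot_injective {e : E}
    (he : e ∈ c.tot.source) {w w' : TangentSpace 𝓘(ℝ, Tot n m) e}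
    (h : (mfderiv 𝓘(ℝ, Tot n m) 𝓘(ℝ, Tot n m) c.tot e w : Tot n m) =
      mfderiv 𝓘(ℝ, Tot n m) 𝓘(ℝ, Tot n m) c.tot e w') : w = w' :=
  c.tot_mdiff.mfderiv_injective he h

variable [IsManifold 𝓘(ℝ, Tot n m) ∞ E] [IsFibredManifold n m p]

/-- The coordinate system of `J¹E` induced by a fibred chart, as a chart of the manifold `J¹E`. -/
def jetChart : OpenPartialHomeomorph (Jet1 n m p) (JetModel n m) :=
  (jetCore n m p).openPartialHomeomorph c.jet ⟨c, rfl⟩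

theorem mem_jetChart_source {j : Jet1 n m p} : j ∈ c.jetChart.source ↔ j.pt ∈ c.tot.source :=
  Iff.rfl

theorem mem_jetChart_target {z : JetModel n m} : z ∈ c.jetChart.target ↔ z.1 ∈ c.tot.target :=
  Iff.rfl

theorem jetChart_mem : c.jetChart ∈ IsManifold.maximalAtlas 𝓘(ℝ, JetModel n m) ∞ (Jet1 n m p) := by
  refine IsManifold.subset_maximalAtlas ?_
  change c.jetChart ∈ ⋃ (e : PartialEquiv (Jet1 n m p) (JetModel n m))
    (he : e ∈ (jetCore n m p).atlas), {(jetCore n m p).openPartialHomeomorph e he}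
  simp only [Set.mem_iUnion, Set.mem_singleton_iff]
  exact ⟨c.jet, ⟨c, rfl⟩, rfl⟩

end FibredChart

variable [IsManifold 𝓘(ℝ, Tot n m) ∞ E] [IsFibredManifold n m p]

theorem contMDiff_proj10 : ContMDiff 𝓘(ℝ, JetModel n m) 𝓘(ℝ, Tot n m) ∞
    (proj10 (n := n) (m := m) (p := p)) := by
  intro j
  obtain ⟨c, hc⟩ := exists_fibredChart (p := p) (n := n) (m := m) j.pt
  have h1 := (contMDiffOn_of_mem_maximalAtlas c.jetChart_mem).contMDiffAt
    (c.jetChart.open_source.mem_nhds (c.mem_jetChart_source.2 hc))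
  have h2 : ContMDiffAt 𝓘(ℝ, JetModel n m) 𝓘(ℝ, Tot n m) ∞
      (fun z : JetModel n m => z.1) (c.jetChart j) := contDiff_fst.contMDiff.contMDiffAt
  have h3 := (contMDiffOn_symm_of_mem_maximalAtlas c.tot_mem).contMDiffAt
    (c.tot.open_target.mem_nhds (c.tot.map_source hc))
  refine ((h3.comp j (h2.comp j h1)) :).congr_of_eventuallyEq ?_
  filter_upwards [c.jetChart.open_source.mem_nhds (c.mem_jetChart_source.2 hc)] with k hk
  exact (c.tot.left_inv hk).symm

namespace FibredChart

variable (c : FibredChart n m p)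

theorem mfderiv_tot_proj10 {j : Jet1 n m p} (hj : j.pt ∈ c.tot.source)
    (w : TangentSpace 𝓘(ℝ, JetModel n m) j) :
    (mfderiv 𝓘(ℝ, Tot n m) 𝓘(ℝ, Tot n m) c.tot j.pt
      (mfderiv 𝓘(ℝ, JetModel n m) 𝓘(ℝ, Tot n m) (proj10 (n := n) (m := m) (p := p)) j w) :
        Tot n m) = (mfderiv 𝓘(ℝ, JetModel n m) 𝓘(ℝ, JetModel n m) c.jet j w : JetModel n m).1 := by
  have h1 := (c.tot_mdiff.mdifferentiableAt hj).hasMFDerivAt.comp j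
    ((contMDiff_proj10 (p := p) (n := n) (m := m) j).mdifferentiableAt (by simp)).hasMFDerivAt
  have h2 : HasMFDerivAt 𝓘(ℝ, JetModel n m) 𝓘(ℝ, Tot n m)
      (fun z : JetModel n m => z.1) (c.jetChart j)
      (ContinuousLinearMap.fst ℝ (Tot n m) (Base n →L[ℝ] Fib m)) :=
    (ContinuousLinearMap.fst ℝ (Tot n m) (Base n →L[ℝ] Fib m)).hasFDerivAt.hasMFDerivAt
  have h3 := h2.comp j ((mdifferentiable_of_mem_maximalAtlas c.jetChart_mem).mdifferentiableAt
    (c.mem_jetChart_source.2 hj)).hasMFDerivAt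
  exact DFunLike.congr_fun (hasMFDerivAt_unique h1 h3) w

theorem mfderiv_proj1_eq_zero_iff {j : Jet1 n m p} (hj : j.pt ∈ c.tot.source)
    (w : TangentSpace 𝓘(ℝ, JetModel n m) j) :
    mfderiv 𝓘(ℝ, JetModel n m) 𝓘(ℝ, Base n) (proj1 (n := n) (m := m) (p := p)) j w = 0 ↔
      (mfderiv 𝓘(ℝ, JetModel n m) 𝓘(ℝ, JetModel n m) c.jet j w : JetModel n m).1.1 = 0 := by
  have h1 := (c.mdiff_proj hj).hasMFDerivAt.comp j
    ((contMDiff_proj10 (p := p) (n := n) (m := m) j).mdifferentiableAt (by simp)).hasMFDerivAt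
  have h2 : mfderiv 𝓘(ℝ, JetModel n m) 𝓘(ℝ, Base n) (proj1 (n := n) (m := m) (p := p)) j w =
      mfderiv 𝓘(ℝ, Tot n m) 𝓘(ℝ, Base n) p j.pt
        (mfderiv 𝓘(ℝ, JetModel n m) 𝓘(ℝ, Tot n m) (proj10 (n := n) (m := m) (p := p)) j w) :=
    DFunLike.congr_fun h1.mfderiv w
  have h3 := c.mfderiv_proj_eq_zero_iff hj
    (mfderiv 𝓘(ℝ, JetModel n m) 𝓘(ℝ, Tot n m) (proj10 (n := n) (m := m) (p := p)) j w)
  exact ((Iff.of_eq (congrArg (· = 0) h2)).trans h3).trans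
    (Iff.of_eq (congrArg (fun u : Tot n m => u.1 = 0) (c.mfderiv_tot_proj10 hj w)))

end FibredChart

end JetCharts

/-! ### Families of functions and their jets -/

section MixedPartials

variable {B F G : Type*} [NormedAddCommGroup B] [NormedSpace ℝ B] [NormedAddCommGroup F]
  [NormedSpace ℝ F] [NormedAddCommGroup G] [NormedSpace ℝ G]

theorem hasFDerivAt_partial_snd {f : ℝ × B → G} {t : ℝ} {ξ : B}
    (hf : DifferentiableAt ℝ f (t, ξ)) : HasFDerivAt (fun ξ => f (t, ξ))
      ((fderiv ℝ f (t, ξ)).comp (ContinuousLinearMap.inr ℝ ℝ B)) ξ :=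
  HasFDerivAt.comp ξ (f := fun ξ => (t, ξ)) hf.hasFDerivAt (hasFDerivAt_prodMk_right t ξ)

theorem hasDerivAt_partial_fst {f : ℝ × B → G} {t : ℝ} {ξ : B}
    (hf : DifferentiableAt ℝ f (t, ξ)) :
    HasDerivAt (fun t => f (t, ξ)) (fderiv ℝ f (t, ξ) (1, 0)) t := by
  have := (HasFDerivAt.comp t (f := fun t => (t, ξ)) hf.hasFDerivAt
    (hasFDerivAt_prodMk_left t ξ)).hasDerivAt
  exact this.congr_deriv (by simp)

/-- The spatial derivative commutes with the derivative in the parameter. -/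
theorem hasDerivAt_fderiv_partial {f : ℝ × B → G} {O : Set (ℝ × B)} (hO : IsOpen O)
    (hf : ContDiffOn ℝ ∞ f O) {ξ₀ : B} (h0 : ((0 : ℝ), ξ₀) ∈ O) :
    HasDerivAt (fun t : ℝ => fderiv ℝ (fun ξ => f (t, ξ)) ξ₀)
      (fderiv ℝ (fun ξ => deriv (fun t : ℝ => f (t, ξ)) 0) ξ₀) 0 := by
  have hd : ∀ q ∈ O, DifferentiableAt ℝ f q := fun q hq =>
    (hf.contDiffAt (hO.mem_nhds hq)).differentiableAt (by simp)
  have hat := hf.contDiffAt (hO.mem_nhds h0)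
  have hd2 : DifferentiableAt ℝ (fderiv ℝ f) (0, ξ₀) :=
    (hat.fderiv_right (m := ∞) (by simp)).differentiableAt (by simp)
  have hsymm : IsSymmSndFDerivAt ℝ f (0, ξ₀) := hat.isSymmSndFDerivAt
    (by rw [minSmoothness_of_isRCLikeNormedField]; norm_cast)
  have e1 : (fun t : ℝ => fderiv ℝ (fun ξ => f (t, ξ)) ξ₀) =ᶠ[𝓝 0]
      fun t => (fderiv ℝ f (t, ξ₀)).comp (ContinuousLinearMap.inr ℝ ℝ B) := by
    have : ContinuousAt (fun t : ℝ => (t, ξ₀)) 0 := by fun_prop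
    filter_upwards [this.eventually_mem (hO.mem_nhds h0)] with t ht
    exact (hasFDerivAt_partial_snd (hd _ ht)).fderiv
  have e2 : (fun ξ => deriv (fun t : ℝ => f (t, ξ)) 0) =ᶠ[𝓝 ξ₀]
      fun ξ => fderiv ℝ f (0, ξ) (1, 0) := by
    have : ContinuousAt (fun ξ => ((0 : ℝ), ξ)) ξ₀ := by fun_prop
    filter_upwards [this.eventually_mem (hO.mem_nhds h0)] with ξ hξ
    exact (hasDerivAt_partial_fst (hd _ hξ)).deriv
  refine HasDerivAt.congr_of_eventuallyEq ?_ e1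
  have h1 := (hasDerivAt_partial_fst hd2).clm_comp
    (hasDerivAt_const (0 : ℝ) (ContinuousLinearMap.inr ℝ ℝ B))
  refine h1.congr_deriv ?_
  rw [e2.fderiv_eq, ((hasFDerivAt_partial_snd hd2).clm_apply
    (hasFDerivAt_const ((1 : ℝ), (0 : B)) ξ₀)).fderiv]
  ext v
  simpa using (hsymm.eq (1, 0) (0, v))

/-- The `1`-jet of a function as a point of the model of the first jet bundle. -/
def flatJet (a : B → F) (ξ : B) : (B × F) × (B →L[ℝ] F) := ((ξ, a ξ), fderiv ℝ a ξ)

/-- The velocity of the `1`-jets of a family of functions with the initial velocity `X`. -/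
def flatLift (X : B → F) (ξ : B) : (B × F) × (B →L[ℝ] F) := ((0, X ξ), fderiv ℝ X ξ)

theorem flatJet_contDiffOn {a : B → F} {O : Set B} (hO : IsOpen O) (ha : ContDiffOn ℝ ∞ a O) :
    ContDiffOn ℝ ∞ (flatJet a) O :=
  (contDiffOn_id.prodMk ha).prodMk (ha.fderiv_of_isOpen hO (by simp))

theorem flatLift_contDiffOn {a : B → F} {O : Set B} (hO : IsOpen O) (ha : ContDiffOn ℝ ∞ a O) :
    ContDiffOn ℝ ∞ (flatLift a) O :=
  (contDiffOn_const.prodMk ha).prodMk (ha.fderiv_of_isOpen hO (by simp))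

/-- The velocities of the `1`-jets `j¹a_t` at `ξ₀` and of their derivatives at `ξ₀`. -/
theorem hasDerivAt_flatJet {f : ℝ × B → F} {O : Set (ℝ × B)} (hO : IsOpen O)
    (hf : ContDiffOn ℝ ∞ f O) {ξ₀ : B} (h0 : ((0 : ℝ), ξ₀) ∈ O) :
    HasDerivAt (fun t : ℝ => flatJet (fun ξ => f (t, ξ)) ξ₀)
      (flatLift (fun ξ => deriv (fun t => f (t, ξ)) 0) ξ₀) 0 ∧
    HasDerivAt (fun t : ℝ => fderiv ℝ (flatJet fun ξ => f (t, ξ)) ξ₀)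
      (fderiv ℝ (flatLift fun ξ => deriv (fun t => f (t, ξ)) 0) ξ₀) 0 := by
  have hd : ∀ q ∈ O, DifferentiableAt ℝ f q := fun q hq =>
    (hf.contDiffAt (hO.mem_nhds hq)).differentiableAt (by simp)
  have hjet : ∀ ξ, ((0 : ℝ), ξ) ∈ O → HasDerivAt (fun t : ℝ => flatJet (fun ξ => f (t, ξ)) ξ)
      (flatLift (fun ξ => deriv (fun t => f (t, ξ)) 0) ξ) 0 := by
    intro ξ hξ
    have h1 := (hasDerivAt_partial_fst (hd _ hξ)).differentiableAt.hasDerivAt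
    exact ((hasDerivAt_const (0 : ℝ) ξ).prodMk h1).prodMk (hasDerivAt_fderiv_partial hO hf hξ)
  refine ⟨hjet ξ₀ h0, ?_⟩
  let h : ℝ × B → (B × F) × (B →L[ℝ] F) := fun q =>
    ((q.2, f q), (fderiv ℝ f q).comp (ContinuousLinearMap.inr ℝ ℝ B))
  have hh : ContDiffOn ℝ ∞ h O :=
    (contDiffOn_snd.prodMk hf).prodMk
      ((hf.fderiv_of_isOpen hO (by simp)).clm_comp contDiffOn_const)
  have hjh : ∀ t ξ, (t, ξ) ∈ O → flatJet (fun ξ => f (t, ξ)) ξ = h (t, ξ) := by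
    intro t ξ hq
    exact Prod.ext rfl (hasFDerivAt_partial_snd (hd _ hq)).fderiv
  have e1 : (fun t : ℝ => fderiv ℝ (flatJet fun ξ => f (t, ξ)) ξ₀) =ᶠ[𝓝 0]
      fun t => fderiv ℝ (fun ξ => h (t, ξ)) ξ₀ := by
    have : ContinuousAt (fun t : ℝ => (t, ξ₀)) 0 := by fun_prop
    filter_upwards [this.eventually_mem (hO.mem_nhds h0)] with t ht
    refine Filter.EventuallyEq.fderiv_eq ?_
    have : ContinuousAt (fun ξ => (t, ξ)) ξ₀ := by fun_prop
    filter_upwards [this.eventually_mem (hO.mem_nhds ht)] with ξ hξ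
    exact hjh t ξ hξ
  have e2 : (flatLift fun ξ => deriv (fun t => f (t, ξ)) 0) =ᶠ[𝓝 ξ₀]
      fun ξ => deriv (fun t : ℝ => h (t, ξ)) 0 := by
    have : ContinuousAt (fun ξ => ((0 : ℝ), ξ)) ξ₀ := by fun_prop
    filter_upwards [this.eventually_mem (hO.mem_nhds h0)] with ξ hξ
    rw [← (hjet ξ hξ).deriv]
    refine Filter.EventuallyEq.deriv_eq ?_
    have : ContinuousAt (fun t : ℝ => (t, ξ)) 0 := by fun_prop
    filter_upwards [this.eventually_mem (hO.mem_nhds hξ)] with t ht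
    exact hjh t ξ ht
  rw [e2.fderiv_eq]
  exact (hasDerivAt_fderiv_partial hO hh h0).congr_of_eventuallyEq e1

/-- The derivative of the Euler-Lagrange expression along a curve. -/
theorem hasDerivAt_elExpr {n : ℕ} {V : Type*} [NormedAddCommGroup V] [NormedSpace ℝ V]
    {D : V → V →L[ℝ] ℝ} {p : Fin n → V → F →L[ℝ] ℝ} {ι : F →L[ℝ] V} {u : F}
    {z : ℝ → V} {S : ℝ → Base n →L[ℝ] V} {z' : V} {S' : Base n →L[ℝ] V}
    (hD : ContDiffAt ℝ ∞ D (z 0)) (hp : ∀ i, ContDiffAt ℝ ∞ (p i) (z 0))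
    (hz : HasDerivAt z z' 0) (hS : HasDerivAt S S' 0) :
    HasDerivAt (fun t => elExpr D p ι u (z t, S t)) (elExprDeriv D p ι u (z 0) (S 0) z' S') 0 := by
  have h := (elExpr_contDiffAt (ι := ι) (u := u) (q := (z 0, S 0)) hD hp).differentiableAt
    (by simp)
  exact HasFDerivAt.comp_hasDerivAt (0 : ℝ) (f := fun t => (z t, S t)) h.hasFDerivAt (hz.prodMk hS)

/-- The Euler-Lagrange expression along a section of the jet bundle. -/
theorem elExpr_comp {n : ℕ} {V : Type*} [NormedAddCommGroup V] [NormedSpace ℝ V]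
    {D : V → V →L[ℝ] ℝ} {p : Fin n → V → F →L[ℝ] ℝ} {ι : F →L[ℝ] V} {u : F}
    {h : Base n → V} {ξ : Base n} (hh : DifferentiableAt ℝ h ξ)
    (hp : ∀ i, DifferentiableAt ℝ (p i) (h ξ)) :
    elExpr D p ι u (h ξ, fderiv ℝ h ξ) =
      D (h ξ) (ι u) - ∑ i, fderiv ℝ (fun ξ => p i (h ξ) u) ξ (baseVec i) := by
  refine congrArg (D (h ξ) (ι u) - ·) (Finset.sum_congr rfl fun i _ => ?_)
  have h1 := ((hp i).hasFDerivAt.comp ξ hh.hasFDerivAt).clm_apply (hasFDerivAt_const u ξ)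
  have h2 : fderiv ℝ (fun ξ => p i (h ξ) u) ξ = _ := h1.fderiv
  rw [h2]
  simp

end MixedPartials

/-! ### Sections and their jets in fibred charts -/

section Sections

variable {n m : ℕ} {M E : Type*} [TopologicalSpace M] [ChartedSpace (Base n) M]
    [TopologicalSpace E] [ChartedSpace (Tot n m) E] {p : E → M}

namespace FibredChart

variable (c : FibredChart n m p) (s : FibSection n m p)

/-- The set of the `xⁱ` over which the section `s` runs in the domain of the chart. -/
def secDomain : Set (Base n) := {ξ | ξ ∈ c.base.target ∧ s.toFun (c.base.symm ξ) ∈ c.tot.source}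

theorem isOpen_secDomain : IsOpen (c.secDomain s) :=
  c.base.isOpen_inter_preimage_symm (c.tot.open_source.preimage s.smooth.continuous)

variable {c s}

theorem mem_base_source {x : M} (hx : s.toFun x ∈ c.tot.source) : x ∈ c.base.source := by
  have := c.proj_mem _ hx
  rwa [s.proj] at this

theorem base_mem_secDomain {x : M} (hx : s.toFun x ∈ c.tot.source) : c.base x ∈ c.secDomain s := by
  refine ⟨c.base.map_source (mem_base_source hx), ?_⟩
  rwa [c.base.left_inv (mem_base_source hx)]

theorem tot_section {x : M} (hx : s.toFun x ∈ c.tot.source) :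
    c.tot (s.toFun x) = (c.base x, c.sectionRep s.toFun (c.base x)) := by
  refine Prod.ext ?_ ?_
  · rw [c.fst_tot _ hx, s.proj]
  · change _ = (c.tot (s.toFun (c.base.symm (c.base x)))).2
    rw [c.base.left_inv (mem_base_source hx)]

theorem holonomicRep_mem {ξ : Base n} (hξ : ξ ∈ c.secDomain s) :
    (c.holonomicRep s.toFun ξ).1 ∈ c.tot.target := by
  have h := tot_section hξ.2
  rw [c.base.right_inv hξ.1] at h
  change (ξ, c.sectionRep s.toFun ξ) ∈ _
  rw [← h]
  exact c.tot.map_source hξ.2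

theorem holonomicRep_eq (c : FibredChart n m p) (a : M → E) :
    c.holonomicRep a = flatJet (c.sectionRep a) := rfl

variable (c s)

theorem contDiffOn_sectionRep : ContDiffOn ℝ ∞ (c.sectionRep s.toFun) (c.secDomain s) := by
  intro ξ hξ
  have h1 := (contMDiffOn_symm_of_mem_maximalAtlas c.base_mem).contMDiffAt
    (c.base.open_target.mem_nhds hξ.1)
  have h2 := (contMDiffOn_of_mem_maximalAtlas c.tot_mem).contMDiffAt
    (c.tot.open_source.mem_nhds hξ.2)
  have h3 := h2.comp ξ (s.smooth.contMDiffAt.comp ξ h1)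
  exact (contDiff_snd.contDiffAt.comp ξ h3.contDiffAt).contDiffWithinAt

theorem contDiffOn_holonomicRep : ContDiffOn ℝ ∞ (c.holonomicRep s.toFun) (c.secDomain s) :=
  flatJet_contDiffOn (c.isOpen_secDomain s) (c.contDiffOn_sectionRep s)

variable [IsManifold 𝓘(ℝ, Tot n m) ∞ E] [IsFibredManifold n m p]
variable {c s}

theorem jet_jetSection {x : M} (hx : s.toFun x ∈ c.tot.source) :
    c.jet (jetSection s x) = c.holonomicRep s.toFun (c.base x) := by
  refine Prod.ext (tot_section hx) ?_
  have hb := mem_base_source hx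
  have hl := c.base.left_inv hb
  have h1 := (c.base_mdiff.mdifferentiableAt_symm (c.base.map_source hb)).hasMFDerivAt
  have h2 : HasMFDerivAt 𝓘(ℝ, Base n) 𝓘(ℝ, Tot n m) s.toFun (c.base.symm (c.base x))
      (mfderiv 𝓘(ℝ, Base n) 𝓘(ℝ, Tot n m) s.toFun (c.base.symm (c.base x))) :=
    ((s.smooth _).mdifferentiableAt (by simp)).hasMFDerivAt
  have h3 := (c.tot_mdiff.mdifferentiableAt (x := s.toFun (c.base.symm (c.base x)))
    (by rwa [hl])).hasMFDerivAt
  have h4 : HasMFDerivAt 𝓘(ℝ, Tot n m) 𝓘(ℝ, Fib m)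
      (fun z : Tot n m => z.2) (c.tot (s.toFun (c.base.symm (c.base x))))
      (ContinuousLinearMap.snd ℝ (Base n) (Fib m)) :=
    (ContinuousLinearMap.snd ℝ (Base n) (Fib m)).hasFDerivAt.hasMFDerivAt
  have h5 := h4.comp (c.base x) (h3.comp (c.base x) (h2.comp (c.base x) h1))
  have h6 : fderiv ℝ (c.sectionRep s.toFun) (c.base x) =
      (ContinuousLinearMap.snd ℝ (Base n) (Fib m)).comp
        ((mfderiv 𝓘(ℝ, Tot n m) 𝓘(ℝ, Tot n m) c.tot (s.toFun (c.base.symm (c.base x))) :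
            Tot n m →L[ℝ] Tot n m).comp
          ((mfderiv 𝓘(ℝ, Base n) 𝓘(ℝ, Tot n m) s.toFun (c.base.symm (c.base x)) :
              Base n →L[ℝ] Tot n m).comp
            (mfderiv 𝓘(ℝ, Base n) 𝓘(ℝ, Base n) c.base.symm (c.base x) :
              Base n →L[ℝ] Base n))) :=
    HasFDerivAt.fderiv (hasMFDerivAt_iff_hasFDerivAt.1 h5)
  refine Eq.trans ?_ h6.symm
  have key : ∀ x', x' = x → ∀ x'', x'' = x →
      (ContinuousLinearMap.snd ℝ (Base n) (Fib m)).comp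
    ((mfderiv 𝓘(ℝ, Tot n m) 𝓘(ℝ, Tot n m) c.tot (s.toFun x) : Tot n m →L[ℝ] Tot n m).comp
      ((mfderiv 𝓘(ℝ, Base n) 𝓘(ℝ, Tot n m) s.toFun x : Base n →L[ℝ] Tot n m).comp
        (mfderiv 𝓘(ℝ, Base n) 𝓘(ℝ, Base n) c.base.symm (c.base x') : Base n →L[ℝ] Base n))) =
      (ContinuousLinearMap.snd ℝ (Base n) (Fib m)).comp
    ((mfderiv 𝓘(ℝ, Tot n m) 𝓘(ℝ, Tot n m) c.tot (s.toFun x'') : Tot n m →L[ℝ] Tot n m).comp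
      ((mfderiv 𝓘(ℝ, Base n) 𝓘(ℝ, Tot n m) s.toFun x'' : Base n →L[ℝ] Tot n m).comp
        (mfderiv 𝓘(ℝ, Base n) 𝓘(ℝ, Base n) c.base.symm (c.base x) : Base n →L[ℝ] Base n))) := by
    rintro _ rfl _ rfl
    rfl
  exact key (p (s.toFun x)) (s.proj x) _ hl

theorem jetRep_jetSection {ξ : Base n} (hξ : ξ ∈ c.secDomain s) :
    c.jetRep (jetSection s) ξ = c.holonomicRep s.toFun ξ := by
  have := jet_jetSection hξ.2
  rwa [c.base.right_inv hξ.1] at this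

end FibredChart

variable [IsManifold 𝓘(ℝ, Tot n m) ∞ E] [IsFibredManifold n m p]

theorem contMDiff_jetSection (s : FibSection n m p) :
    ContMDiff 𝓘(ℝ, Base n) 𝓘(ℝ, JetModel n m) ∞ (jetSection s) := by
  intro x
  obtain ⟨c, hc⟩ := exists_fibredChart (p := p) (n := n) (m := m) (s.toFun x)
  have hb := FibredChart.mem_base_source hc
  have hξ := FibredChart.base_mem_secDomain hc
  have h1 := (contMDiffOn_of_mem_maximalAtlas c.base_mem).contMDiffAt
    (c.base.open_source.mem_nhds hb)
  have h2 := ((c.contDiffOn_holonomicRep s).contDiffAt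
    ((c.isOpen_secDomain s).mem_nhds hξ)).contMDiffAt
  have h3 := (contMDiffOn_symm_of_mem_maximalAtlas c.jetChart_mem).contMDiffAt
    (c.jetChart.open_target.mem_nhds (c.mem_jetChart_target.2 (FibredChart.holonomicRep_mem hξ)))
  refine ((h3.comp x (h2.comp x h1)) :).congr_of_eventuallyEq ?_
  filter_upwards [s.smooth.continuous.continuousAt.eventually_mem (c.tot.open_source.mem_nhds hc)]
    with y hy
  change _ = c.jet.symm (c.holonomicRep s.toFun (c.base y))
  rw [← FibredChart.jet_jetSection hy]
  exact (c.jet.left_inv hy).symm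

theorem FibredChart.contDiffOn_lagrangian (c : FibredChart n m p) (v : VolumeForm n M)
    {L : Jet1 n m p → ℝ} (hL : ContMDiff 𝓘(ℝ, JetModel n m) 𝓘(ℝ, ℝ) ∞ L) :
    ContDiffOn ℝ ∞ (c.lagrangian v L) c.jetChart.target := by
  have h1 : ContDiffOn ℝ ∞ (fun z => L (c.jet.symm z)) c.jetChart.target :=
    (hL.comp_contMDiffOn (contMDiffOn_symm_of_mem_maximalAtlas c.jetChart_mem)).contDiffOn
  have h2 : ContDiffOn ℝ ∞ (fun z : JetModel n m => chartDensity v.form c.base z.1.1)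
      c.jetChart.target :=
    (v.smooth c.base c.base_mem).comp (contDiff_fst.comp contDiff_fst).contDiffOn
      fun z hz => c.fst_mem hz
  exact h1.mul h2

/-- The Euler-Lagrange operator is `elDensity` on the `2`-jet of the section. -/
theorem eulerLagrange_eq_elDensity {c : FibredChart n m p} {v : VolumeForm n M}
    {L : Jet1 n m p → ℝ} (hL : ContMDiff 𝓘(ℝ, JetModel n m) 𝓘(ℝ, ℝ) ∞ L) {a : M → E} {x : M}
    (ha : ContDiffAt ℝ ∞ (c.sectionRep a) (c.base x))
    (hx : (c.base x, c.sectionRep a (c.base x)) ∈ c.tot.target) (u : Fib m) :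
    eulerLagrange v L c a x u = elDensity (c.lagrangian v L) u (flatJet (c.sectionRep a) (c.base x))
      (fderiv ℝ (flatJet (c.sectionRep a)) (c.base x)) := by
  have hℓ : ContDiffAt ℝ ∞ (c.lagrangian v L) (flatJet (c.sectionRep a) (c.base x)) :=
    (c.contDiffOn_lagrangian v hL).contDiffAt (c.jetChart.open_target.mem_nhds hx)
  have hd : DifferentiableAt ℝ (flatJet (c.sectionRep a)) (c.base x) :=
    ((differentiableAt_id.prodMk (ha.differentiableAt (by simp))).prodMk
      ((ha.fderiv_right (m := ∞) (by simp)).differentiableAt (by simp)) :)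
  exact (elExpr_comp (D := fderiv ℝ (c.lagrangian v L)) (ι := fibIncl n m) (u := u) hd
    fun i => (momentum_contDiffAt hℓ i).differentiableAt (by simp)).symm

end Sections

theorem flatJet_congr {B F : Type*} [NormedAddCommGroup B] [NormedSpace ℝ B] [NormedAddCommGroup F]
    [NormedSpace ℝ F] {a b : B → F} {ξ : B} (h : a =ᶠ[𝓝 ξ] b) : flatJet a =ᶠ[𝓝 ξ] flatJet b := by
  filter_upwards [h, h.fderiv (𝕜 := ℝ)] with η h1 h2
  simp only [flatJet, h1, h2]

theorem flatLift_congr {B F : Type*} [NormedAddCommGroup B] [NormedSpace ℝ B]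
    [NormedAddCommGroup F] [NormedSpace ℝ F] {a b : B → F} {ξ : B} (h : a =ᶠ[𝓝 ξ] b) :
    flatLift a =ᶠ[𝓝 ξ] flatLift b := by
  filter_upwards [h, h.fderiv (𝕜 := ℝ)] with η h1 h2
  simp only [flatLift, h1, h2]

/-! ### Jacobi fields and the linearised Euler-Lagrange equations -/

section Jacobi

variable {n m : ℕ} {M E : Type*} [TopologicalSpace M] [ChartedSpace (Base n) M]
    [TopologicalSpace E] [ChartedSpace (Tot n m) E] {p : E → M}

/-- The components `X^α` of a vertical vector field along the section `s`. -/
def FibredChart.alongRep (c : FibredChart n m p) (s : FibSection n m p)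
    (X : ∀ x : M, TangentSpace 𝓘(ℝ, Tot n m) (s.toFun x)) (ξ : Base n) : Fib m :=
  (mfderiv 𝓘(ℝ, Tot n m) 𝓘(ℝ, Tot n m) c.tot (s.toFun (c.base.symm ξ))
    (X (c.base.symm ξ)) : Tot n m).2

variable {s : FibSection n m p} {X : ∀ x : M, TangentSpace 𝓘(ℝ, Tot n m) (s.toFun x)}

section

variable [IsManifold 𝓘(ℝ, Tot n m) ∞ E]

theorem FibredChart.contDiffOn_alongRep (c : FibredChart n m p)
    (hX : ContMDiff 𝓘(ℝ, Base n) 𝓘(ℝ, Tot n m).tangent ∞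
      (fun x => (⟨s.toFun x, X x⟩ : TangentBundle 𝓘(ℝ, Tot n m) E))) :
    ContDiffOn ℝ ∞ (c.alongRep s X) (c.secDomain s) := by
  intro ξ hξ
  have h1 := (contMDiffOn_symm_of_mem_maximalAtlas c.base_mem).contMDiffAt
    (c.base.open_target.mem_nhds hξ.1)
  have h2 := contMDiffAt_coord_of_field c.tot_mem hξ.2 (hX (c.base.symm ξ))
  have h3 := ContMDiffAt.comp ξ h2 h1
  exact (contDiff_snd.contDiffAt.comp ξ h3.contDiffAt).contDiffWithinAt

theorem FibredChart.mfderiv_tot_along (c : FibredChart n m p) (hX : IsVerticalAlong n p s.toFun X)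
    {x : M} (hx : s.toFun x ∈ c.tot.source) :
    (mfderiv 𝓘(ℝ, Tot n m) 𝓘(ℝ, Tot n m) c.tot (s.toFun x) (X x) : Tot n m) =
      (0, c.alongRep s X (c.base x)) := by
  refine Prod.ext ((c.mfderiv_proj_eq_zero_iff hx (X x)).1 (hX.2 x)) ?_
  have key : ∀ x', x' = x →
      (mfderiv 𝓘(ℝ, Tot n m) 𝓘(ℝ, Tot n m) c.tot (s.toFun x) (X x) : Tot n m).2 =
      (mfderiv 𝓘(ℝ, Tot n m) 𝓘(ℝ, Tot n m) c.tot (s.toFun x') (X x') : Tot n m).2 := by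
    rintro _ rfl
    rfl
  exact key _ (c.base.left_inv (FibredChart.mem_base_source hx))

/-- Locally every vertical vector field along `s` is the velocity of a variation, namely of
`s + tX` in a fibred chart. -/
theorem exists_isVariation (c : FibredChart n m p) (hX : IsVerticalAlong n p s.toFun X)
    {x : M} (hx : s.toFun x ∈ c.tot.source) : ∃ ε U S, IsVariation s X ε U S ∧ x ∈ U := by
  have hξ := FibredChart.base_mem_secDomain hx
  have hxb := FibredChart.mem_base_source hx
  have ha := c.contDiffOn_sectionRep s
  have hr := c.contDiffOn_alongRep hX.1
  let g : ℝ × Base n → Tot n m := fun q =>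
    (q.2, c.sectionRep s.toFun q.2 + q.1 • c.alongRep s X q.2)
  have hg : ContDiffOn ℝ ∞ g (Set.univ ×ˢ c.secDomain s) := by
    have ha' := ha.comp (contDiff_snd (𝕜 := ℝ) (E := ℝ)).contDiffOn
      (s := Set.univ ×ˢ c.secDomain s) fun q hq => hq.2
    have hr' := hr.comp (contDiff_snd (𝕜 := ℝ) (E := ℝ)).contDiffOn
      (s := Set.univ ×ˢ c.secDomain s) fun q hq => hq.2
    exact contDiff_snd.contDiffOn.prodMk (ha'.add (contDiff_fst.contDiffOn.smul hr'))
  have hopen := hg.continuousOn.isOpen_inter_preimage (isOpen_univ.prod (c.isOpen_secDomain s))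
    c.tot.open_target
  have hg0 : ∀ y, s.toFun y ∈ c.tot.source → g (0, c.base y) = c.tot (s.toFun y) := by
    intro y hy
    rw [FibredChart.tot_section hy]
    simp [g]
  have h0 : ((0 : ℝ), c.base x) ∈ (Set.univ ×ˢ c.secDomain s) ∩ g ⁻¹' c.tot.target :=
    ⟨⟨trivial, hξ⟩, by
      rw [Set.mem_preimage, hg0 x hx]
      exact c.tot.map_source hx⟩
  obtain ⟨A, hA, W, hW, hAW⟩ := mem_nhds_prod_iff.1 (hopen.mem_nhds h0)
  obtain ⟨ε, hε, hεA⟩ := Metric.mem_nhds_iff.1 hA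
  obtain ⟨W', hW'W, hW', hxW'⟩ := mem_nhds_iff.1 hW
  rw [Real.ball_eq_Ioo, zero_sub, zero_add] at hεA
  let U : Set M := c.base.source ∩ c.base ⁻¹' W'
  have hU : ∀ t ∈ Set.Ioo (-ε) ε, ∀ y ∈ U, c.base y ∈ c.secDomain s ∧
      g (t, c.base y) ∈ c.tot.target := fun t ht y hy => by
    have := hAW (Set.mk_mem_prod (hεA ht) (hW'W hy.2))
    exact ⟨this.1.2, this.2⟩
  have hsU : ∀ y ∈ U, s.toFun y ∈ c.tot.source := fun y hy => by
    have := (hU 0 ⟨by linarith, hε⟩ y hy).1.2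
    rwa [c.base.left_inv hy.1] at this
  refine ⟨ε, U, fun t y => c.tot.symm (g (t, c.base y)), ⟨hε, c.base.isOpen_inter_preimage hW',
    ?_, ?_, ?_, ?_⟩, hxb, hxW'⟩
  · refine (contMDiffOn_symm_of_mem_maximalAtlas c.tot_mem).comp (t := c.tot.target) ?_
      fun q hq => (hU q.1 hq.1 q.2 hq.2).2
    have h1 : ContMDiffOn (𝓘(ℝ, ℝ).prod 𝓘(ℝ, Base n)) 𝓘(ℝ, ℝ × Base n) ∞
        (fun q : ℝ × M => (q.1, c.base q.2)) (Set.Ioo (-ε) ε ×ˢ U) :=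
      contMDiffOn_fst.prodMk_space ((contMDiffOn_of_mem_maximalAtlas c.base_mem).comp
        contMDiffOn_snd fun q hq => hq.2.1)
    exact hg.contMDiffOn.comp h1 fun q hq => ⟨trivial, (hU q.1 hq.1 q.2 hq.2).1⟩
  · intro t ht y hy
    rw [c.proj_symm (hU t ht y hy).2]
    exact c.base.left_inv hy.1
  · intro y hy
    rw [hg0 y (hsU y hy), c.tot.left_inv (hsU y hy)]
  · intro y hy
    have h1 : HasDerivAt (fun t : ℝ => g (t, c.base y))
        ((0, c.alongRep s X (c.base y)) : Tot n m) 0 := by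
      refine (hasDerivAt_const (0 : ℝ) (c.base y)).prodMk ?_
      simpa using ((hasDerivAt_id (0 : ℝ)).smul_const (c.alongRep s X (c.base y))).const_add
        (c.sectionRep s.toFun (c.base y))
    have h2 := hg0 y (hsU y hy)
    have h3 := (c.tot_mdiff.mdifferentiableAt_symm (x := g (0, c.base y))
      (by rw [h2]; exact c.tot.map_source (hsU y hy))).hasMFDerivAt
    have h4 := (h3.comp (0 : ℝ) h1.hasFDerivAt.hasMFDerivAt).mfderiv
    have h5 := DFunLike.congr_fun h4 (1 : ℝ)
    refine h5.trans ?_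
    have h6 := mfderiv_symm_mfderiv c.tot_mem (hsU y hy) (X y)
    rw [c.mfderiv_tot_along hX (hsU y hy)] at h6
    refine Eq.trans ?_ h6
    have key : ∀ z z' : Tot n m, z = z' → ∀ w w' : Tot n m, w = w' →
        (mfderiv 𝓘(ℝ, Tot n m) 𝓘(ℝ, Tot n m) c.tot.symm z w : Tot n m) =
          mfderiv 𝓘(ℝ, Tot n m) 𝓘(ℝ, Tot n m) c.tot.symm z' w' := by
      rintro _ _ rfl _ _ rfl
      rfl
    exact key _ _ h2 _ _ (one_smul ℝ ((0, c.alongRep s X (c.base y)) : Tot n m))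

end

/-- The coordinate expression of a variation is smooth on the open set where it is defined. -/
theorem IsVariation.isOpen_domain {ε : ℝ} {U : Set M} {S : ℝ → M → E}
    (hS : IsVariation s X ε U S) (c : FibredChart n m p) :
    ∃ O : Set (ℝ × Base n), IsOpen O ∧
      ContDiffOn ℝ ∞ (fun q : ℝ × Base n => c.sectionRep (S q.1) q.2) O ∧
      ∀ t ξ, (t, ξ) ∈ O ↔ (t ∈ Set.Ioo (-ε) ε ∧ ξ ∈ c.base.target ∧ c.base.symm ξ ∈ U) ∧
        S t (c.base.symm ξ) ∈ c.tot.source := by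
  let O₁ : Set (ℝ × Base n) := Set.Ioo (-ε) ε ×ˢ (c.base.target ∩ c.base.symm ⁻¹' U)
  have hO₁ : IsOpen O₁ := isOpen_Ioo.prod (c.base.isOpen_inter_preimage_symm hS.isOpen)
  let g : ℝ × Base n → E := fun q => S q.1 (c.base.symm q.2)
  have hg : ContMDiffOn 𝓘(ℝ, ℝ × Base n) 𝓘(ℝ, Tot n m) ∞ g O₁ := by
    have h1 : ContMDiffOn 𝓘(ℝ, ℝ × Base n) 𝓘(ℝ, Base n) ∞
        (fun q : ℝ × Base n => c.base.symm q.2) O₁ :=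
      (contMDiffOn_symm_of_mem_maximalAtlas c.base_mem).comp
        (contDiff_snd.contMDiff.contMDiffOn) fun q hq => hq.2.1
    have h2 : ContMDiffOn 𝓘(ℝ, ℝ × Base n) 𝓘(ℝ, ℝ) ∞ (fun q : ℝ × Base n => q.1) O₁ :=
      contDiff_fst.contMDiff.contMDiffOn
    exact hS.smooth.comp (h2.prodMk h1) fun q hq => ⟨hq.1, hq.2.2⟩
  refine ⟨O₁ ∩ g ⁻¹' c.tot.source, hg.continuousOn.isOpen_inter_preimage hO₁ c.tot.open_source,
    ?_, fun t ξ => Iff.rfl⟩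
  have h3 := ((contMDiffOn_of_mem_maximalAtlas c.tot_mem).comp (hg.mono Set.inter_subset_left)
    fun q hq => hq.2).contDiffOn
  exact contDiff_snd.comp_contDiffOn h3

theorem IsVariation.deriv_sectionRep {ε : ℝ} {U : Set M} {S : ℝ → M → E}
    (hS : IsVariation s X ε U S) (c : FibredChart n m p) {ξ : Base n} (hU : c.base.symm ξ ∈ U)
    (hξ : s.toFun (c.base.symm ξ) ∈ c.tot.source) :
    deriv (fun t => c.sectionRep (S t) ξ) 0 = c.alongRep s X ξ := by
  set x := c.base.symm ξ with hx
  have h0 : S 0 x = s.toFun x := hS.zero x hU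
  have h1 : HasMFDerivAt 𝓘(ℝ, ℝ) 𝓘(ℝ, Tot n m) (fun t => S t x) 0
      (mfderiv 𝓘(ℝ, ℝ) 𝓘(ℝ, Tot n m) (fun t => S t x) 0) := by
    have ha := (hS.smooth (0, x) ⟨⟨by linarith [hS.pos], hS.pos⟩, hU⟩).contMDiffAt
      ((isOpen_Ioo.prod hS.isOpen).mem_nhds ⟨⟨by linarith [hS.pos], hS.pos⟩, hU⟩)
    have hb : ContMDiffAt 𝓘(ℝ, ℝ) (𝓘(ℝ, ℝ).prod 𝓘(ℝ, Base n)) ∞ (fun t : ℝ => (t, x)) 0 :=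
      contMDiffAt_id.prodMk contMDiffAt_const
    exact ((ContMDiffAt.comp (0 : ℝ) ha hb).mdifferentiableAt (by simp)).hasMFDerivAt
  have h2 := (c.tot_mdiff.mdifferentiableAt (x := S 0 x) (by rwa [h0])).hasMFDerivAt
  have h3 := hasMFDerivAt_iff_hasFDerivAt.1 (h2.comp (0 : ℝ) h1)
  have h4 := ((ContinuousLinearMap.snd ℝ (Base n) (Fib m)).hasFDerivAt.comp (0 : ℝ) h3).hasDerivAt
  refine h4.deriv.trans ?_
  have key : ∀ (e : E) (w : Tot n m), e = s.toFun x → w = X x →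
      (mfderiv 𝓘(ℝ, Tot n m) 𝓘(ℝ, Tot n m) c.tot e w : Tot n m).2 =
      (mfderiv 𝓘(ℝ, Tot n m) 𝓘(ℝ, Tot n m) c.tot (s.toFun x) (X x) : Tot n m).2 := by
    rintro _ _ rfl rfl
    rfl
  exact key (S 0 x) _ h0 (hS.velocity x hU)

variable [IsManifold 𝓘(ℝ, Tot n m) ∞ E] [IsFibredManifold n m p]
variable {v : VolumeForm n M} {L : Jet1 n m p → ℝ}

/-- The derivative of the Euler-Lagrange operator along a variation. -/
theorem IsVariation.hasDerivAt_eulerLagrange (hL : ContMDiff 𝓘(ℝ, JetModel n m) 𝓘(ℝ, ℝ) ∞ L)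
    {ε : ℝ} {U : Set M} {S : ℝ → M → E} (hS : IsVariation s X ε U S) (c : FibredChart n m p)
    {x : M} (hxU : x ∈ U) (hx : s.toFun x ∈ c.tot.source) (u : Fib m) :
    HasDerivAt (fun t => eulerLagrange v L c (S t) x u)
      (linEL (c.lagrangian v L) u (c.holonomicRep s.toFun (c.base x))
        (fderiv ℝ (c.holonomicRep s.toFun) (c.base x)) (flatLift (c.alongRep s X) (c.base x))
        (fderiv ℝ (flatLift (c.alongRep s X)) (c.base x))) 0 := by
  obtain ⟨O, hO, hf, hmem⟩ := hS.isOpen_domain c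
  have hxb := FibredChart.mem_base_source hx
  have hl := c.base.left_inv hxb
  have hpos : (0 : ℝ) ∈ Set.Ioo (-ε) ε := ⟨by linarith [hS.pos], hS.pos⟩
  have h0 : ((0 : ℝ), c.base x) ∈ O := (hmem _ _).2
    ⟨⟨hpos, c.base.map_source hxb, by rwa [hl]⟩, by rwa [hl, hS.zero x hxU]⟩
  have hnear : ∀ᶠ ξ in 𝓝 (c.base x), ((0 : ℝ), ξ) ∈ O := by
    have : ContinuousAt (fun ξ => ((0 : ℝ), ξ)) (c.base x) := by fun_prop
    exact this.eventually_mem (hO.mem_nhds h0)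
  have e0 : c.sectionRep (S 0) =ᶠ[𝓝 (c.base x)] c.sectionRep s.toFun := by
    filter_upwards [hnear] with ξ hξ
    exact congrArg (fun e => (c.tot e).2) (hS.zero _ ((hmem _ _).1 hξ).1.2.2)
  have eX : (fun ξ => deriv (fun t => c.sectionRep (S t) ξ) 0) =ᶠ[𝓝 (c.base x)]
      c.alongRep s X := by
    filter_upwards [hnear] with ξ hξ
    have h1 := (hmem _ _).1 hξ
    exact hS.deriv_sectionRep c h1.1.2.2 (by rw [← hS.zero _ h1.1.2.2]; exact h1.2)
  obtain ⟨hz, hSd⟩ := hasDerivAt_flatJet hO hf h0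
  have hz0 : flatJet (c.sectionRep (S 0)) (c.base x) = c.holonomicRep s.toFun (c.base x) :=
    (flatJet_congr e0).self_of_nhds
  have hℓ : ContDiffAt ℝ ∞ (c.lagrangian v L) (flatJet (c.sectionRep (S 0)) (c.base x)) := by
    rw [hz0]
    exact (c.contDiffOn_lagrangian v hL).contDiffAt (c.jetChart.open_target.mem_nhds
      (FibredChart.holonomicRep_mem (FibredChart.base_mem_secDomain hx)))
  have h := hasDerivAt_elExpr (D := fderiv ℝ (c.lagrangian v L))
    (p := momentum (c.lagrangian v L)) (ι := fibIncl n m) (u := u)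
    (z := fun t => flatJet (c.sectionRep (S t)) (c.base x))
    (S := fun t => fderiv ℝ (flatJet (c.sectionRep (S t))) (c.base x))
    (hℓ.fderiv_right (by simp)) (momentum_contDiffAt hℓ) hz hSd
  rw [(flatLift_congr eX).self_of_nhds, (flatLift_congr eX).fderiv_eq, hz0,
    (flatJet_congr e0).fderiv_eq] at h
  refine h.congr_of_eventuallyEq ?_
  have hc : ContinuousAt (fun t : ℝ => (t, c.base x)) 0 := by fun_prop
  filter_upwards [hc.eventually_mem (hO.mem_nhds h0)] with t ht
  have ht' := (hmem _ _).1 ht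
  rw [hl] at ht'
  refine eulerLagrange_eq_elDensity hL ?_ ?_ u
  · exact ContDiffAt.comp (c.base x) (f := fun ξ => (t, ξ)) (hf.contDiffAt (hO.mem_nhds ht))
      (contDiffAt_const.prodMk contDiffAt_id)
  · have h1 : (c.base x, c.sectionRep (S t) (c.base x)) = c.tot (S t x) := by
      refine Prod.ext ?_ ?_
      · rw [c.fst_tot _ ht'.2, hS.proj t ht'.1.1 x hxU]
      · change (c.tot (S t (c.base.symm (c.base x)))).2 = _
        rw [hl]
    rw [h1]
    exact c.tot.map_source ht'.2

/-- Jacobi fields are the solutions to the linearised Euler-Lagrange equations. -/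
theorem isJacobiField_iff (hL : ContMDiff 𝓘(ℝ, JetModel n m) 𝓘(ℝ, ℝ) ∞ L) :
    IsJacobiField v L s X ↔ IsVerticalAlong n p s.toFun X ∧
      ∀ (c : FibredChart n m p) (x : M), s.toFun x ∈ c.tot.source → ∀ u,
        linEL (c.lagrangian v L) u (c.holonomicRep s.toFun (c.base x))
          (fderiv ℝ (c.holonomicRep s.toFun) (c.base x)) (flatLift (c.alongRep s X) (c.base x))
          (fderiv ℝ (flatLift (c.alongRep s X)) (c.base x)) = 0 := by
  refine and_congr_right fun hX => ⟨fun h c x hx u => ?_, fun h c ε U S hS x hxU hx u => ?_⟩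
  · obtain ⟨ε, U, S, hS, hxU⟩ := exists_isVariation c hX hx
    exact (hS.hasDerivAt_eulerLagrange hL c hxU hx u).unique (h c ε U S hS x hxU hx u)
  · have h1 := hS.hasDerivAt_eulerLagrange (v := v) hL c hxU hx u
    rwa [h c x hx u] at h1

end Jacobi

/-- An `n`-form on `ℝⁿ` is determined by its value on the standard frame. -/
theorem eq_zero_of_apply_baseVec {n : ℕ} (μ : Base n [⋀^Fin n]→L[ℝ] ℝ) (h : μ baseVec = 0) :
    μ = 0 := by
  have h1 := AlternatingMap.eq_smul_basis_det (EuclideanSpace.basisFun (Fin n) ℝ).toBasis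
    μ.toAlternatingMap
  have h2 : ⇑(EuclideanSpace.basisFun (Fin n) ℝ).toBasis = baseVec := by
    ext1 i; simp
  rw [h2] at h1
  have h3 : μ.toAlternatingMap baseVec = 0 := h
  rw [h3, zero_smul] at h1
  ext w
  exact congrArg (fun ν : Base n [⋀^Fin n]→ₗ[ℝ] ℝ => ν w) h1

/-- The horizontal space of a holonomic section: it projects isomorphically to the base, and the
contact forms vanish on it. -/
theorem fderiv_flatJet {n m : ℕ} {a : Base n → Fib m} {ξ : Base n} {O : Set (Base n)}
    (hO : IsOpen O) (ha : ContDiffOn ℝ ∞ a O) (hξ : ξ ∈ O) :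
    (∀ w, (fderiv ℝ (flatJet a) ξ w : JetModel n m).1.1 = w) ∧
      (contactForm (flatJet a ξ)).comp (fderiv ℝ (flatJet a) ξ) = 0 := by
  have h1 := ((ha.contDiffAt (hO.mem_nhds hξ)).differentiableAt (by simp)).hasFDerivAt
  have h2 := ((((ha.contDiffAt (hO.mem_nhds hξ)).fderiv_right (m := ∞) (by simp))).differentiableAt
    (by simp)).hasFDerivAt
  have h3 : HasFDerivAt (flatJet a) _ ξ := ((hasFDerivAt_id ξ).prodMk h1).prodMk h2
  rw [h3.fderiv]
  refine ⟨fun w => rfl, ?_⟩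
  ext1 w
  change fderiv ℝ a ξ w - fderiv ℝ a ξ w = 0
  exact sub_self _

/-- The linearised Hamilton-Cartan expression on the vertical vector `y` for a vertical field with
the value `z'` and the derivative `S'` along a holonomic section that has the value `z` and the
derivative `S`. The second summand measures how far the field is from the lift of its projection. -/
def linHC {n m : ℕ} (ℓ : JetModel n m → ℝ) (y z : JetModel n m) (S : Base n →L[ℝ] JetModel n m)
    (z' : JetModel n m) (S' : Base n →L[ℝ] JetModel n m) : ℝ :=
  linEL ℓ y.1.2 z S z' S' + fderiv ℝ (fderiv ℝ ℓ) z y (slopeIncl n m ((projFib n m).comp S' - z'.2))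

/-! ### The Hamilton-Cartan equations and their linearisation -/

section HamiltonCartan

variable {n m : ℕ} {M E : Type*} [TopologicalSpace M] [ChartedSpace (Base n) M]
    [TopologicalSpace E] [ChartedSpace (Tot n m) E] {p : E → M}
    [IsManifold 𝓘(ℝ, Tot n m) ∞ E] [IsFibredManifold n m p]
    {s : FibSection n m p}
    {X : ∀ x : M, TangentSpace 𝓘(ℝ, JetModel n m) (jetSection s x)}
    {Z : ∀ j : Jet1 n m p, TangentSpace 𝓘(ℝ, JetModel n m) j}
    {v : VolumeForm n M} {L : Jet1 n m p → ℝ}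

namespace FibredChart

variable (c : FibredChart n m p)

variable (s) in
/-- The coordinate expression of a vector field along `j¹s`. -/
def jetAlongRep (X : ∀ x : M, TangentSpace 𝓘(ℝ, JetModel n m) (jetSection s x)) (ξ : Base n) :
    JetModel n m :=
  mfderiv 𝓘(ℝ, JetModel n m) 𝓘(ℝ, JetModel n m) c.jet (jetSection s (c.base.symm ξ))
    (X (c.base.symm ξ))

theorem contDiffOn_jetAlongRep (hX : IsVerticalAlong n proj1 (jetSection s) X) :
    ContDiffOn ℝ ∞ (c.jetAlongRep s X) (c.secDomain s) := by
  intro ξ hξ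
  have h1 := (contMDiffOn_symm_of_mem_maximalAtlas c.base_mem).contMDiffAt
    (c.base.open_target.mem_nhds hξ.1)
  have h2 := contMDiffAt_coord_of_field c.jetChart_mem (c.mem_jetChart_source.2 hξ.2)
    (hX.1 (c.base.symm ξ))
  exact (ContMDiffAt.comp ξ h2 h1).contDiffAt.contDiffWithinAt

theorem jetAlongRep_vertical (hX : IsVerticalAlong n proj1 (jetSection s) X) {ξ : Base n}
    (hξ : ξ ∈ c.secDomain s) : (c.jetAlongRep s X ξ).1.1 = 0 :=
  (c.mfderiv_proj1_eq_zero_iff (j := jetSection s (c.base.symm ξ)) hξ.2 _).1 (hX.2 _)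

theorem contDiffOn_fieldRep (hZ : ContMDiff 𝓘(ℝ, JetModel n m) 𝓘(ℝ, JetModel n m).tangent ∞
      (fun j => (⟨j, Z j⟩ : TangentBundle 𝓘(ℝ, JetModel n m) (Jet1 n m p)))) :
    ContDiffOn ℝ ∞ (c.fieldRep Z) c.jetChart.target := by
  intro z hz
  have h1 := (contMDiffOn_symm_of_mem_maximalAtlas c.jetChart_mem).contMDiffAt
    (c.jetChart.open_target.mem_nhds hz)
  have h2 := contMDiffAt_coord_of_field (f := fun j => j) c.jetChart_mem (c.jetChart.map_target hz)
    (hZ (c.jetChart.symm z))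
  exact (ContMDiffAt.comp z h2 h1).contDiffAt.contDiffWithinAt

theorem fieldRep_vertical (hZ : IsVerticalField n (proj1 (p := p) (m := m)) Z) {z : JetModel n m}
    (hz : z ∈ c.jetChart.target) : (c.fieldRep Z z).1.1 = 0 :=
  (c.mfderiv_proj1_eq_zero_iff (j := c.jet.symm z) (c.jetChart.map_target hz) _).1 (hZ.2 _)

theorem fieldRep_jet {j : Jet1 n m p} (hj : j.pt ∈ c.tot.source) : c.fieldRep Z (c.jet j) =
    mfderiv 𝓘(ℝ, JetModel n m) 𝓘(ℝ, JetModel n m) c.jet j (Z j) := by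
  have key : ∀ k, k = j → (mfderiv 𝓘(ℝ, JetModel n m) 𝓘(ℝ, JetModel n m) c.jet k (Z k) :
      JetModel n m) = mfderiv 𝓘(ℝ, JetModel n m) 𝓘(ℝ, JetModel n m) c.jet j (Z j) := by
    rintro _ rfl
    rfl
  exact key _ (c.jet.left_inv hj)

theorem fieldRep_holonomicRep (hZ : ∀ x, Z (jetSection s x) = X x) {ξ : Base n}
    (hξ : ξ ∈ c.secDomain s) : c.fieldRep Z (c.holonomicRep s.toFun ξ) = c.jetAlongRep s X ξ := by
  have h1 := jet_jetSection hξ.2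
  rw [c.base.right_inv hξ.1] at h1
  rw [← h1, c.fieldRep_jet (j := jetSection s (c.base.symm ξ)) hξ.2, hZ]
  rfl

theorem fderiv_jetRep {x : M} (hx : s.toFun x ∈ c.tot.source) :
    fderiv ℝ (c.jetRep (jetSection s)) (c.base x) =
      fderiv ℝ (c.holonomicRep s.toFun) (c.base x) := by
  refine Filter.EventuallyEq.fderiv_eq ?_
  filter_upwards [(c.isOpen_secDomain s).mem_nhds (base_mem_secDomain hx)] with ξ hξ
  exact jetRep_jetSection hξ

end FibredChart

theorem elDensity_holonomicRep (hL : ContMDiff 𝓘(ℝ, JetModel n m) 𝓘(ℝ, ℝ) ∞ L)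
    (hs : IsExtremal v L s) (c : FibredChart n m p) {x : M} (hx : s.toFun x ∈ c.tot.source)
    (u : Fib m) : elDensity (c.lagrangian v L) u (c.holonomicRep s.toFun (c.base x))
      (fderiv ℝ (c.holonomicRep s.toFun) (c.base x)) = 0 := by
  have hξ := FibredChart.base_mem_secDomain hx
  rw [← hs c x hx u]
  exact (eulerLagrange_eq_elDensity hL ((c.contDiffOn_sectionRep s).contDiffAt
    ((c.isOpen_secDomain s).mem_nhds hξ)) (FibredChart.holonomicRep_mem hξ) u).symm

/-- On a holonomic section the contact forms vanish, so that the Hamilton-Cartan equations reduce to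
the Euler-Lagrange equations. -/
theorem isHCSolution_jetSection (hL : ContMDiff 𝓘(ℝ, JetModel n m) 𝓘(ℝ, ℝ) ∞ L)
    (hs : IsExtremal v L s) : IsHCSolution v L (jetSection s) := by
  refine ⟨contMDiff_jetSection s, s.proj, fun Y hY c x hx => eq_zero_of_apply_baseVec _ ?_⟩
  have hx' : s.toFun x ∈ c.tot.source := hx
  have hξ := FibredChart.base_mem_secDomain hx'
  rw [FibredChart.jet_jetSection hx', c.fderiv_jetRep hx']
  have hz : c.holonomicRep s.toFun (c.base x) ∈ c.jetChart.target := FibredChart.holonomicRep_mem hξ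
  have hS := fderiv_flatJet (c.isOpen_secDomain s) (c.contDiffOn_sectionRep s) hξ
  have h := extDeriv_poincareCartan ((c.contDiffOn_lagrangian v hL).contDiffAt
    (c.jetChart.open_target.mem_nhds hz)) (c.fieldRep_vertical hY hz) hS.1
  have h2 := elDensity_holonomicRep hL hs c hx'
    (c.fieldRep Y (c.holonomicRep s.toFun (c.base x))).1.2
  refine h.trans ?_
  rw [FibredChart.holonomicRep_eq] at h2 ⊢
  rw [hS.2, map_zero, map_zero, add_zero, h2]

variable (v L s) in
/-- The linearised Hamilton-Cartan equations for a vertical field along `j¹s`, in coordinates. -/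
def SolvesLinHC (X : ∀ x : M, TangentSpace 𝓘(ℝ, JetModel n m) (jetSection s x)) : Prop :=
  ∀ Y : (∀ j : Jet1 n m p, TangentSpace 𝓘(ℝ, JetModel n m) j), IsVerticalField n proj1 Y →
    ∀ (c : FibredChart n m p) (x : M), s.toFun x ∈ c.tot.source →
      linHC (c.lagrangian v L) (c.fieldRep Y (c.holonomicRep s.toFun (c.base x)))
        (c.holonomicRep s.toFun (c.base x)) (fderiv ℝ (c.holonomicRep s.toFun) (c.base x))
        (c.jetAlongRep s X (c.base x)) (fderiv ℝ (c.jetAlongRep s X) (c.base x)) = 0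

/-- The linearised Hamilton-Cartan equations only involve the values of the field along `j¹s`. -/
theorem linearisedHC_iff (hL : ContMDiff 𝓘(ℝ, JetModel n m) 𝓘(ℝ, ℝ) ∞ L)
    (hs : IsExtremal v L s) (hZ : IsVerticalExtension n proj1 (jetSection s) X Z) :
    LinearisedHC v L (jetSection s) Z ↔ SolvesLinHC s v L X := by
  have main : ∀ Y : (∀ j : Jet1 n m p, TangentSpace 𝓘(ℝ, JetModel n m) j),
      IsVerticalField n proj1 Y → ∀ (c : FibredChart n m p) (x : M), s.toFun x ∈ c.tot.source →
      lieDeriv (c.fieldRep Z) (extDeriv (poincareCartan (c.lagrangian v L)))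
          (c.holonomicRep s.toFun (c.base x))
        (Matrix.vecCons (c.fieldRep Y (c.holonomicRep s.toFun (c.base x)))
          fun i => fderiv ℝ (c.holonomicRep s.toFun) (c.base x) (baseVec i)) =
      linHC (c.lagrangian v L) (c.fieldRep Y (c.holonomicRep s.toFun (c.base x)))
        (c.holonomicRep s.toFun (c.base x)) (fderiv ℝ (c.holonomicRep s.toFun) (c.base x))
        (c.jetAlongRep s X (c.base x)) (fderiv ℝ (c.jetAlongRep s X) (c.base x)) := by
    intro Y hY c x hx
    have hξ := FibredChart.base_mem_secDomain hx
    have hz : c.holonomicRep s.toFun (c.base x) ∈ c.jetChart.target :=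
      FibredChart.holonomicRep_mem hξ
    have hS := fderiv_flatJet (c.isOpen_secDomain s) (c.contDiffOn_sectionRep s) hξ
    have hZd : DifferentiableAt ℝ (c.fieldRep Z) (c.holonomicRep s.toFun (c.base x)) :=
      ((c.contDiffOn_fieldRep hZ.1.1).contDiffAt
        (c.jetChart.open_target.mem_nhds hz)).differentiableAt (by simp)
    have hZv : ∀ w, (fderiv ℝ (c.fieldRep Z) (c.holonomicRep s.toFun (c.base x)) w).1.1 = 0 := by
      intro w
      have h1 := ((projBase n m).hasFDerivAt.comp _ hZd.hasFDerivAt)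
      have h2 : (projBase n m) ∘ c.fieldRep Z =ᶠ[𝓝 (c.holonomicRep s.toFun (c.base x))]
          fun _ => 0 := by
        filter_upwards [c.jetChart.open_target.mem_nhds hz] with z hz
        exact c.fieldRep_vertical hZ.1 hz
      exact DFunLike.congr_fun (h1.unique ((hasFDerivAt_const 0 _).congr_of_eventuallyEq h2)) w
    have hd : HasFDerivAt (c.holonomicRep s.toFun) (fderiv ℝ (c.holonomicRep s.toFun) (c.base x))
        (c.base x) := (((c.contDiffOn_holonomicRep s).contDiffAt
      ((c.isOpen_secDomain s).mem_nhds hξ)).differentiableAt (by simp)).hasFDerivAt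
    have e : c.fieldRep Z ∘ c.holonomicRep s.toFun =ᶠ[𝓝 (c.base x)] c.jetAlongRep s X := by
      filter_upwards [(c.isOpen_secDomain s).mem_nhds hξ] with ξ hξ
      exact c.fieldRep_holonomicRep hZ.2 hξ
    have e1 : (fderiv ℝ (c.fieldRep Z) (c.holonomicRep s.toFun (c.base x))).comp
        (fderiv ℝ (c.holonomicRep s.toFun) (c.base x)) =
          fderiv ℝ (c.jetAlongRep s X) (c.base x) := by
      rw [← e.fderiv_eq]
      exact (hZd.hasFDerivAt.comp _ hd).fderiv.symm
    have h := lieDeriv_extDeriv_poincareCartan c.jetChart.open_target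
      (c.contDiffOn_lagrangian v hL) hz hZv (c.fieldRep_vertical hY hz) hS.1 hS.2
      (elDensity_holonomicRep hL hs c hx)
    refine h.trans ?_
    rw [← FibredChart.holonomicRep_eq, e1, c.fieldRep_holonomicRep hZ.2 hξ]
    rfl
  refine forall_congr' fun Y => forall_congr' fun hY => forall_congr' fun c =>
    forall_congr' fun x => forall_congr' fun hx => ?_
  have hx' : s.toFun x ∈ c.tot.source := hx
  rw [← main Y hY c x hx', FibredChart.jet_jetSection hx', c.fderiv_jetRep hx']
  refine ⟨fun h => ?_, fun h => eq_zero_of_apply_baseVec _ h⟩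
  exact congrArg (fun μ : Base n [⋀^Fin n]→L[ℝ] ℝ => μ baseVec) h

end HamiltonCartan

/-! ### The vector spaces of the solutions to the linearised equations -/

section VectorSpaces

/-- A set of vectors that contains `0` and is closed under `a + r • b`, as a submodule. -/
def submoduleOfAddSMul {A : Type*} [AddCommGroup A] [Module ℝ A] (P : A → Prop) (h0 : P 0)
    (h : ∀ a b (r : ℝ), P a → P b → P (a + r • b)) : Submodule ℝ A where
  carrier := {a | P a}
  zero_mem' := h0
  add_mem' {a b} ha hb := by simpa using h a b 1 ha hb
  smul_mem' r a ha := by simpa using h 0 a r h0 ha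

section Fields

variable {V N : Type*} [NormedAddCommGroup V] [NormedSpace ℝ V] [TopologicalSpace N]
  [ChartedSpace V N] [IsManifold 𝓘(ℝ, V) ∞ N]
  {W H : Type*} [NormedAddCommGroup W] [NormedSpace ℝ W] [TopologicalSpace H]
  {I : ModelWithCorners ℝ W H} {M' : Type*} [TopologicalSpace M'] [ChartedSpace H M']
  {f : M' → N}

theorem contMDiff_of_field {X : ∀ x, TangentSpace 𝓘(ℝ, V) (f x)}
    (hX : ContMDiff I 𝓘(ℝ, V).tangent ∞ (fun x => (⟨f x, X x⟩ : TangentBundle 𝓘(ℝ, V) N))) :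
    ContMDiff I 𝓘(ℝ, V) ∞ f :=
  (Bundle.contMDiff_proj (TangentSpace 𝓘(ℝ, V) (M := N))).comp hX

theorem contMDiff_zero_field (hf : ContMDiff I 𝓘(ℝ, V) ∞ f) :
    ContMDiff I 𝓘(ℝ, V).tangent ∞
      (fun x => (⟨f x, 0⟩ : TangentBundle 𝓘(ℝ, V) N)) := by
  intro x
  refine contMDiffAt_field_of_coord (φ := chartAt V (f x)) (X := fun x => 0)
    (IsManifold.chart_mem_maximalAtlas _) (mem_chart_source V (f x)) (hf x) ?_
  exact (contMDiffAt_const (c := (0 : V))).congr_of_eventuallyEq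
    (Filter.Eventually.of_forall fun y => map_zero _)

theorem contMDiff_field_add_smul {X Y : ∀ x, TangentSpace 𝓘(ℝ, V) (f x)} (r : ℝ)
    (hX : ContMDiff I 𝓘(ℝ, V).tangent ∞ (fun x => (⟨f x, X x⟩ : TangentBundle 𝓘(ℝ, V) N)))
    (hY : ContMDiff I 𝓘(ℝ, V).tangent ∞ (fun x => (⟨f x, Y x⟩ : TangentBundle 𝓘(ℝ, V) N))) :
    ContMDiff I 𝓘(ℝ, V).tangent ∞
      (fun x => (⟨f x, X x + r • Y x⟩ : TangentBundle 𝓘(ℝ, V) N)) := by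
  intro x
  have hφ : chartAt V (f x) ∈ IsManifold.maximalAtlas 𝓘(ℝ, V) ∞ N :=
    IsManifold.chart_mem_maximalAtlas _
  have h1 := contMDiffAt_coord_of_field hφ (mem_chart_source V (f x)) (hX x)
  have h2 := contMDiffAt_coord_of_field hφ (mem_chart_source V (f x)) (hY x)
  refine contMDiffAt_field_of_coord (X := fun x => X x + r • Y x) hφ (mem_chart_source V (f x))
    (contMDiff_of_field hX x) ?_
  refine (h1.add ((contMDiffAt_const (I' := 𝓘(ℝ, ℝ)) (c := r)).smul h2)).congr_of_eventuallyEq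
    (Filter.Eventually.of_forall fun y => ?_)
  exact (map_add _ _ _).trans (congrArg (_ + ·) (map_smul _ _ _))

end Fields

section Vertical

variable {n : ℕ} {M : Type*} [TopologicalSpace M] [ChartedSpace (Base n) M]
  {V N : Type*} [NormedAddCommGroup V] [NormedSpace ℝ V] [TopologicalSpace N] [ChartedSpace V N]
  [IsManifold 𝓘(ℝ, V) ∞ N] {q : N → M} {f : M → N}

theorem isVerticalAlong_zero (hf : ContMDiff 𝓘(ℝ, Base n) 𝓘(ℝ, V) ∞ f) :
    IsVerticalAlong n q f (0 : ∀ x, TangentSpace 𝓘(ℝ, V) (f x)) :=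
  ⟨contMDiff_zero_field hf, fun _ => map_zero _⟩

theorem IsVerticalAlong.add_smul {X Y : ∀ x, TangentSpace 𝓘(ℝ, V) (f x)}
    (hX : IsVerticalAlong n q f X) (hY : IsVerticalAlong n q f Y) (r : ℝ) :
    IsVerticalAlong n q f (X + r • Y) :=
  ⟨contMDiff_field_add_smul r hX.1 hY.1, fun x => by
    change mfderiv 𝓘(ℝ, V) 𝓘(ℝ, Base n) q (f x) (X x + r • Y x) = 0
    rw [map_add, map_smul, hX.2, hY.2, smul_zero, add_zero]⟩

theorem isVerticalExtension_zero : IsVerticalExtension n q f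
    (0 : ∀ x, TangentSpace 𝓘(ℝ, V) (f x)) (0 : ∀ y, TangentSpace 𝓘(ℝ, V) y) :=
  ⟨⟨contMDiff_zero_field contMDiff_id, fun _ => map_zero _⟩, fun _ => rfl⟩

theorem IsVerticalExtension.add_smul {X Y : ∀ x, TangentSpace 𝓘(ℝ, V) (f x)}
    {Z Z' : ∀ y, TangentSpace 𝓘(ℝ, V) y} (hX : IsVerticalExtension n q f X Z)
    (hY : IsVerticalExtension n q f Y Z') (r : ℝ) :
    IsVerticalExtension n q f (X + r • Y) (Z + r • Z') :=
  ⟨⟨contMDiff_field_add_smul r hX.1.1 hY.1.1, fun y => by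
    change mfderiv 𝓘(ℝ, V) 𝓘(ℝ, Base n) q y (Z y + r • Z' y) = 0
    rw [map_add, map_smul, hX.1.2, hY.1.2, smul_zero, add_zero]⟩, fun x => by
    change Z (f x) + r • Z' (f x) = X x + r • Y x
    rw [hX.2, hY.2]⟩

end Vertical

theorem elExprDeriv_add_smul {n : ℕ} {V F : Type*} [NormedAddCommGroup V] [NormedSpace ℝ V]
    [NormedAddCommGroup F] [NormedSpace ℝ F]
    (D : V → V →L[ℝ] ℝ) (p : Fin n → V → F →L[ℝ] ℝ) (ι : F →L[ℝ] V) (u : F)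
    (z : V) (S : Base n →L[ℝ] V) (z₁ z₂ : V) (S₁ S₂ : Base n →L[ℝ] V) (r : ℝ) :
    elExprDeriv D p ι u z S (z₁ + r • z₂) (S₁ + r • S₂) =
      elExprDeriv D p ι u z S z₁ S₁ + r * elExprDeriv D p ι u z S z₂ S₂ := by
  have h : ((z₁ + r • z₂, S₁ + r • S₂) : V × (Base n →L[ℝ] V)) = (z₁, S₁) + r • (z₂, S₂) := rfl
  rw [elExprDeriv, h, map_add, map_smul]
  rfl

theorem elExprDeriv_zero {n : ℕ} {V F : Type*} [NormedAddCommGroup V] [NormedSpace ℝ V]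
    [NormedAddCommGroup F] [NormedSpace ℝ F]
    (D : V → V →L[ℝ] ℝ) (p : Fin n → V → F →L[ℝ] ℝ) (ι : F →L[ℝ] V) (u : F)
    (z : V) (S : Base n →L[ℝ] V) : elExprDeriv D p ι u z S 0 0 = 0 :=
  map_zero (fderiv ℝ (elExpr D p ι u) (z, S))

theorem flatLift_add_smul {B F : Type*} [NormedAddCommGroup B] [NormedSpace ℝ B]
    [NormedAddCommGroup F] [NormedSpace ℝ F] {a b : B → F} {ξ : B} (ha : DifferentiableAt ℝ a ξ)
    (hb : DifferentiableAt ℝ b ξ) (r : ℝ) :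
    flatLift (a + r • b) ξ = flatLift a ξ + r • flatLift b ξ := by
  refine Prod.ext (Prod.ext ?_ rfl) ?_
  · simp [flatLift]
  · exact (ha.hasFDerivAt.add (hb.hasFDerivAt.const_smul r)).fderiv

variable {n m : ℕ}

theorem linHC_add_smul (ℓ : JetModel n m → ℝ) (y z : JetModel n m) (S : Base n →L[ℝ] JetModel n m)
    (z₁ z₂ : JetModel n m) (S₁ S₂ : Base n →L[ℝ] JetModel n m) (r : ℝ) :
    linHC ℓ y z S (z₁ + r • z₂) (S₁ + r • S₂) = linHC ℓ y z S z₁ S₁ + r * linHC ℓ y z S z₂ S₂ := by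
  have h : (projFib n m).comp (S₁ + r • S₂) - (z₁ + r • z₂).2 =
      ((projFib n m).comp S₁ - z₁.2) + r • ((projFib n m).comp S₂ - z₂.2) := by
    rw [ContinuousLinearMap.comp_add, ContinuousLinearMap.comp_smul, Prod.snd_add, Prod.smul_snd,
      smul_sub]
    abel
  have h2 := elExprDeriv_add_smul (fderiv ℝ ℓ) (momentum ℓ) (fibIncl n m) y.1.2 z S z₁ z₂ S₁ S₂ r
  rw [linHC, h, map_add, map_smul, map_add, map_smul, linHC, linHC, linEL, h2, linEL, linEL,
    smul_eq_mul]
  ring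

theorem linHC_zero (ℓ : JetModel n m → ℝ) (y z : JetModel n m) (S : Base n →L[ℝ] JetModel n m) :
    linHC ℓ y z S 0 0 = 0 := by
  have h : (projFib n m).comp (0 : Base n →L[ℝ] JetModel n m) - (0 : JetModel n m).2 = 0 := by
    rw [ContinuousLinearMap.comp_zero]
    exact sub_zero _
  have h2 := elExprDeriv_zero (fderiv ℝ ℓ) (momentum ℓ) (fibIncl n m) y.1.2 z S
  rw [linHC, h, map_zero, map_zero, add_zero]
  exact h2

variable {M E : Type*} [TopologicalSpace M] [ChartedSpace (Base n) M]
    [TopologicalSpace E] [ChartedSpace (Tot n m) E] {p : E → M}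
    {s : FibSection n m p}

theorem FibredChart.alongRep_add_smul (c : FibredChart n m p)
    (X Y : ∀ x : M, TangentSpace 𝓘(ℝ, Tot n m) (s.toFun x)) (r : ℝ) :
    c.alongRep s (X + r • Y) = c.alongRep s X + r • c.alongRep s Y := by
  funext ξ
  have h := (map_add (mfderiv 𝓘(ℝ, Tot n m) 𝓘(ℝ, Tot n m) c.tot (s.toFun (c.base.symm ξ)))
    (X (c.base.symm ξ)) (r • Y (c.base.symm ξ))).trans (congrArg (_ + ·) (map_smul _ r _))
  exact congrArg (fun w : Tot n m => w.2) h

theorem FibredChart.alongRep_zero (c : FibredChart n m p) :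
    c.alongRep s (0 : ∀ x : M, TangentSpace 𝓘(ℝ, Tot n m) (s.toFun x)) = fun _ => 0 := by
  funext ξ
  exact congrArg (fun w : Tot n m => w.2)
    (map_zero (mfderiv 𝓘(ℝ, Tot n m) 𝓘(ℝ, Tot n m) c.tot (s.toFun (c.base.symm ξ))))

variable [IsManifold 𝓘(ℝ, Tot n m) ∞ E] [IsFibredManifold n m p]
    {v : VolumeForm n M} {L : Jet1 n m p → ℝ}

theorem FibredChart.jetAlongRep_add_smul (c : FibredChart n m p)
    (X Y : ∀ x : M, TangentSpace 𝓘(ℝ, JetModel n m) (jetSection s x)) (r : ℝ) :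
    c.jetAlongRep s (X + r • Y) = c.jetAlongRep s X + r • c.jetAlongRep s Y := by
  funext ξ
  exact (map_add (mfderiv 𝓘(ℝ, JetModel n m) 𝓘(ℝ, JetModel n m) c.jet
    (jetSection s (c.base.symm ξ))) (X (c.base.symm ξ)) (r • Y (c.base.symm ξ))).trans
      (congrArg (_ + ·) (map_smul _ r _))

theorem FibredChart.jetAlongRep_zero (c : FibredChart n m p) :
    c.jetAlongRep s (0 : ∀ x : M, TangentSpace 𝓘(ℝ, JetModel n m) (jetSection s x)) =
      fun _ => 0 := by
  funext ξ
  exact map_zero (mfderiv 𝓘(ℝ, JetModel n m) 𝓘(ℝ, JetModel n m) c.jet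
    (jetSection s (c.base.symm ξ)))

theorem isJacobiField_zero (hL : ContMDiff 𝓘(ℝ, JetModel n m) 𝓘(ℝ, ℝ) ∞ L) :
    IsJacobiField v L s 0 := by
  rw [isJacobiField_iff hL]
  refine ⟨isVerticalAlong_zero s.smooth, fun c x hx u => ?_⟩
  have h : flatLift (c.alongRep s 0) = fun _ => (0 : JetModel n m) := by
    funext ξ
    rw [c.alongRep_zero]
    exact Prod.ext rfl (fderiv_const_apply _)
  rw [h, fderiv_const_apply]
  exact elExprDeriv_zero _ _ _ _ _ _

theorem IsJacobiField.add_smul (hL : ContMDiff 𝓘(ℝ, JetModel n m) 𝓘(ℝ, ℝ) ∞ L)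
    {X Y : ∀ x : M, TangentSpace 𝓘(ℝ, Tot n m) (s.toFun x)} (hX : IsJacobiField v L s X)
    (hY : IsJacobiField v L s Y) (r : ℝ) : IsJacobiField v L s (X + r • Y) := by
  rw [isJacobiField_iff hL] at *
  refine ⟨hX.1.add_smul hY.1 r, fun c x hx u => ?_⟩
  have hO := c.isOpen_secDomain s
  have hξ := FibredChart.base_mem_secDomain hx
  have ha := c.contDiffOn_alongRep hX.1.1
  have hb := c.contDiffOn_alongRep hY.1.1
  have e : flatLift (c.alongRep s (X + r • Y)) =ᶠ[𝓝 (c.base x)]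
      flatLift (c.alongRep s X) + r • flatLift (c.alongRep s Y) := by
    filter_upwards [hO.mem_nhds hξ] with ξ hξ
    rw [c.alongRep_add_smul]
    exact flatLift_add_smul ((ha.contDiffAt (hO.mem_nhds hξ)).differentiableAt (by simp))
      ((hb.contDiffAt (hO.mem_nhds hξ)).differentiableAt (by simp)) r
  have h1 := (((flatLift_contDiffOn hO ha).contDiffAt (hO.mem_nhds hξ)).differentiableAt
    (by simp)).hasFDerivAt
  have h2 := (((flatLift_contDiffOn hO hb).contDiffAt (hO.mem_nhds hξ)).differentiableAt
    (by simp)).hasFDerivAt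
  rw [e.fderiv_eq, e.self_of_nhds, (h1.add (h2.const_smul r)).fderiv]
  refine (elExprDeriv_add_smul _ _ _ _ _ _ _ _ _ _ r).trans ?_
  have hx1 := hX.2 c x hx u
  have hx2 := hY.2 c x hx u
  rw [linEL] at hx1 hx2
  rw [hx1, hx2, mul_zero, add_zero]

theorem solvesLinHC_zero :
    SolvesLinHC s v L (0 : ∀ x : M, TangentSpace 𝓘(ℝ, JetModel n m) (jetSection s x)) := by
  intro Y _ c x _
  rw [c.jetAlongRep_zero, fderiv_const_apply]
  exact linHC_zero _ _ _ _

theorem SolvesLinHC.add_smul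
    {X Y : ∀ x : M, TangentSpace 𝓘(ℝ, JetModel n m) (jetSection s x)}
    (hX : IsVerticalAlong n proj1 (jetSection s) X) (hY : IsVerticalAlong n proj1 (jetSection s) Y)
    (hX' : SolvesLinHC s v L X) (hY' : SolvesLinHC s v L Y) (r : ℝ) :
    SolvesLinHC s v L (X + r • Y) := by
  intro Z hZ c x hx
  have hO := (c.isOpen_secDomain s).mem_nhds (FibredChart.base_mem_secDomain hx)
  have h1 := (((c.contDiffOn_jetAlongRep hX).contDiffAt hO).differentiableAt
    (by simp)).hasFDerivAt
  have h2 := (((c.contDiffOn_jetAlongRep hY).contDiffAt hO).differentiableAt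
    (by simp)).hasFDerivAt
  rw [c.jetAlongRep_add_smul, (h1.add (h2.const_smul r)).fderiv]
  refine (linHC_add_smul _ _ _ _ _ _ _ _ r).trans ?_
  rw [hX' Z hZ c x hx, hY' Z hZ c x hx, mul_zero, add_zero]

theorem isHCTangent_iff (hL : ContMDiff 𝓘(ℝ, JetModel n m) 𝓘(ℝ, ℝ) ∞ L)
    (hs : IsExtremal v L s) {X : ∀ x : M, TangentSpace 𝓘(ℝ, JetModel n m) (jetSection s x)} :
    IsHCTangent v L (jetSection s) X ↔ IsVerticalAlong n proj1 (jetSection s) X ∧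
      (∃ Z, IsVerticalExtension n proj1 (jetSection s) X Z) ∧ SolvesLinHC s v L X :=
  and_congr_right fun _ =>
    ⟨fun ⟨Z, hZ, h⟩ => ⟨⟨Z, hZ⟩, (linearisedHC_iff hL hs hZ).1 h⟩,
      fun ⟨⟨Z, hZ⟩, h⟩ => ⟨Z, hZ, (linearisedHC_iff hL hs hZ).2 h⟩⟩

/-- The vector space of the Jacobi fields along `s`. -/
def jacobiSpace (hL : ContMDiff 𝓘(ℝ, JetModel n m) 𝓘(ℝ, ℝ) ∞ L) (v : VolumeForm n M)
    (s : FibSection n m p) : Submodule ℝ (∀ x : M, TangentSpace 𝓘(ℝ, Tot n m) (s.toFun x)) :=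
  submoduleOfAddSMul (IsJacobiField v L s) (isJacobiField_zero hL)
    fun _ _ r hX hY => hX.add_smul hL hY r

/-- The tangent space at `j¹s` to the solutions to the Hamilton-Cartan equations. -/
def hcTangentSpace (hL : ContMDiff 𝓘(ℝ, JetModel n m) 𝓘(ℝ, ℝ) ∞ L) (hs : IsExtremal v L s) :
    Submodule ℝ (∀ x : M, TangentSpace 𝓘(ℝ, JetModel n m) (jetSection s x)) :=
  submoduleOfAddSMul (IsHCTangent v L (jetSection s))
    ((isHCTangent_iff hL hs).2 ⟨isVerticalAlong_zero (contMDiff_jetSection s),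
      ⟨0, isVerticalExtension_zero⟩, solvesLinHC_zero⟩)
    fun X Y r hX hY => by
      rw [isHCTangent_iff hL hs] at *
      obtain ⟨hX1, ⟨Z, hZ⟩, hX2⟩ := hX
      obtain ⟨hY1, ⟨Z', hZ'⟩, hY2⟩ := hY
      exact ⟨hX1.add_smul hY1 r, ⟨_, hZ.add_smul hZ' r⟩, SolvesLinHC.add_smul hX1 hY1 hX2 hY2 r⟩

end VectorSpaces

/-! ### Prolongation of vertical vector fields in coordinates -/

section FlatProlongation

variable {B F : Type*} [NormedAddCommGroup B] [NormedSpace ℝ B] [NormedAddCommGroup F]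
  [NormedSpace ℝ F]

/-- The `1`-jet prolongation `y^α ∂/∂y^α + (∂ᵢy^α + y^β_i ∂_βy^α) ∂/∂y^α_i` of the vertical vector
field with the components `y^α`. -/
def flatProlong (y : B × F → F) (z : (B × F) × (B →L[ℝ] F)) : (B × F) × (B →L[ℝ] F) :=
  ((0, y z.1), (fderiv ℝ y z.1).comp ((ContinuousLinearMap.id ℝ B).prod z.2))

theorem flatProlong_contDiffOn {y : B × F → F} {O : Set (B × F)} (hO : IsOpen O)
    (hy : ContDiffOn ℝ ∞ y O) : ContDiffOn ℝ ∞ (flatProlong y) (O ×ˢ Set.univ) := by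
  have h1 : Set.MapsTo (Prod.fst : (B × F) × (B →L[ℝ] F) → B × F) (O ×ˢ Set.univ) O :=
    fun z hz => hz.1
  have h2 := hy.comp (contDiff_fst (𝕜 := ℝ)).contDiffOn h1
  have h3 := (hy.fderiv_of_isOpen (m := ∞) hO (by simp)).comp (contDiff_fst (𝕜 := ℝ)).contDiffOn h1
  have h4 : ContDiff ℝ ∞ (fun z : (B × F) × (B →L[ℝ] F) =>
      ContinuousLinearMap.inl ℝ B F + (ContinuousLinearMap.inr ℝ B F).comp z.2) :=
    contDiff_const.add (contDiff_const.clm_comp contDiff_snd)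
  refine (((contDiffOn_const (c := (0 : B))).prodMk h2).prodMk (h3.clm_comp h4.contDiffOn)).congr
    fun z _ => ?_
  refine Prod.ext rfl ?_
  ext u
  simp [flatProlong, ← map_add]

/-- Along the `1`-jet of `a`, the prolongation of `y` is the velocity of the `1`-jets of a family
with the initial velocity `y ∘ (id, a)`. -/
theorem flatProlong_flatJet {y : B × F → F} {a : B → F} {ξ : B}
    (hy : DifferentiableAt ℝ y (ξ, a ξ)) (ha : DifferentiableAt ℝ a ξ) :
    flatProlong y (flatJet a ξ) = flatLift (fun ξ => y (ξ, a ξ)) ξ :=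
  Prod.ext rfl (HasFDerivAt.comp ξ (f := fun ξ => (ξ, a ξ)) hy.hasFDerivAt
    ((hasFDerivAt_id ξ).prodMk ha.hasFDerivAt)).fderiv.symm

/-- The action of a fibred change of coordinates `T` on `1`-jets. Here `C` is the derivative of the
inverse change of the base coordinates. -/
def flatTransition (T : B × F → B × F) (C : B → B →L[ℝ] B) (z : (B × F) × (B →L[ℝ] F)) :
    (B × F) × (B →L[ℝ] F) :=
  (T z.1, (ContinuousLinearMap.snd ℝ B F).comp ((fderiv ℝ T z.1).comp
    ((ContinuousLinearMap.inl ℝ B F + (ContinuousLinearMap.inr ℝ B F).comp z.2).comp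
      (C (T z.1).1))))

/-- The prolongation of vertical vector fields commutes with fibred changes of coordinates. -/
theorem fderiv_flatTransition_flatProlong {T : B × F → B × F} {C : B → B →L[ℝ] B}
    {z : (B × F) × (B →L[ℝ] F)} (hT : ContDiffAt ℝ ∞ T z.1) (hC : DifferentiableAt ℝ C (T z.1).1)
    (hvert : ∀ v, (fderiv ℝ T z.1 (0, v)).1 = 0)
    (hinv : ∀ u v, (fderiv ℝ T z.1 (C (T z.1).1 u, v)).1 = u)
    {y y' : B × F → F} (hy : DifferentiableAt ℝ y z.1) (hy' : DifferentiableAt ℝ y' (T z.1))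
    (h : ∀ᶠ ζ in 𝓝 z.1, y' (T ζ) = (fderiv ℝ T ζ (0, y ζ)).2) :
    fderiv ℝ (flatTransition T C) z (flatProlong y z) = flatProlong y' (flatTransition T C z) := by
  have hTd : HasFDerivAt T (fderiv ℝ T z.1) z.1 := (hT.differentiableAt (by simp)).hasFDerivAt
  have hTd2 : HasFDerivAt (fderiv ℝ T) (fderiv ℝ (fderiv ℝ T) z.1) z.1 :=
    ((hT.fderiv_right (m := ∞) (by simp)).differentiableAt (by simp)).hasFDerivAt
  have hsymm : IsSymmSndFDerivAt ℝ T z.1 := hT.isSymmSndFDerivAt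
    (by rw [minSmoothness_of_isRCLikeNormedField]; norm_cast)
  -- both sides of the relation `h` between `y` and `y'`, differentiated
  have hy'y : ∀ w, fderiv ℝ y' (T z.1) (fderiv ℝ T z.1 w) =
      (fderiv ℝ (fderiv ℝ T) z.1 w (0, y z.1)).2 + (fderiv ℝ T z.1 (0, fderiv ℝ y z.1 w)).2 := by
    intro w
    have e1 := hy'.hasFDerivAt.comp z.1 hTd
    have e2 := (ContinuousLinearMap.snd ℝ B F).hasFDerivAt.comp z.1
      (hTd2.clm_apply ((hasFDerivAt_const (0 : B) z.1).prodMk hy.hasFDerivAt))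
    have e3 := DFunLike.congr_fun ((e1.congr_of_eventuallyEq
      (h.mono fun ζ hζ => hζ.symm)).unique e2) w
    simpa [add_comm] using e3
  have p1 : HasFDerivAt (fun z : (B × F) × (B →L[ℝ] F) => T z.1) _ z :=
    HasFDerivAt.comp z (f := Prod.fst) hTd hasFDerivAt_fst
  have p2 : HasFDerivAt (fun z : (B × F) × (B →L[ℝ] F) => fderiv ℝ T z.1) _ z :=
    HasFDerivAt.comp z (f := Prod.fst) hTd2 hasFDerivAt_fst
  have p3 : HasFDerivAt (fun z : (B × F) × (B →L[ℝ] F) => C (T z.1).1) _ z :=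
    HasFDerivAt.comp z (f := fun z : (B × F) × (B →L[ℝ] F) => (T z.1).1) hC.hasFDerivAt p1.fst
  have p4 : HasFDerivAt (fun z : (B × F) × (B →L[ℝ] F) => ContinuousLinearMap.inl ℝ B F +
      (ContinuousLinearMap.inr ℝ B F).comp z.2) _ z :=
    ((hasFDerivAt_const (ContinuousLinearMap.inr ℝ B F) z).clm_comp hasFDerivAt_snd).const_add _
  have p5 : HasFDerivAt (flatTransition T C) _ z := p1.prodMk
    ((hasFDerivAt_const (ContinuousLinearMap.snd ℝ B F) z).clm_comp (p2.clm_comp (p4.clm_comp p3)))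
  rw [p5.fderiv]
  refine Prod.ext (Prod.ext ?_ ?_) ?_
  · exact hvert _
  · exact h.self_of_nhds.symm
  · ext1 u
    set w : B × F := (C (T z.1).1 u, z.2 (C (T z.1).1 u)) with hw
    have hsplit (A : B × F →L[ℝ] B × F) (a : B) (b : F) :
        (A (a, b)).2 = (A (a, 0)).2 + (A (0, b)).2 := by
      rw [← Prod.snd_add, ← map_add]
      simp
    have h1 : fderiv ℝ T z.1 w = (u, (flatTransition T C z).2 u) := by
      refine Prod.ext (hinv _ _) ?_
      simp [flatTransition, hw, ← hsplit]
    have h2 : (flatProlong y' (flatTransition T C z)).2 u =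
        fderiv ℝ y' (T z.1) (fderiv ℝ T z.1 w) := by
      rw [h1]
      rfl
    rw [h2, hy'y, hsymm.eq w (0, y z.1)]
    simp [flatProlong, hvert, hw]
    rw [← hsplit, add_comm]

end FlatProlongation

/-- The Lie derivative of the contact forms along a vector field on the jet bundle that projects
onto the vertical field `y`. -/
theorem lieDerivOne_contactForm {n m : ℕ} {Z : JetModel n m → JetModel n m} {y : Tot n m → Fib m}
    {z w : JetModel n m} (hZ : DifferentiableAt ℝ Z z) (hy : DifferentiableAt ℝ y z.1)
    (h : ∀ᶠ ζ in 𝓝 z, (Z ζ).1 = (0, y ζ.1)) :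
    lieDerivOne Z contactForm z w = fderiv ℝ y z.1 w.1 - (Z z).2 w.1.1 := by
  have e1 : HasFDerivAt (fun ζ => (Z ζ).1) _ z := hZ.hasFDerivAt.fst
  have e2 : HasFDerivAt (fun ζ : JetModel n m => ((0 : Base n), y ζ.1)) _ z :=
    (hasFDerivAt_const (0 : Base n) z).prodMk
      (HasFDerivAt.comp z (f := Prod.fst) hy.hasFDerivAt hasFDerivAt_fst)
  have e3 : (fderiv ℝ Z z w).1 = ((0 : Base n), fderiv ℝ y z.1 w.1) :=
    DFunLike.congr_fun ((e1.congr_of_eventuallyEq (h.mono fun ζ hζ => hζ.symm)).unique e2) w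
  change fderiv ℝ contactForm z (Z z) w + contactForm z (fderiv ℝ Z z w) = _
  rw [fderiv_contactForm, contactForm_apply, e3, map_zero, sub_zero]
  abel

section Prolongation

variable {n m : ℕ} {M E : Type*} [TopologicalSpace M] [ChartedSpace (Base n) M]
    [TopologicalSpace E] [ChartedSpace (Tot n m) E] {p : E → M}

/-- The components `Y^α` of a vertical vector field on `E`. -/
def FibredChart.vertRep (c : FibredChart n m p) (Y : ∀ e : E, TangentSpace 𝓘(ℝ, Tot n m) e)
    (ζ : Tot n m) : Fib m :=
  (mfderiv 𝓘(ℝ, Tot n m) 𝓘(ℝ, Tot n m) c.tot (c.tot.symm ζ) (Y (c.tot.symm ζ)) : Tot n m).2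

/-- The change of coordinates between two fibred charts. -/
def FibredChart.totTrans (c d : FibredChart n m p) : OpenPartialHomeomorph (Tot n m) (Tot n m) :=
  c.tot.symm.trans d.tot

theorem fderiv_chart_trans {V N : Type*} [NormedAddCommGroup V] [NormedSpace ℝ V]
    [TopologicalSpace N] [ChartedSpace V N] {φ ψ : OpenPartialHomeomorph N V}
    (hφ : φ.MDifferentiable 𝓘(ℝ, V) 𝓘(ℝ, V)) (hψ : ψ.MDifferentiable 𝓘(ℝ, V) 𝓘(ℝ, V)) {z : V}
    (hz : z ∈ (φ.symm.trans ψ).source) (w : V) :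
    fderiv ℝ (φ.symm.trans ψ) z w = (mfderiv 𝓘(ℝ, V) 𝓘(ℝ, V) ψ (φ.symm z)
      (mfderiv 𝓘(ℝ, V) 𝓘(ℝ, V) φ.symm z w) : V) := by
  have h : mfderiv 𝓘(ℝ, V) 𝓘(ℝ, V) (φ.symm.trans ψ) z = _ :=
    mfderiv_comp (g := ψ) (f := φ.symm) z (hψ.mdifferentiableAt hz.2)
      (hφ.mdifferentiableAt_symm hz.1)
  rw [← mfderiv_eq_fderiv, h]
  rfl

theorem mfderiv_chart_congr {V N : Type*} [NormedAddCommGroup V] [NormedSpace ℝ V]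
    [TopologicalSpace N] [ChartedSpace V N] (φ : N → V) {y y' : N}
    (h : y = y') {w w' : V} (hw : w = w') :
    (mfderiv 𝓘(ℝ, V) 𝓘(ℝ, V) φ y (w : TangentSpace 𝓘(ℝ, V) y) : V) =
      mfderiv 𝓘(ℝ, V) 𝓘(ℝ, V) φ y' (w' : TangentSpace 𝓘(ℝ, V) y') := by
  subst h hw
  rfl

theorem field_congr {V N : Type*} [NormedAddCommGroup V] [NormedSpace ℝ V]
    [TopologicalSpace N] [ChartedSpace V N] (Y : ∀ y : N, TangentSpace 𝓘(ℝ, V) y) {y y' : N}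
    (h : y = y') : (Y y : V) = Y y' := by
  subst h
  rfl

section Chart

variable (c d : FibredChart n m p) {Y : ∀ e : E, TangentSpace 𝓘(ℝ, Tot n m) e}

theorem FibredChart.contDiffOn_totTrans : ContDiffOn ℝ ∞ (c.totTrans d) (c.totTrans d).source := by
  rw [← contMDiffOn_iff_contDiffOn]
  exact (contMDiffOn_of_mem_maximalAtlas d.tot_mem).comp
    ((contMDiffOn_symm_of_mem_maximalAtlas c.tot_mem).mono fun _ h => h.1) fun _ h => h.2

theorem FibredChart.fderiv_totTrans {ζ : Tot n m} (hζ : ζ ∈ (c.totTrans d).source) (w : Tot n m) :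
    fderiv ℝ (c.totTrans d) ζ w =
      (mfderiv 𝓘(ℝ, Tot n m) 𝓘(ℝ, Tot n m) d.tot (c.tot.symm ζ)
        (mfderiv 𝓘(ℝ, Tot n m) 𝓘(ℝ, Tot n m) c.tot.symm ζ w) : Tot n m) :=
  fderiv_chart_trans c.tot_mdiff d.tot_mdiff hζ w

/-- In the base coordinates, a change of fibred charts is a change of charts of the base. -/
theorem FibredChart.fst_fderiv_totTrans {ζ : Tot n m} (hζ : ζ ∈ (c.totTrans d).source)
    (w : Tot n m) : (fderiv ℝ (c.totTrans d) ζ w).1 =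
      fderiv ℝ (c.base.symm.trans d.base) ζ.1 w.1 := by
  have hT := (((c.contDiffOn_totTrans d).contDiffAt
    ((c.totTrans d).open_source.mem_nhds hζ)).differentiableAt (by simp)).hasFDerivAt.fst
  have hβm : ζ.1 ∈ (c.base.symm.trans d.base).source := by
    refine ⟨c.fst_mem hζ.1, ?_⟩
    change c.base.symm ζ.1 ∈ d.base.source
    rw [← c.proj_symm hζ.1]
    exact d.proj_mem _ hζ.2
  have hβ : DifferentiableAt ℝ (c.base.symm.trans d.base) ζ.1 := by
    have : ContDiffOn ℝ ∞ (c.base.symm.trans d.base) (c.base.symm.trans d.base).source := by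
      rw [← contMDiffOn_iff_contDiffOn]
      exact (contMDiffOn_of_mem_maximalAtlas d.base_mem).comp
        ((contMDiffOn_symm_of_mem_maximalAtlas c.base_mem).mono fun _ h => h.1) fun _ h => h.2
    exact (this.contDiffAt ((c.base.symm.trans d.base).open_source.mem_nhds hβm)).differentiableAt
      (by simp)
  have h2 := HasFDerivAt.comp ζ (f := Prod.fst) hβ.hasFDerivAt hasFDerivAt_fst
  have e : (fun ζ => (c.totTrans d ζ).1) =ᶠ[𝓝 ζ] (c.base.symm.trans d.base) ∘ Prod.fst := by
    filter_upwards [(c.totTrans d).open_source.mem_nhds hζ] with η hη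
    change (d.tot (c.tot.symm η)).1 = d.base (c.base.symm η.1)
    rw [show (d.tot (c.tot.symm η)).1 = d.base (p (c.tot.symm η)) from d.fst_tot _ hη.2,
      c.proj_symm hη.1]
  exact DFunLike.congr_fun (hT.unique (h2.congr_of_eventuallyEq e)) w

theorem FibredChart.mfderiv_tot_vert {e : E} (he : e ∈ c.tot.source)
    (hY : ∀ e, mfderiv 𝓘(ℝ, Tot n m) 𝓘(ℝ, Base n) p e (Y e) = 0) :
    (mfderiv 𝓘(ℝ, Tot n m) 𝓘(ℝ, Tot n m) c.tot e (Y e) : Tot n m) =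
      (0, c.vertRep Y (c.tot e)) := by
  refine Prod.ext (x := (mfderiv 𝓘(ℝ, Tot n m) 𝓘(ℝ, Tot n m) c.tot e (Y e) : Tot n m))
    ((c.mfderiv_proj_eq_zero_iff he (Y e)).1 (hY e)) ?_
  have h := (c.tot.left_inv he).symm
  exact congrArg (fun w : Tot n m => w.2) (a₂ := mfderiv 𝓘(ℝ, Tot n m) 𝓘(ℝ, Tot n m) c.tot
    (c.tot.symm (c.tot e)) (Y (c.tot.symm (c.tot e))))
    (mfderiv_chart_congr c.tot h (field_congr Y h))

end Chart

variable [IsManifold 𝓘(ℝ, Tot n m) ∞ E]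

theorem FibredChart.contDiffOn_vertRep (c : FibredChart n m p)
    {Y : ∀ e : E, TangentSpace 𝓘(ℝ, Tot n m) e} (hY : IsVerticalField n p Y) :
    ContDiffOn ℝ ∞ (c.vertRep Y) c.tot.target := by
  intro z hz
  have h1 := (contMDiffOn_symm_of_mem_maximalAtlas c.tot_mem).contMDiffAt
    (c.tot.open_target.mem_nhds hz)
  have h2 := contMDiffAt_coord_of_field (f := fun j => j) c.tot_mem (c.tot.map_target hz)
    (hY.1 (c.tot.symm z))
  exact (contDiff_snd.contDiffAt.comp z (ContMDiffAt.comp z h2 h1).contDiffAt).contDiffWithinAt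

theorem FibredChart.vertRep_totTrans (c d : FibredChart n m p)
    {Y : ∀ e : E, TangentSpace 𝓘(ℝ, Tot n m) e} (hY : IsVerticalField n p Y) {ζ : Tot n m}
    (hζ : ζ ∈ (c.totTrans d).source) :
    d.vertRep Y (c.totTrans d ζ) = (fderiv ℝ (c.totTrans d) ζ (0, c.vertRep Y ζ)).2 := by
  have he : c.tot.symm ζ ∈ c.tot.source := c.tot.map_target hζ.1
  have h1 := c.mfderiv_tot_vert he hY.2
  rw [c.tot.right_inv hζ.1] at h1
  have h2 := d.mfderiv_tot_vert (e := c.tot.symm ζ) hζ.2 hY.2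
  have h3 := mfderiv_symm_mfderiv c.tot_mem he (Y (c.tot.symm ζ))
  rw [c.tot.right_inv hζ.1] at h3
  rw [c.fderiv_totTrans d hζ, ← h1]
  exact (congrArg Prod.snd ((mfderiv_chart_congr d.tot rfl h3).trans h2)).symm

variable [IsFibredManifold n m p]

/-- The coordinate expressions `flatProlong` of the prolongation agree in all fibred charts. -/
theorem FibredChart.fderiv_jet_trans_flatProlong (c d : FibredChart n m p)
    {Y : ∀ e : E, TangentSpace 𝓘(ℝ, Tot n m) e} (hY : IsVerticalField n p Y) {z : JetModel n m}
    (hz : z.1 ∈ (c.totTrans d).source) :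
    fderiv ℝ (c.jet.symm.trans d.jet) z (flatProlong (c.vertRep Y) z) =
      flatProlong (d.vertRep Y) ((c.jet.symm.trans d.jet) z) := by
  have hopen : IsOpen (Prod.fst ⁻¹' (c.totTrans d).source : Set (JetModel n m)) :=
    (c.totTrans d).open_source.preimage continuous_fst
  let C : Base n → Base n →L[ℝ] Base n := fderiv ℝ (d.base.symm.trans c.base)
  have e : ((c.jet.symm.trans d.jet : JetModel n m → JetModel n m)) =ᶠ[𝓝 z]
      flatTransition (c.totTrans d) C := by
    filter_upwards [hopen.mem_nhds hz] with ζ hζ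
    exact c.jet_trans_apply d hζ
  have hB : ContDiffOn ℝ ∞ (d.base.symm.trans c.base) (d.base.symm.trans c.base).source := by
    rw [← contMDiffOn_iff_contDiffOn]
    exact (contMDiffOn_of_mem_maximalAtlas c.base_mem).comp
      ((contMDiffOn_symm_of_mem_maximalAtlas d.base_mem).mono fun _ h => h.1) fun _ h => h.2
  have hβ : ContDiffOn ℝ ∞ (c.base.symm.trans d.base) (c.base.symm.trans d.base).source := by
    rw [← contMDiffOn_iff_contDiffOn]
    exact (contMDiffOn_of_mem_maximalAtlas d.base_mem).comp
      ((contMDiffOn_symm_of_mem_maximalAtlas c.base_mem).mono fun _ h => h.1) fun _ h => h.2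
  have hβm : z.1.1 ∈ (c.base.symm.trans d.base).source := by
    refine ⟨c.fst_mem hz.1, ?_⟩
    change c.base.symm z.1.1 ∈ d.base.source
    rw [← c.proj_symm hz.1]
    exact d.proj_mem _ hz.2
  have hx' : (c.totTrans d z.1).1 = (c.base.symm.trans d.base) z.1.1 := by
    change (d.tot (c.tot.symm z.1)).1 = d.base (c.base.symm z.1.1)
    rw [show (d.tot (c.tot.symm z.1)).1 = d.base (p (c.tot.symm z.1)) from d.fst_tot _ hz.2,
      c.proj_symm hz.1]
  have hBsymm : (d.base.symm.trans c.base) = (c.base.symm.trans d.base).symm := by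
    rw [OpenPartialHomeomorph.trans_symm_eq_symm_trans_symm, OpenPartialHomeomorph.symm_symm]
  have hBm : (c.totTrans d z.1).1 ∈ (d.base.symm.trans c.base).source := by
    rw [hx', hBsymm]
    exact (c.base.symm.trans d.base).map_source hβm
  have hBat := hB.contDiffAt ((d.base.symm.trans c.base).open_source.mem_nhds hBm)
  have hCd : DifferentiableAt ℝ C (c.totTrans d z.1).1 :=
    (hBat.fderiv_right (m := ∞) (by simp)).differentiableAt (by simp)
  have hinv : ∀ u, fderiv ℝ (c.base.symm.trans d.base) z.1.1 (C (c.totTrans d z.1).1 u) = u := by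
    intro u
    have hB1 : (d.base.symm.trans c.base) (c.totTrans d z.1).1 = z.1.1 := by
      rw [hx', hBsymm]
      exact (c.base.symm.trans d.base).left_inv hβm
    have h1 := ((hβ.contDiffAt ((c.base.symm.trans d.base).open_source.mem_nhds
      hβm)).differentiableAt (by simp)).hasFDerivAt
    rw [← hB1] at h1
    have h2 := h1.comp _ (hBat.differentiableAt (by simp)).hasFDerivAt
    have e2 : (c.base.symm.trans d.base) ∘ (d.base.symm.trans c.base) =ᶠ[𝓝 (c.totTrans d z.1).1]
        id := by
      filter_upwards [(d.base.symm.trans c.base).open_source.mem_nhds hBm] with ξ hξ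
      rw [hBsymm] at hξ ⊢
      exact (c.base.symm.trans d.base).right_inv hξ
    have h3 := DFunLike.congr_fun (h2.unique ((hasFDerivAt_id _).congr_of_eventuallyEq e2)) u
    rw [hB1] at h3
    exact h3
  have hTm : c.totTrans d z.1 ∈ d.tot.target := d.tot.map_source hz.2
  rw [e.fderiv_eq, e.self_of_nhds]
  refine fderiv_flatTransition_flatProlong ((c.contDiffOn_totTrans d).contDiffAt
    ((c.totTrans d).open_source.mem_nhds hz)) hCd ?_ ?_
    (((c.contDiffOn_vertRep hY).contDiffAt (c.tot.open_target.mem_nhds hz.1)).differentiableAt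
      (by simp))
    (((d.contDiffOn_vertRep hY).contDiffAt (d.tot.open_target.mem_nhds hTm)).differentiableAt
      (by simp)) ?_
  · intro v
    rw [c.fst_fderiv_totTrans d hz, map_zero]
  · intro u v
    rw [c.fst_fderiv_totTrans d hz]
    exact hinv u
  · filter_upwards [(c.totTrans d).open_source.mem_nhds hz] with ζ hζ
    exact c.vertRep_totTrans d hY hζ

end Prolongation

/-! ### The jet prolongation of a vertical vector field -/

section JetProlongation

variable {n m : ℕ} {M E : Type*} [TopologicalSpace M] [ChartedSpace (Base n) M]
    [TopologicalSpace E] [ChartedSpace (Tot n m) E] {p : E → M}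
    [IsManifold 𝓘(ℝ, Tot n m) ∞ E] [IsFibredManifold n m p]

theorem mem_fibredChartAt_source (e : E) :
    e ∈ (fibredChartAt (n := n) (m := m) (p := p) e).tot.source :=
  Classical.choose_spec (exists_fibredChart (p := p) e)

/-- The tangent vector of `J¹E` at `j` with the components `w` in the fibred chart `c`. -/
def FibredChart.jetVec (c : FibredChart n m p) (j : Jet1 n m p) (w : JetModel n m) :
    TangentSpace 𝓘(ℝ, JetModel n m) j :=
  (mfderiv 𝓘(ℝ, JetModel n m) 𝓘(ℝ, JetModel n m) c.jet.symm (c.jet j) w : JetModel n m)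

theorem FibredChart.mfderiv_jet_jetVec (c : FibredChart n m p) {j : Jet1 n m p}
    (hj : j.pt ∈ c.tot.source) (w : JetModel n m) :
    (mfderiv 𝓘(ℝ, JetModel n m) 𝓘(ℝ, JetModel n m) c.jet j (c.jetVec j w) : JetModel n m) = w :=
  (mfderiv_chart_congr c.jet (c.jet.left_inv hj).symm rfl).trans
    (mfderiv_mfderiv_symm c.jetChart_mem (c.jetChart.map_source hj) w)

theorem FibredChart.mfderiv_jet_injective (c : FibredChart n m p) {j : Jet1 n m p}
    (hj : j.pt ∈ c.tot.source) {w w' : TangentSpace 𝓘(ℝ, JetModel n m) j}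
    (h : (mfderiv 𝓘(ℝ, JetModel n m) 𝓘(ℝ, JetModel n m) c.jet j w : JetModel n m) =
      mfderiv 𝓘(ℝ, JetModel n m) 𝓘(ℝ, JetModel n m) c.jet j w') : w = w' :=
  (mdifferentiable_of_mem_maximalAtlas c.jetChart_mem).mfderiv_injective hj h

/-- The `1`-jet prolongation of a vertical vector field on `E`. It is defined in the chosen charts;
by `mfderiv_jet_jetProlongation` its expression is the same in all fibred charts. -/
def jetProlongation (Y : ∀ e : E, TangentSpace 𝓘(ℝ, Tot n m) e) (j : Jet1 n m p) :
    TangentSpace 𝓘(ℝ, JetModel n m) j :=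
  (fibredChartAt j.pt).jetVec j
    (flatProlong ((fibredChartAt (n := n) (m := m) (p := p) j.pt).vertRep Y)
      ((fibredChartAt j.pt).jet j))

variable {Y : ∀ e : E, TangentSpace 𝓘(ℝ, Tot n m) e}
    {Z : ∀ j : Jet1 n m p, TangentSpace 𝓘(ℝ, JetModel n m) j}

theorem mfderiv_jet_jetProlongation (hY : IsVerticalField n p Y) (d : FibredChart n m p)
    {j : Jet1 n m p} (hj : j.pt ∈ d.tot.source) :
    (mfderiv 𝓘(ℝ, JetModel n m) 𝓘(ℝ, JetModel n m) d.jet j (jetProlongation Y j) : JetModel n m) =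
      flatProlong (d.vertRep Y) (d.jet j) := by
  set c : FibredChart n m p := fibredChartAt j.pt with hc
  have hjc : j.pt ∈ c.tot.source := mem_fibredChartAt_source j.pt
  have hz : (c.jet j).1 ∈ (c.totTrans d).source := by
    refine ⟨c.tot.map_source hjc, ?_⟩
    change c.tot.symm (c.tot j.pt) ∈ d.tot.source
    rwa [c.tot.left_inv hjc]
  have hz' : c.jet j ∈ (c.jetChart.symm.trans d.jetChart).source := by
    refine ⟨c.jetChart.map_source hjc, ?_⟩
    change c.jet.symm (c.jet j) ∈ d.jetChart.source
    rwa [c.jet.left_inv hjc]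
  have h1 := c.fderiv_jet_trans_flatProlong d hY hz
  have h2 := fderiv_chart_trans (mdifferentiable_of_mem_maximalAtlas c.jetChart_mem)
    (mdifferentiable_of_mem_maximalAtlas d.jetChart_mem) hz' (flatProlong (c.vertRep Y) (c.jet j))
  have h3 : (c.jet.symm.trans d.jet) (c.jet j) = d.jet j := congrArg d.jet (c.jet.left_inv hjc)
  rw [h3] at h1
  exact (mfderiv_chart_congr d.jet (c.jet.left_inv hjc).symm rfl).trans (h2.symm.trans h1)

theorem fieldRep_jetProlongation (hY : IsVerticalField n p Y) (c : FibredChart n m p)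
    {z : JetModel n m} (hz : z ∈ c.jet.target) :
    c.fieldRep (jetProlongation Y) z = flatProlong (c.vertRep Y) z := by
  refine (mfderiv_jet_jetProlongation hY c (c.jet.map_target hz)).trans ?_
  rw [c.jet.right_inv hz]

theorem FibredChart.contDiffOn_flatProlong_vertRep (c : FibredChart n m p)
    (hY : IsVerticalField n p Y) :
    ContDiffOn ℝ ∞ (flatProlong (c.vertRep Y)) c.jetChart.target :=
  (flatProlong_contDiffOn c.tot.open_target (c.contDiffOn_vertRep hY)).mono fun _ h => ⟨h, trivial⟩

theorem isJetProlongation_jetProlongation (hY : IsVerticalField n p Y) :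
    IsJetProlongation (p := p) Y (jetProlongation Y) := by
  refine ⟨fun j => ?_, fun j => ?_, fun c z hz w hw => ?_⟩
  · obtain ⟨c, hc⟩ := exists_fibredChart (p := p) (n := n) (m := m) j.pt
    refine contMDiffAt_field_of_coord (f := fun j => j) c.jetChart_mem hc contMDiffAt_id ?_
    have h1 := ((c.contDiffOn_flatProlong_vertRep hY).contDiffAt
      (c.jetChart.open_target.mem_nhds (c.jetChart.map_source hc))).contMDiffAt
    have h2 := (contMDiffOn_of_mem_maximalAtlas c.jetChart_mem).contMDiffAt
      (c.jetChart.open_source.mem_nhds hc)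
    refine (h1.comp j h2).congr_of_eventuallyEq ?_
    filter_upwards [c.jetChart.open_source.mem_nhds hc] with k hk
    exact mfderiv_jet_jetProlongation hY c hk
  · obtain ⟨c, hc⟩ := exists_fibredChart (p := p) (n := n) (m := m) j.pt
    refine c.mfderiv_tot_injective (e := j.pt) hc ?_
    refine (c.mfderiv_tot_proj10 hc _).trans ?_
    rw [mfderiv_jet_jetProlongation hY c hc, c.mfderiv_tot_vert hc hY.2]
    rfl
  · have e : c.fieldRep (jetProlongation Y) =ᶠ[𝓝 z] flatProlong (c.vertRep Y) := by
      filter_upwards [c.jetChart.open_target.mem_nhds hz] with ζ hζ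
      exact fieldRep_jetProlongation hY c hζ
    rw [lieDerivOne_contactForm (y := c.vertRep Y)]
    · have hw' : w.1 = (w.1.1, z.2 w.1.1) := Prod.ext rfl (sub_eq_zero.1 hw)
      rw [e.self_of_nhds, hw']
      exact sub_self _
    · exact (((c.contDiffOn_flatProlong_vertRep hY).contDiffAt
        (c.jetChart.open_target.mem_nhds hz)).differentiableAt (by simp)).congr_of_eventuallyEq e
    · exact ((c.contDiffOn_vertRep hY).contDiffAt
        (c.tot.open_target.mem_nhds hz)).differentiableAt (by simp)
    · filter_upwards [e] with ζ hζ
      rw [hζ]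
      rfl

/-- The two defining properties determine the prolongation: its components are those of
`flatProlong`. -/
theorem IsJetProlongation.fieldRep_eq (hZ : IsJetProlongation (p := p) Y Z)
    (hY : IsVerticalField n p Y) (c : FibredChart n m p) {z : JetModel n m}
    (hz : z ∈ c.jet.target) : c.fieldRep Z z = flatProlong (c.vertRep Y) z := by
  have h1 : ∀ ζ ∈ c.jet.target, (c.fieldRep Z ζ).1 = (0, c.vertRep Y ζ.1) := by
    intro ζ hζ
    have hj : (c.jet.symm ζ).pt ∈ c.tot.source := c.jet.map_target hζ
    have h := c.mfderiv_tot_proj10 hj (Z (c.jet.symm ζ))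
    rw [hZ.2.1, c.mfderiv_tot_vert hj hY.2] at h
    refine h.symm.trans ?_
    rw [show c.tot (c.jet.symm ζ).pt = ζ.1 from congrArg Prod.fst (c.jet.right_inv hζ)]
  refine Prod.ext (h1 z hz) ?_
  ext1 u
  -- evaluate the Lie derivative on a vector that is annihilated by the contact forms
  have h2 := hZ.2.2 c z hz ((u, z.2 u), 0) (sub_self (z.2 u))
  rw [lieDerivOne_contactForm (y := c.vertRep Y)] at h2
  · exact (sub_eq_zero.1 h2).symm
  · exact ((c.contDiffOn_fieldRep hZ.1).contDiffAt
      (c.jetChart.open_target.mem_nhds hz)).differentiableAt (by simp)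
  · exact ((c.contDiffOn_vertRep hY).contDiffAt
      (c.tot.open_target.mem_nhds hz)).differentiableAt (by simp)
  · filter_upwards [c.jetChart.open_target.mem_nhds hz] with ζ hζ
    exact h1 ζ hζ

theorem IsJetProlongation.isVerticalField (hZ : IsJetProlongation (p := p) Y Z)
    (hY : IsVerticalField n p Y) : IsVerticalField n (proj1 (p := p) (m := m)) Z := by
  refine ⟨hZ.1, fun j => ?_⟩
  obtain ⟨c, hc⟩ := exists_fibredChart (p := p) (n := n) (m := m) j.pt
  rw [c.mfderiv_proj1_eq_zero_iff hc, ← c.fieldRep_jet hc,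
    hZ.fieldRep_eq hY c (c.jet.map_source hc)]
  rfl

variable {s : FibSection n m p} {X : ∀ x : M, TangentSpace 𝓘(ℝ, Tot n m) (s.toFun x)}

/-- Along `j¹s`, the prolongation only depends on the values of the vector field along `s`. -/
theorem IsJetProlongation.along (hZ : IsJetProlongation (p := p) Y Z)
    (hY : IsVerticalExtension n p s.toFun X Y) (c : FibredChart n m p) {ξ : Base n}
    (hξ : ξ ∈ c.secDomain s) :
    c.fieldRep Z (c.holonomicRep s.toFun ξ) = flatLift (c.alongRep s X) ξ := by
  have hz := c.holonomicRep_mem hξ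
  rw [hZ.fieldRep_eq hY.1 c hz, c.holonomicRep_eq]
  have e : (fun ξ => c.vertRep Y (ξ, c.sectionRep s.toFun ξ)) =ᶠ[𝓝 ξ] c.alongRep s X := by
    filter_upwards [(c.isOpen_secDomain s).mem_nhds hξ] with η hη
    have h1 : c.tot.symm (η, c.sectionRep s.toFun η) = s.toFun (c.base.symm η) := by
      have h := FibredChart.tot_section hη.2
      rw [c.base.right_inv hη.1] at h
      rw [← h, c.tot.left_inv hη.2]
    have h2 : (Y (c.tot.symm (η, c.sectionRep s.toFun η)) : Tot n m) = X (c.base.symm η) :=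
      (field_congr Y h1).trans (hY.2 _)
    exact congrArg (fun w : Tot n m => w.2) (mfderiv_chart_congr c.tot h1 h2)
  rw [flatProlong_flatJet]
  · exact (flatLift_congr e).self_of_nhds
  · exact ((c.contDiffOn_vertRep hY.1).contDiffAt
      (c.tot.open_target.mem_nhds hz)).differentiableAt (by simp)
  · exact ((c.contDiffOn_sectionRep s).contDiffAt
      ((c.isOpen_secDomain s).mem_nhds hξ)).differentiableAt (by simp)

end JetProlongation

/-! ### Existence of vertical extensions -/

theorem IsFibredManifold.continuous {n m : ℕ} {M E : Type*} [TopologicalSpace M]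
    [ChartedSpace (Base n) M] [TopologicalSpace E] [ChartedSpace (Tot n m) E]
    [IsManifold 𝓘(ℝ, Tot n m) ∞ E] {p : E → M} (h : IsFibredManifold n m p) : Continuous p := by
  rw [continuous_iff_continuousAt]
  intro e
  obtain ⟨c, hc⟩ := exists_fibredChart (p := p) (n := n) (m := m) e
  exact (c.mdiff_proj hc).continuousAt

section Extension

variable {n m : ℕ} {M E : Type*} [TopologicalSpace M] [ChartedSpace (Base n) M]
    [TopologicalSpace E] [ChartedSpace (Tot n m) E] {p : E → M}
    [IsManifold 𝓘(ℝ, Tot n m) ∞ E] [IsFibredManifold n m p]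

theorem isClosed_range_section [T2Space E] (s : FibSection n m p) :
    IsClosed (Set.range s.toFun) := by
  have h : Set.range s.toFun = {e | s.toFun (p e) = e} := by
    ext e
    refine ⟨?_, fun h => ⟨p e, h⟩⟩
    rintro ⟨x, rfl⟩
    exact congrArg s.toFun (s.proj x)
  rw [h]
  exact isClosed_eq (s.smooth.continuous.comp
    (IsFibredManifold.continuous (n := n) (m := m) inferInstance)) continuous_id

/-- Near a point of the section, a vertical field along it extends with components that do not
depend on the `y^α`. -/
theorem exists_local_verticalExtension {s : FibSection n m p}
    {X : ∀ x : M, TangentSpace 𝓘(ℝ, Tot n m) (s.toFun x)} (hX : IsVerticalAlong n p s.toFun X)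
    (x₀ : M) : ∃ U ∈ 𝓝 (s.toFun x₀), ∃ Y : ∀ e : E, TangentSpace 𝓘(ℝ, Tot n m) e,
      ContMDiffOn 𝓘(ℝ, Tot n m) 𝓘(ℝ, Tot n m).tangent ∞
        (fun e => (⟨e, Y e⟩ : TangentBundle 𝓘(ℝ, Tot n m) E)) U ∧
      ∀ e ∈ U, mfderiv 𝓘(ℝ, Tot n m) 𝓘(ℝ, Base n) p e (Y e) = 0 ∧
        ∀ x, s.toFun x = e → (Y e : Tot n m) = X x := by
  obtain ⟨c, hc⟩ := exists_fibredChart (p := p) (n := n) (m := m) (s.toFun x₀)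
  set U : Set E := c.tot.source ∩ c.tot ⁻¹' (Prod.fst ⁻¹' c.secDomain s) with hU
  have hUo : IsOpen U :=
    c.tot.isOpen_inter_preimage ((c.isOpen_secDomain s).preimage continuous_fst)
  have hx₀ : s.toFun x₀ ∈ U := by
    refine ⟨hc, ?_⟩
    change (c.tot (s.toFun x₀)).1 ∈ c.secDomain s
    rw [FibredChart.tot_section hc]
    exact FibredChart.base_mem_secDomain hc
  let Y : ∀ e : E, TangentSpace 𝓘(ℝ, Tot n m) e := fun e =>
    (mfderiv 𝓘(ℝ, Tot n m) 𝓘(ℝ, Tot n m) c.tot.symm (c.tot e)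
      ((0, c.alongRep s X (c.tot e).1) : Tot n m) : Tot n m)
  have hYc : ∀ e ∈ c.tot.source, (mfderiv 𝓘(ℝ, Tot n m) 𝓘(ℝ, Tot n m) c.tot e (Y e) : Tot n m) =
      (0, c.alongRep s X (c.tot e).1) := fun e he =>
    (mfderiv_chart_congr c.tot (c.tot.left_inv he).symm rfl).trans
      (mfderiv_mfderiv_symm c.tot_mem (c.tot.map_source he) _)
  refine ⟨U, hUo.mem_nhds hx₀, Y, fun e he => ?_, fun e he => ⟨?_, ?_⟩⟩
  · refine (contMDiffAt_field_of_coord (f := fun e => e) c.tot_mem he.1 contMDiffAt_id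
      ?_).contMDiffWithinAt
    have h1 := (contMDiffOn_of_mem_maximalAtlas c.tot_mem).contMDiffAt
      (c.tot.open_source.mem_nhds he.1)
    have h2 : ContDiffAt ℝ ∞ (fun z : Tot n m => ((0 : Base n), c.alongRep s X z.1)) (c.tot e) :=
      contDiffAt_const.prodMk (((c.contDiffOn_alongRep hX.1).contDiffAt
        ((c.isOpen_secDomain s).mem_nhds he.2)).comp (c.tot e) contDiffAt_fst)
    refine (h2.contMDiffAt.comp e h1).congr_of_eventuallyEq ?_
    filter_upwards [hUo.mem_nhds he] with e' he'
    exact hYc e' he'.1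
  · rw [c.mfderiv_proj_eq_zero_iff he.1, hYc e he.1]
  · rintro x rfl
    refine c.mfderiv_tot_injective he.1 ((hYc _ he.1).trans ?_)
    rw [c.mfderiv_tot_along hX he.1, FibredChart.tot_section he.1]

theorem exists_verticalExtension [T2Space E] [SigmaCompactSpace E] {s : FibSection n m p}
    {X : ∀ x : M, TangentSpace 𝓘(ℝ, Tot n m) (s.toFun x)} (hX : IsVerticalAlong n p s.toFun X) :
    ∃ Y, IsVerticalExtension n p s.toFun X Y := by
  -- the values at `e` of the vertical extensions form an affine space, so local extensions glue
  let t (e : E) : Set (TangentSpace 𝓘(ℝ, Tot n m) e) :=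
    {w | mfderiv 𝓘(ℝ, Tot n m) 𝓘(ℝ, Base n) p e w = 0 ∧
      ∀ x, s.toFun x = e → (w : Tot n m) = X x}
  have ht : ∀ e, Convex ℝ (t e) := by
    rintro e a ⟨ha, ha'⟩ b ⟨hb, hb'⟩ r r' - - hr
    refine ⟨?_, fun x hx => ?_⟩
    · rw [map_add, map_smul, map_smul, ha, hb, smul_zero, smul_zero, add_zero]
    · rw [ha' x hx, hb' x hx]
      exact (add_smul r r' (X x : Tot n m)).symm.trans (by rw [hr, one_smul])
  obtain ⟨Y, hY⟩ := exists_contMDiffSection_forall_mem_convex_of_local (n := ⊤)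
    (I := 𝓘(ℝ, Tot n m)) (F_fiber := Tot n m) (fun e : E => TangentSpace 𝓘(ℝ, Tot n m) e) t ht
    fun e => by
      by_cases he : e ∈ Set.range s.toFun
      · obtain ⟨x₀, rfl⟩ := he
        exact exists_local_verticalExtension hX x₀
      · refine ⟨(Set.range s.toFun)ᶜ, (isClosed_range_section s).isOpen_compl.mem_nhds he,
          fun _ => 0, (contMDiff_zero_field contMDiff_id).contMDiffOn, fun y hy => ⟨map_zero _, ?_⟩⟩
        exact fun x hx => absurd ⟨x, hx⟩ hy
  exact ⟨Y, ⟨Y.contMDiff, fun e => (hY e).1⟩, fun x => (hY (s.toFun x)).2 x rfl⟩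

/-- Every `p₁`-vertical tangent vector of `J¹E` is the value of a vertical vector field. Cutting off
by a function on `E` avoids the question whether `J¹E` is Hausdorff. -/
theorem exists_verticalField_jet [T2Space E] (c : FibredChart n m p) {j : Jet1 n m p}
    (hj : j.pt ∈ c.tot.source) {w : JetModel n m} (hw : w.1.1 = 0) :
    ∃ Y : (∀ j : Jet1 n m p, TangentSpace 𝓘(ℝ, JetModel n m) j),
      IsVerticalField n (proj1 (p := p) (m := m)) Y ∧ c.fieldRep Y (c.jet j) = w := by
  obtain ⟨χ, -, hχ⟩ := (SmoothBumpFunction.nhds_basis_tsupport (I := 𝓘(ℝ, Tot n m))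
    j.pt).mem_iff.1 (c.tot.open_source.mem_nhds hj)
  have hχs : ContMDiff 𝓘(ℝ, JetModel n m) 𝓘(ℝ, ℝ) ∞ (fun k : Jet1 n m p => χ k.pt) :=
    χ.contMDiff.comp contMDiff_proj10
  let Y : ∀ k : Jet1 n m p, TangentSpace 𝓘(ℝ, JetModel n m) k := fun k => χ k.pt • c.jetVec k w
  have hYc : ∀ k : Jet1 n m p, k.pt ∈ c.tot.source →
      (mfderiv 𝓘(ℝ, JetModel n m) 𝓘(ℝ, JetModel n m) c.jet k (Y k) : JetModel n m) =
        χ k.pt • w := fun k hk =>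
    (map_smul _ _ _).trans (congrArg (χ k.pt • ·) (c.mfderiv_jet_jetVec hk w))
  have hY0 : ∀ k : Jet1 n m p, k.pt ∉ tsupport χ → Y k = 0 := fun k hk => by
    change χ k.pt • c.jetVec k w = 0
    rw [image_eq_zero_of_notMem_tsupport hk, zero_smul]
  refine ⟨Y, ⟨fun k => ?_, fun k => ?_⟩, ?_⟩
  · by_cases hk : k.pt ∈ c.tot.source
    · refine contMDiffAt_field_of_coord (f := fun k => k) c.jetChart_mem hk contMDiffAt_id ?_
      refine ((hχs k).smul (contMDiffAt_const (c := w))).congr_of_eventuallyEq ?_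
      filter_upwards [c.jetChart.open_source.mem_nhds hk] with k' hk'
      exact hYc k' hk'
    · have hopen : {k : Jet1 n m p | k.pt ∉ tsupport χ} ∈ 𝓝 k :=
        ((isClosed_tsupport χ).isOpen_compl.preimage
          (contMDiff_proj10 (n := n) (m := m) (p := p)).continuous).mem_nhds fun h => hk (hχ h)
      refine (contMDiff_zero_field (I := 𝓘(ℝ, JetModel n m)) (f := fun k : Jet1 n m p => k)
        contMDiff_id k).congr_of_eventuallyEq ?_
      filter_upwards [hopen] with k' hk'
      rw [hY0 k' hk']
  · by_cases hk : k.pt ∈ c.tot.source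
    · rw [c.mfderiv_proj1_eq_zero_iff hk, hYc k hk]
      change χ k.pt • w.1.1 = 0
      rw [hw, smul_zero]
    · rw [hY0 k fun h => hk (hχ h)]
      exact map_zero _
  · rw [c.fieldRep_jet hj, hYc j hj, χ.eq_one, one_smul]

end Extension

/-! ### Regular Lagrangians -/

theorem chartDensity_ne_zero {n : ℕ} {M : Type*} [TopologicalSpace M] [ChartedSpace (Base n) M]
    (v : VolumeForm n M) {φ : OpenPartialHomeomorph M (Base n)}
    (hφ : φ.MDifferentiable 𝓘(ℝ, Base n) 𝓘(ℝ, Base n)) {ξ : Base n} (hξ : ξ ∈ φ.target) :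
    chartDensity v.form φ ξ ≠ 0 := by
  intro h
  let A : Base n →L[ℝ] Base n := mfderiv 𝓘(ℝ, Base n) 𝓘(ℝ, Base n) φ.symm ξ
  let B : Base n →L[ℝ] Base n := mfderiv 𝓘(ℝ, Base n) 𝓘(ℝ, Base n) φ (φ.symm ξ)
  let μ : Base n [⋀^Fin n]→L[ℝ] ℝ := v.form (φ.symm ξ)
  have h0 : μ.compContinuousLinearMap A = 0 := eq_zero_of_apply_baseVec _ h
  have hAB : ∀ u, A (B u) = u := fun u => by
    have := DFunLike.congr_fun (hφ.symm_comp_deriv (φ.map_target hξ)) u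
    rw [φ.right_inv hξ] at this
    exact this
  have hμ : μ = 0 := by
    ext u
    have h1 := DFunLike.congr_fun h0 fun i => B (u i)
    simpa [Function.comp_def, hAB] using h1
  exact v.ne_zero _ hμ

theorem deriv_deriv_add_smul {V : Type*} [NormedAddCommGroup V] [NormedSpace ℝ V] {g : V → ℝ}
    {z : V} (hg : ContDiffAt ℝ ∞ g z) (w₁ w₂ : V) :
    deriv (fun a : ℝ => deriv (fun b : ℝ => g (z + (a • w₂ + b • w₁))) 0) 0 =
      fderiv ℝ (fderiv ℝ g) z w₂ w₁ := by
  have hline : ∀ y w : V, HasDerivAt (fun a : ℝ => y + a • w) w 0 := fun y w => by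
    simpa using ((hasDerivAt_id (0 : ℝ)).smul_const w).const_add y
  have hd : HasFDerivAt (fun y => fderiv ℝ g y w₁) _ z :=
    (((hg.fderiv_right (m := ∞) (by simp)).differentiableAt (by simp)).hasFDerivAt).clm_apply
      (hasFDerivAt_const w₁ z)
  have h2 := HasFDerivAt.comp_hasDerivAt_of_eq (0 : ℝ) hd (hline z w₂) (by simp)
  have hev : ∀ᶠ y in 𝓝 z, DifferentiableAt ℝ g y :=
    ((hg.of_le (m := 1) (by simp)).eventually (by simp)).mono
      fun y hy => hy.differentiableAt (by simp)
  have e : (fun a : ℝ => deriv (fun b : ℝ => g (z + (a • w₂ + b • w₁))) 0) =ᶠ[𝓝 0]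
      (fun y => fderiv ℝ g y w₁) ∘ fun a : ℝ => z + a • w₂ := by
    have hc : Filter.Tendsto (fun a : ℝ => z + a • w₂) (𝓝 0) (𝓝 z) := by
      have := (hline z w₂).continuousAt.tendsto
      simpa using this
    filter_upwards [hc.eventually hev] with a ha
    have h1 := HasFDerivAt.comp_hasDerivAt_of_eq (0 : ℝ) ha.hasFDerivAt (hline (z + a • w₂) w₁)
      (by simp)
    simp only [← add_assoc]
    exact h1.deriv
  rw [e.deriv_eq, h2.deriv]
  simp

section Regular

variable {n m : ℕ} {M E : Type*} [TopologicalSpace M] [ChartedSpace (Base n) M]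
    [TopologicalSpace E] [ChartedSpace (Tot n m) E] {p : E → M}

namespace FibredChart

variable (c : FibredChart n m p) (j : Jet1 n m p)

/-- The components of an element of the vector space on which the fibre of `J¹E → E` is
modelled. -/
def vertSlope (h : vertHom n m p j.pt) : Base n →L[ℝ] Fib m :=
  (ContinuousLinearMap.snd ℝ (Base n) (Fib m)).comp
    ((mfderiv 𝓘(ℝ, Tot n m) 𝓘(ℝ, Tot n m) c.tot j.pt).comp
      (h.1.comp (mfderiv 𝓘(ℝ, Base n) 𝓘(ℝ, Base n) c.base.symm (c.base (p j.pt)))))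

theorem vertSlope_add_smul (a b : ℝ) (h₁ h₂ : vertHom n m p j.pt) :
    c.vertSlope j (a • h₂ + b • h₁) = a • c.vertSlope j h₂ + b • c.vertSlope j h₁ := by
  ext1 u
  let A : Tot n m →L[ℝ] Tot n m := mfderiv 𝓘(ℝ, Tot n m) 𝓘(ℝ, Tot n m) c.tot j.pt
  let u' : Base n := mfderiv 𝓘(ℝ, Base n) 𝓘(ℝ, Base n) c.base.symm (c.base (p j.pt)) u
  let k₁ : Base n →L[ℝ] Tot n m := h₁.1
  let k₂ : Base n →L[ℝ] Tot n m := h₂.1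
  change (A (a • k₂ u' + b • k₁ u')).2 = a • (A (k₂ u')).2 + b • (A (k₁ u')).2
  rw [map_add, map_smul, map_smul]
  rfl

theorem exists_vertSlope_eq {j : Jet1 n m p} (hj : j.pt ∈ c.tot.source) (δ : Base n →L[ℝ] Fib m) :
    ∃ h : vertHom n m p j.pt, c.vertSlope j h = δ := by
  let A : Tot n m →L[ℝ] Tot n m := mfderiv 𝓘(ℝ, Tot n m) 𝓘(ℝ, Tot n m) c.tot.symm (c.tot j.pt)
  let B : Base n →L[ℝ] Base n := mfderiv 𝓘(ℝ, Base n) 𝓘(ℝ, Base n) c.base (p j.pt)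
  let k : Base n →L[ℝ] Tot n m :=
    A.comp ((ContinuousLinearMap.inr ℝ (Base n) (Fib m)).comp (δ.comp B))
  have hk : ∀ u, (mfderiv 𝓘(ℝ, Tot n m) 𝓘(ℝ, Tot n m) c.tot j.pt (k u) : Tot n m) =
      (0, δ (B u)) := fun u =>
    (mfderiv_chart_congr c.tot (c.tot.left_inv hj).symm rfl).trans
      (mfderiv_mfderiv_symm c.tot_mem (c.tot.map_source hj) ((0, δ (B u)) : Tot n m))
  refine ⟨⟨k, ?_⟩, ?_⟩
  · ext1 u
    refine (c.mfderiv_proj_eq_zero_iff hj (k u)).2 ?_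
    exact congrArg (fun w : Tot n m => w.1) (hk u)
  · ext1 u
    have h := DFunLike.congr_fun (c.base_mdiff.comp_symm_deriv
      (c.base.map_source (c.proj_mem _ hj))) u
    rw [c.base.left_inv (c.proj_mem _ hj)] at h
    refine (congrArg (fun w : Tot n m => w.2) (hk _)).trans ?_
    exact congrArg δ h

variable [IsManifold 𝓘(ℝ, Tot n m) ∞ E] [IsFibredManifold n m p]

theorem jet_translate (h : vertHom n m p j.pt) :
    c.jet (j.translate h) = c.jet j + slopeIncl n m (c.vertSlope j h) := by
  refine Prod.ext (add_zero (c.tot j.pt)).symm ?_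
  ext1 u
  let A : Tot n m →L[ℝ] Tot n m := mfderiv 𝓘(ℝ, Tot n m) 𝓘(ℝ, Tot n m) c.tot j.pt
  let u' : Base n := mfderiv 𝓘(ℝ, Base n) 𝓘(ℝ, Base n) c.base.symm (c.base (p j.pt)) u
  let k : Base n →L[ℝ] Tot n m := h.1
  let k' : Base n →L[ℝ] Tot n m := j.hom
  change (A (k' u' + k u')).2 = (A (k' u')).2 + (A (k u')).2
  rw [map_add]
  rfl

end FibredChart

variable [IsManifold 𝓘(ℝ, Tot n m) ∞ E] [IsFibredManifold n m p]

variable {v : VolumeForm n M} {L : Jet1 n m p → ℝ}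

/-- The Hessian metric in coordinates. The density of the volume form is constant along the fibres
of `J¹E → E`, hence only a factor. -/
theorem hessian_mul_chartDensity (hL : ContMDiff 𝓘(ℝ, JetModel n m) 𝓘(ℝ, ℝ) ∞ L)
    (c : FibredChart n m p) {j : Jet1 n m p} (hj : j.pt ∈ c.tot.source)
    (h₁ h₂ : vertHom n m p j.pt) :
    hessian L j h₁ h₂ * chartDensity v.form c.base (c.jet j).1.1 =
      fderiv ℝ (fderiv ℝ (c.lagrangian v L)) (c.jet j) (slopeIncl n m (c.vertSlope j h₂))
        (slopeIncl n m (c.vertSlope j h₁)) := by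
  have hℓ := (c.contDiffOn_lagrangian v hL).contDiffAt
    (c.jetChart.open_target.mem_nhds (c.jetChart.map_source hj))
  refine Eq.trans ?_ (deriv_deriv_add_smul (z := c.jet j) hℓ _ _)
  have e : ∀ a b : ℝ, c.lagrangian v L (c.jet j + (a • slopeIncl n m (c.vertSlope j h₂) +
      b • slopeIncl n m (c.vertSlope j h₁))) =
      L (j.translate (a • h₂ + b • h₁)) * chartDensity v.form c.base (c.jet j).1.1 := by
    intro a b
    rw [← map_smul, ← map_smul, ← map_add, ← c.vertSlope_add_smul, ← c.jet_translate]
    have hj' : j.translate (a • h₂ + b • h₁) ∈ c.jet.source := hj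
    unfold FibredChart.lagrangian
    rw [c.jet.left_inv hj']
    rfl
  simp only [e, deriv_mul_const_field]
  rfl

/-- For a regular Lagrangian the matrix `∂²ℓ/∂y^α_i∂y^β_j` is non-singular. -/
theorem IsRegularLagrangian.eq_zero (hreg : IsRegularLagrangian L)
    (hL : ContMDiff 𝓘(ℝ, JetModel n m) 𝓘(ℝ, ℝ) ∞ L) (c : FibredChart n m p) {z : JetModel n m}
    (hz : z ∈ c.jetChart.target) {δ : Base n →L[ℝ] Fib m}
    (h : ∀ ζ, fderiv ℝ (fderiv ℝ (c.lagrangian v L)) z (slopeIncl n m ζ) (slopeIncl n m δ) = 0) :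
    δ = 0 := by
  have hj : (c.jet.symm z).pt ∈ c.tot.source := c.jet.map_target hz
  have hjz : c.jet (c.jet.symm z) = z := c.jet.right_inv hz
  obtain ⟨h₁, rfl⟩ := c.exists_vertSlope_eq hj δ
  have h0 : h₁ = 0 := by
    refine hreg _ h₁ fun h₂ => ?_
    have h3 := hessian_mul_chartDensity (v := v) hL c hj h₁ h₂
    rw [hjz, h, mul_eq_zero] at h3
    exact h3.resolve_right (chartDensity_ne_zero v c.base_mdiff (c.fst_mem hz))
  have h4 := c.vertSlope_add_smul (c.jet.symm z) 0 0 0 0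
  simpa [h0] using h4

end Regular

theorem linEL_zero_left {n m : ℕ} (ℓ : JetModel n m → ℝ) (z : JetModel n m)
    (S : Base n →L[ℝ] JetModel n m) (z' : JetModel n m) (S' : Base n →L[ℝ] JetModel n m) :
    linEL ℓ 0 z S z' S' = 0 := by
  have h : elExpr (fderiv ℝ ℓ) (momentum ℓ) (fibIncl n m) 0 = fun _ => 0 := by
    funext q
    simp [elExpr]
  rw [linEL, elExprDeriv, h]
  simp

/-- On the `1`-jet of a vertical field, the linearised Hamilton-Cartan expression is the linearised
Euler-Lagrange expression. -/
theorem linHC_flatLift {n m : ℕ} (ℓ : JetModel n m → ℝ) (y z : JetModel n m)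
    (S : Base n →L[ℝ] JetModel n m) {a : Base n → Fib m} {ξ : Base n} {O : Set (Base n)}
    (hO : IsOpen O) (ha : ContDiffOn ℝ ∞ a O) (hξ : ξ ∈ O) :
    linHC ℓ y z S (flatLift a ξ) (fderiv ℝ (flatLift a) ξ) =
      linEL ℓ y.1.2 z S (flatLift a ξ) (fderiv ℝ (flatLift a) ξ) := by
  have h : (projFib n m).comp (fderiv ℝ (flatLift a) ξ) = fderiv ℝ a ξ :=
    ((projFib n m).hasFDerivAt.comp ξ (((flatLift_contDiffOn hO ha).contDiffAt
      (hO.mem_nhds hξ)).differentiableAt (by simp)).hasFDerivAt).fderiv.symm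
  rw [linHC, h, show (flatLift a ξ).2 = fderiv ℝ a ξ from rfl, sub_self, map_zero, map_zero,
    add_zero]

/-! ### The lift of Jacobi fields to the jet bundle -/

section JetLift

variable {n m : ℕ} {M E : Type*} [TopologicalSpace M] [ChartedSpace (Base n) M]
    [TopologicalSpace E] [ChartedSpace (Tot n m) E] {p : E → M}
    [IsManifold 𝓘(ℝ, Tot n m) ∞ E] [IsFibredManifold n m p]
    {s : FibSection n m p}

/-- The vector field along `j¹s` with the components `X^α`, `∂ᵢX^α`, where `X^α` are the components
of the vector field `X` along `s`. -/
def jetLift (s : FibSection n m p) (X : ∀ x : M, TangentSpace 𝓘(ℝ, Tot n m) (s.toFun x)) (x : M) :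
    TangentSpace 𝓘(ℝ, JetModel n m) (jetSection s x) :=
  (fibredChartAt (n := n) (m := m) (p := p) (s.toFun x)).jetVec (jetSection s x)
    (flatLift ((fibredChartAt (n := n) (m := m) (p := p) (s.toFun x)).alongRep s X)
      ((fibredChartAt (n := n) (m := m) (p := p) (s.toFun x)).base x))

variable {X X' : ∀ x : M, TangentSpace 𝓘(ℝ, Tot n m) (s.toFun x)}
    {Y : ∀ e : E, TangentSpace 𝓘(ℝ, Tot n m) e}
    {Z : ∀ j : Jet1 n m p, TangentSpace 𝓘(ℝ, JetModel n m) j}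
    {v : VolumeForm n M} {L : Jet1 n m p → ℝ}

/-- Every prolongation of every vertical extension of `X` restricts to `jetLift s X` along `j¹s`. -/
theorem IsJetProlongation.eq_jetLift (hZ : IsJetProlongation (p := p) Y Z)
    (hY : IsVerticalExtension n p s.toFun X Y) (x : M) :
    Z (jetSection s x) = jetLift s X x := by
  set c : FibredChart n m p := fibredChartAt (s.toFun x) with hc
  have hx : s.toFun x ∈ c.tot.source := mem_fibredChartAt_source (s.toFun x)
  refine c.mfderiv_jet_injective (j := jetSection s x) hx ?_
  refine Eq.trans ?_ (c.mfderiv_jet_jetVec (j := jetSection s x) hx _).symm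
  rw [← c.fieldRep_jet (j := jetSection s x) hx, FibredChart.jet_jetSection hx]
  exact hZ.along hY c (FibredChart.base_mem_secDomain hx)

theorem jetLift_add_smul (hX : IsVerticalAlong n p s.toFun X)
    (hX' : IsVerticalAlong n p s.toFun X') (r : ℝ) :
    jetLift s (X + r • X') = jetLift s X + r • jetLift s X' := by
  funext x
  set c : FibredChart n m p := fibredChartAt (s.toFun x) with hc
  have hx : s.toFun x ∈ c.tot.source := mem_fibredChartAt_source (s.toFun x)
  have hd : ∀ {X}, IsVerticalAlong n p s.toFun X → DifferentiableAt ℝ (c.alongRep s X) (c.base x) :=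
    fun hX => ((c.contDiffOn_alongRep hX.1).contDiffAt ((c.isOpen_secDomain s).mem_nhds
      (FibredChart.base_mem_secDomain hx))).differentiableAt (by simp)
  change c.jetVec _ (flatLift (c.alongRep s (X + r • X')) (c.base x)) = _
  rw [c.alongRep_add_smul, flatLift_add_smul (hd hX) (hd hX')]
  exact (map_add _ _ _).trans (congrArg (_ + ·) (map_smul _ _ _))

theorem jetLift_zero : jetLift s 0 = 0 := by
  have h := isVerticalAlong_zero (q := p) s.smooth
  simpa using jetLift_add_smul h h 1

variable [T2Space E] [SigmaCompactSpace E]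

theorem exists_verticalExtension_jetLift (hX : IsVerticalAlong n p s.toFun X) :
    ∃ Z, IsVerticalExtension n proj1 (jetSection s) (jetLift s X) Z := by
  obtain ⟨Y, hY⟩ := exists_verticalExtension hX
  have h := isJetProlongation_jetProlongation hY.1
  exact ⟨jetProlongation Y, h.isVerticalField hY.1, h.eq_jetLift hY⟩

theorem FibredChart.jetAlongRep_jetLift (c : FibredChart n m p)
    (hX : IsVerticalAlong n p s.toFun X) {ξ : Base n} (hξ : ξ ∈ c.secDomain s) :
    c.jetAlongRep s (jetLift s X) ξ = flatLift (c.alongRep s X) ξ := by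
  obtain ⟨Y, hY⟩ := exists_verticalExtension hX
  have h := isJetProlongation_jetProlongation hY.1
  rw [← c.fieldRep_holonomicRep (h.eq_jetLift hY) hξ]
  exact h.along hY c hξ

theorem FibredChart.jetAlongRep_jetLift_eventuallyEq (c : FibredChart n m p)
    (hX : IsVerticalAlong n p s.toFun X) {x : M} (hx : s.toFun x ∈ c.tot.source) :
    c.jetAlongRep s (jetLift s X) =ᶠ[𝓝 (c.base x)] flatLift (c.alongRep s X) := by
  filter_upwards [(c.isOpen_secDomain s).mem_nhds (FibredChart.base_mem_secDomain hx)] with ξ hξ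
  exact c.jetAlongRep_jetLift hX hξ

theorem isVerticalAlong_jetLift (hX : IsVerticalAlong n p s.toFun X) :
    IsVerticalAlong n proj1 (jetSection s) (jetLift s X) := by
  obtain ⟨Z, hZ, hZX⟩ := exists_verticalExtension_jetLift hX
  have h : jetLift s X = fun x => Z (jetSection s x) := funext fun x => (hZX x).symm
  rw [h]
  exact ⟨hZ.1.comp (contMDiff_jetSection s), fun x => hZ.2 _⟩

theorem linHC_jetLift (hX : IsVerticalAlong n p s.toFun X) (c : FibredChart n m p) {x : M}
    (hx : s.toFun x ∈ c.tot.source) (ℓ : JetModel n m → ℝ) (y z : JetModel n m)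
    (S : Base n →L[ℝ] JetModel n m) :
    linHC ℓ y z S (c.jetAlongRep s (jetLift s X) (c.base x))
        (fderiv ℝ (c.jetAlongRep s (jetLift s X)) (c.base x)) =
      linEL ℓ y.1.2 z S (flatLift (c.alongRep s X) (c.base x))
        (fderiv ℝ (flatLift (c.alongRep s X)) (c.base x)) := by
  have e := c.jetAlongRep_jetLift_eventuallyEq hX hx
  rw [e.fderiv_eq, e.self_of_nhds]
  exact linHC_flatLift ℓ y z S (c.isOpen_secDomain s) (c.contDiffOn_alongRep hX.1)
    (FibredChart.base_mem_secDomain hx)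

/-- A vertical field along `s` is a Jacobi field if and only if its lift solves the linearised
Hamilton-Cartan equations. -/
theorem solvesLinHC_jetLift_iff (hL : ContMDiff 𝓘(ℝ, JetModel n m) 𝓘(ℝ, ℝ) ∞ L)
    (hX : IsVerticalAlong n p s.toFun X) :
    SolvesLinHC s v L (jetLift s X) ↔ IsJacobiField v L s X := by
  rw [isJacobiField_iff hL]
  refine ⟨fun h => ⟨hX, fun c x hx u => ?_⟩, fun h Y hY c x hx => ?_⟩
  -- test with a vertical field that has the value `u^α ∂/∂y^α` at the point
  · obtain ⟨Y, hY, hYw⟩ := exists_verticalField_jet c (j := jetSection s x) hx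
      (w := ((0, u), 0)) rfl
    have h1 := h Y hY c x hx
    rw [linHC_jetLift hX c hx, ← FibredChart.jet_jetSection hx, hYw] at h1
    rw [← FibredChart.jet_jetSection hx]
    exact h1
  · rw [linHC_jetLift hX c hx]
    exact h.2 c x hx _

theorem isHCTangent_jetLift (hL : ContMDiff 𝓘(ℝ, JetModel n m) 𝓘(ℝ, ℝ) ∞ L)
    (hs : IsExtremal v L s) (hX : IsJacobiField v L s X) :
    IsHCTangent v L (jetSection s) (jetLift s X) :=
  (isHCTangent_iff hL hs).2 ⟨isVerticalAlong_jetLift hX.1, exists_verticalExtension_jetLift hX.1,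
    (solvesLinHC_jetLift_iff hL hX.1).2 hX⟩

/-- The lift is injective because its components contain those of `X`. -/
theorem jetLift_injective (hX : IsVerticalAlong n p s.toFun X)
    (hX' : IsVerticalAlong n p s.toFun X') (h : jetLift s X = jetLift s X') : X = X' := by
  funext x
  obtain ⟨c, hx⟩ := exists_fibredChart (p := p) (n := n) (m := m) (s.toFun x)
  have h1 := (c.jetAlongRep_jetLift hX (FibredChart.base_mem_secDomain hx)).symm.trans
    ((congrArg (fun W => c.jetAlongRep s W (c.base x)) h).trans
      (c.jetAlongRep_jetLift hX' (FibredChart.base_mem_secDomain hx)))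
  refine c.mfderiv_tot_injective hx ?_
  rw [c.mfderiv_tot_along hX hx, c.mfderiv_tot_along hX' hx]
  exact congrArg Prod.fst h1

end JetLift

/-! ### The projection to `E` and the regular case -/

section Projection

variable {n m : ℕ} {M E : Type*} [TopologicalSpace M] [ChartedSpace (Base n) M]
    [TopologicalSpace E] [ChartedSpace (Tot n m) E] {p : E → M}
    [IsManifold 𝓘(ℝ, Tot n m) ∞ E] [IsFibredManifold n m p]
    {s : FibSection n m p} {v : VolumeForm n M} {L : Jet1 n m p → ℝ}

/-- The projection to `E` of a vector field along `j¹s`. -/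
def projAlong (s : FibSection n m p)
    (W : ∀ x : M, TangentSpace 𝓘(ℝ, JetModel n m) (jetSection s x)) (x : M) :
    TangentSpace 𝓘(ℝ, Tot n m) (s.toFun x) :=
  (mfderiv 𝓘(ℝ, JetModel n m) 𝓘(ℝ, Tot n m) (proj10 (n := n) (m := m) (p := p)) (jetSection s x)
    (W x) : Tot n m)

variable {W : ∀ x : M, TangentSpace 𝓘(ℝ, JetModel n m) (jetSection s x)}

theorem FibredChart.mfderiv_tot_projAlong (c : FibredChart n m p) {x : M}
    (hx : s.toFun x ∈ c.tot.source) :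
    (mfderiv 𝓘(ℝ, Tot n m) 𝓘(ℝ, Tot n m) c.tot (s.toFun x) (projAlong s W x) : Tot n m) =
      (mfderiv 𝓘(ℝ, JetModel n m) 𝓘(ℝ, JetModel n m) c.jet (jetSection s x) (W x) :
        JetModel n m).1 :=
  c.mfderiv_tot_proj10 (j := jetSection s x) hx (W x)

theorem isVerticalAlong_projAlong (hW : IsVerticalAlong n proj1 (jetSection s) W) :
    IsVerticalAlong n p s.toFun (projAlong s W) := by
  refine ⟨fun x => ?_, fun x => ?_⟩
  · obtain ⟨c, hx⟩ := exists_fibredChart (p := p) (n := n) (m := m) (s.toFun x)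
    refine contMDiffAt_field_of_coord c.tot_mem hx (s.smooth x) ?_
    have h1 := contMDiffAt_coord_of_field (f := jetSection s) c.jetChart_mem (x₀ := x) hx (hW.1 x)
    have h2 : ContMDiffAt 𝓘(ℝ, JetModel n m) 𝓘(ℝ, Tot n m) ∞ (fun z : JetModel n m => z.1)
        (mfderiv 𝓘(ℝ, JetModel n m) 𝓘(ℝ, JetModel n m) c.jet (jetSection s x) (W x)) :=
      contDiffAt_fst.contMDiffAt
    refine (ContMDiffAt.comp x h2 h1).congr_of_eventuallyEq ?_
    filter_upwards [(c.tot.open_source.preimage s.smooth.continuous).mem_nhds hx] with x' hx'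
    exact c.mfderiv_tot_projAlong hx'
  · obtain ⟨c, hx⟩ := exists_fibredChart (p := p) (n := n) (m := m) (s.toFun x)
    rw [c.mfderiv_proj_eq_zero_iff hx, c.mfderiv_tot_projAlong hx]
    exact (c.mfderiv_proj1_eq_zero_iff (j := jetSection s x) hx (W x)).1 (hW.2 x)

theorem FibredChart.alongRep_projAlong (c : FibredChart n m p) {ξ : Base n}
    (hξ : ξ ∈ c.secDomain s) :
    c.alongRep s (projAlong s W) ξ = (c.jetAlongRep s W ξ).1.2 :=
  congrArg (fun w : Tot n m => w.2) (c.mfderiv_tot_projAlong hξ.2)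

variable [T2Space E]

/-- For a regular Lagrangian, the Hamilton-Cartan equations in the directions `∂/∂y^α_i` force the
components `y^α_i` of a solution to be the derivatives of the components `y^α`. -/
theorem IsRegularLagrangian.jetAlongRep_eq (hreg : IsRegularLagrangian L)
    (hL : ContMDiff 𝓘(ℝ, JetModel n m) 𝓘(ℝ, ℝ) ∞ L)
    (hW : IsVerticalAlong n proj1 (jetSection s) W) (hW' : SolvesLinHC s v L W)
    (c : FibredChart n m p) {ξ : Base n} (hξ : ξ ∈ c.secDomain s) :
    c.jetAlongRep s W ξ = flatLift (c.alongRep s (projAlong s W)) ξ := by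
  set x := c.base.symm ξ with hxdef
  have hx : s.toFun x ∈ c.tot.source := hξ.2
  have hxξ : c.base x = ξ := c.base.right_inv hξ.1
  have hz : c.holonomicRep s.toFun ξ ∈ c.jetChart.target := c.holonomicRep_mem hξ
  have hJ := ((c.contDiffOn_jetAlongRep hW).contDiffAt
    ((c.isOpen_secDomain s).mem_nhds hξ)).differentiableAt (by simp)
  -- in a direction `y = ζ^α_i ∂/∂y^α_i` only the second summand of `linHC` is left
  have h0 : (projFib n m).comp (fderiv ℝ (c.jetAlongRep s W) ξ) - (c.jetAlongRep s W ξ).2 = 0 := by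
    refine hreg.eq_zero (v := v) hL c hz fun ζ => ?_
    obtain ⟨Y, hY, hYw⟩ := exists_verticalField_jet c (j := jetSection s x) hx
      (w := slopeIncl n m ζ) rfl
    have h1 := hW' Y hY c x hx
    rw [← FibredChart.jet_jetSection hx, hYw, linHC, FibredChart.jet_jetSection hx, hxξ,
      show (slopeIncl n m ζ).1.2 = 0 from rfl, linEL_zero_left, zero_add] at h1
    exact h1
  have e : c.alongRep s (projAlong s W) =ᶠ[𝓝 ξ] projFib n m ∘ c.jetAlongRep s W := by
    filter_upwards [(c.isOpen_secDomain s).mem_nhds hξ] with η hη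
    exact c.alongRep_projAlong hη
  have h2 : fderiv ℝ (c.alongRep s (projAlong s W)) ξ =
      (projFib n m).comp (fderiv ℝ (c.jetAlongRep s W) ξ) := by
    rw [e.fderiv_eq]
    exact ((projFib n m).hasFDerivAt.comp ξ hJ.hasFDerivAt).fderiv
  refine Prod.ext (Prod.ext (c.jetAlongRep_vertical hW hξ) (c.alongRep_projAlong hξ).symm) ?_
  exact (sub_eq_zero.1 h0).symm.trans h2.symm

/-- For a regular Lagrangian, every solution to the linearised Hamilton-Cartan equations along `j¹s`
is the lift of its projection. -/
theorem IsRegularLagrangian.jetLift_projAlong [SigmaCompactSpace E] (hreg : IsRegularLagrangian L)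
    (hL : ContMDiff 𝓘(ℝ, JetModel n m) 𝓘(ℝ, ℝ) ∞ L)
    (hW : IsVerticalAlong n proj1 (jetSection s) W) (hW' : SolvesLinHC s v L W) :
    jetLift s (projAlong s W) = W := by
  funext x
  set c : FibredChart n m p := fibredChartAt (s.toFun x) with hc
  have hx : s.toFun x ∈ c.tot.source := mem_fibredChartAt_source (s.toFun x)
  refine c.mfderiv_jet_injective (j := jetSection s x) hx ?_
  refine (c.mfderiv_jet_jetVec (j := jetSection s x) hx _).trans ?_
  rw [← hc, ← hreg.jetAlongRep_eq hL hW hW' c (FibredChart.base_mem_secDomain hx)]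
  have h := c.base.left_inv (FibredChart.mem_base_source hx)
  unfold FibredChart.jetAlongRep
  rw [h]

end Projection

/-! ### The comparison map -/

section Isomorphism

variable {n m : ℕ} {M E : Type*} [TopologicalSpace M] [ChartedSpace (Base n) M]
    [TopologicalSpace E] [ChartedSpace (Tot n m) E] {p : E → M}
    [IsManifold 𝓘(ℝ, Tot n m) ∞ E] [IsFibredManifold n m p] [T2Space E] [SigmaCompactSpace E]
    {s : FibSection n m p} {v : VolumeForm n M} {L : Jet1 n m p → ℝ}

/-- The map `X ↦ jetLift s X` from the Jacobi fields along the extremal `s` to the tangent space at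
`j¹s` to the solutions to the Hamilton-Cartan equations. -/
def jetLiftMap (hL : ContMDiff 𝓘(ℝ, JetModel n m) 𝓘(ℝ, ℝ) ∞ L) (hs : IsExtremal v L s) :
    jacobiSpace hL v s →ₗ[ℝ] hcTangentSpace hL hs where
  toFun X := ⟨jetLift s X.1, isHCTangent_jetLift hL hs X.2⟩
  map_add' X X' := Subtype.ext <| by
    have h := jetLift_add_smul X.2.1 X'.2.1 1
    rw [one_smul, one_smul] at h
    exact h
  map_smul' r X := Subtype.ext <| by
    have h := jetLift_add_smul (isVerticalAlong_zero (q := p) s.smooth) X.2.1 r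
    rw [zero_add, jetLift_zero, zero_add] at h
    exact h

theorem jetLiftMap_injective (hL : ContMDiff 𝓘(ℝ, JetModel n m) 𝓘(ℝ, ℝ) ∞ L)
    (hs : IsExtremal v L s) : Function.Injective (jetLiftMap hL hs) := fun X X' h =>
  Subtype.ext (jetLift_injective X.2.1 X'.2.1 (congrArg Subtype.val h))

theorem IsRegularLagrangian.jetLiftMap_surjective (hreg : IsRegularLagrangian L)
    (hL : ContMDiff 𝓘(ℝ, JetModel n m) 𝓘(ℝ, ℝ) ∞ L)
    (hs : IsExtremal v L s) : Function.Surjective (jetLiftMap hL hs) := by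
  intro W
  obtain ⟨hW, -, hW'⟩ := (isHCTangent_iff hL hs).1 W.2
  have h := hreg.jetLift_projAlong hL hW hW'
  refine ⟨⟨projAlong s W.1, ?_⟩, Subtype.ext h⟩
  refine (solvesLinHC_jetLift_iff hL (isVerticalAlong_projAlong hW)).1 ?_
  rw [h]
  exact hW'

end Isomorphism

end FibredJet

end

theorem propositionp2 {n m : ℕ}
    {M : Type*} [TopologicalSpace M] [ChartedSpace (Base n) M]
    [IsManifold 𝓘(ℝ, Base n) ∞ M] [T2Space M] [SigmaCompactSpace M]
    {E : Type*} [TopologicalSpace E] [ChartedSpace (Tot n m) E]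
    [IsManifold 𝓘(ℝ, Tot n m) ∞ E] [T2Space E] [SigmaCompactSpace E]
    (p : E → M) [IsFibredManifold n m p]
    (v : VolumeForm n M)
    (L : Jet1 n m p → ℝ) (hL : ContMDiff 𝓘(ℝ, JetModel n m) 𝓘(ℝ, ℝ) ∞ L)
    (s : FibSection n m p) (hs : IsExtremal v L s) :
    IsHCSolution v L (jetSection s) ∧
    (∀ X Z, IsHCTangent v L (jetSection s) X →
      IsVerticalExtension n proj1 (jetSection s) X Z → LinearisedHC v L (jetSection s) Z) ∧
    ∃ (J : Submodule ℝ (∀ x : M, TangentSpace 𝓘(ℝ, Tot n m) (s.toFun x)))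
      (T : Submodule ℝ (∀ x : M, TangentSpace 𝓘(ℝ, JetModel n m) (jetSection s x))),
      (∀ X, X ∈ J ↔ IsJacobiField v L s X) ∧
      (∀ X, X ∈ T ↔ IsHCTangent v L (jetSection s) X) ∧
      ∃ Φ : J →ₗ[ℝ] T,
        (∀ X : J,
          (∃ Y, IsVerticalExtension n p s.toFun X.1 Y) ∧
          ∀ Y, IsVerticalExtension n p s.toFun X.1 Y →
            (∃ Z, IsJetProlongation (p := p) Y Z) ∧
            ∀ Z, IsJetProlongation (p := p) Y Z → ∀ x, (Φ X).1 x = Z (jetSection s x)) ∧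
        Function.Injective Φ ∧
        (IsRegularLagrangian L → Function.Bijective Φ) :=
  ⟨isHCSolution_jetSection hL hs,
    fun _ _ hX hZ => (linearisedHC_iff hL hs hZ).2 ((isHCTangent_iff hL hs).1 hX).2.2,
    jacobiSpace hL v s, hcTangentSpace hL hs, fun _ => Iff.rfl, fun _ => Iff.rfl,
    jetLiftMap hL hs,
    fun X => ⟨exists_verticalExtension X.2.1, fun Y hY =>
      ⟨⟨jetProlongation Y, isJetProlongation_jetProlongation hY.1⟩,
        fun _ hZ x => (hZ.eq_jetLift hY x).symm⟩⟩,
    jetLiftMap_injective hL hs,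
    fun hreg => ⟨jetLiftMap_injective hL hs, hreg.jetLiftMap_surjective hL hs⟩⟩
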